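/- **Setting.** Let $\Phi^t$, $t\in\mathbb R$, be a continuous flow on a metric space $\mathcal M$ with an ergodic invariant Borel probability measure $\mu$, which is concentrated on its support $X$; let $X$ be compact and contained in a compact set $K$ with $\Phi^t(K)\subseteq K$ for $t\ge 0$. Put $H=L^2(\mu)$ (complex), $\tilde H=\{f\in H:\int f\,d\mu=0\}$, and let $V$ be the generator of the Koopman group $U^tf=f\circ\Phi^t$ on $H$, with spectral measure $E$, $U^t=\int_{i\mathbb R}e^{t\lambda}\,dE(\lambda)$. Let $\Pi_+=E(i(0,\infty))$, $\Pi_-=E(i(-\infty,0))$, $H_+=\Pi_+H$. Let $p_\tau:\mathcal M\times\mathcal M\to[0,\infty)$, $\tau>0$, be measurable kernels, continuous on $K\times K$, with $\int p_\tau(x,\cdot)\,d\mu=1$ for $x\in K$, whose integral operators $G_\tau f=\int p_\tau(\cdot,y)f(y)\,d\mu(y)$ on $H$ form a strongly continuous semigroup ($G_\tau G_{\tau'}=G_{\tau+\tau'}$, and $G_\tau f\to f$ as $\tau\to0^+$), satisfy $\langle f,G_\tau f\rangle>0$ for every $f\neq0$, and are ergodic ($G_\tau f=f$ for all $\tau>0$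 iff $f$ is $\mu$-a.e. constant). Fix $z,\tau>0$. For a bounded operator $A$ write $|A|=\sqrt{A^*A}$. Let $R_z^\pm=\Pi_\pm(z-V)^{-1}$, $S_z^\pm=|R_z^\pm|$, $S^\pm_{z,\tau}=\sqrt{S_z^\pm}\,G_\tau\sqrt{S_z^\pm}$ and $S_{z,\tau}=S^+_{z,\tau}-S^-_{z,\tau}$, all regarded as operators on $\tilde H$. Let $(\psi_{j})_{j\ge1}$ be an orthonormal basis of $H_+$ with $S^+_{z,\tau}\psi_j=e_{j,\tau}\psi_j$ and $e_{1,\tau}\ge e_{2,\tau}\ge\cdots$, let $\Psi^{+,(M)}$ and $\Psi^{-,(M)}$ be the orthogonal projections of $\tilde H$ onto $\operatorname{span}\{\psi_1,\dots,\psi_M\}$ and $\operatorname{span}\{\psi_1^*,\dots,\psi_M^*\}$ (${}^*$ on functions is complex conjugation), and put $$S^{(M)}_{z,\tau}=\Psi^{+,(M)}S^+_{z,\tau}\Psi^{+,(M)}-\Psi^{-,(M)}S^-_{z,\tau}\Psi^{-,(M)}.$$ Let $(\phi_j)_{j\ge1}$ be an orthonormal basis of $\tilde H$ of real eigenfunctions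 of $G_\tau$, with eigenvalues in decreasing order, and let $\Pi_L$ be the orthogonal projection onto $\operatorname{span}\{\phi_1,\dots,\phi_L\}$. On $\tilde H$ let $\tilde S^\pm_{z,L}=|\Pi_LR_z^\pm\Pi_L|$ and $S^\pm_{z,\tau,L}=\sqrt{\tilde S^\pm_{z,L}}\,G_\tau\sqrt{\tilde S^\pm_{z,L}}$. For each $L$ let $(\xi_{j,L})_{j\ge1}$ be an orthonormal basis of $\tilde H$ of eigenfunctions of $S^+_{z,\tau,L}$, with eigenvalues in decreasing order, let $\Xi_L^{(M)}$ and $\bar\Xi_L^{(M)}$ be the orthogonal projections onto $\operatorname{span}\{\xi_{1,L},\dots,\xi_{M,L}\}$ and $\operatorname{span}\{\xi_{1,L}^*,\dots,\xi_{M,L}^*\}$, and put $$S^{(M)}_{z,\tau,L}=\Xi_L^{(M)}S^+_{z,\tau,L}\Xi_L^{(M)}-\bar\Xi_L^{(M)}S^-_{z,\tau,L}\bar\Xi_L^{(M)}.$$ **Spectral convergence.** Self-adjoint operators $A_n$ converge spectrally to a compact self-adjoint operator $A$ if for every nonzero eigenvalue $\lambda$ of $A$, of multiplicity $m$, which is finite,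 and every open neighborhood $O\subseteq\mathbb C$ of $\lambda$ with $\sigma(A)\cap\overline O=\{\lambda\}$: for all large $n$ the set $\sigma(A_n)\cap O$ consists of at most $m$ eigenvalues, whose multiplicities sum to $m$; every sequence $\lambda_n\in\sigma(A_n)\cap O$ converges to $\lambda$; and the orthogonal projections onto the span of the eigenspaces of $A_n$ for the eigenvalues in $\sigma(A_n)\cap O$ converge strongly to the orthogonal projection onto the eigenspace of $A$ for $\lambda$. **Proposition.** There is a closed interval $\tilde I_{z,\tau}\subset(-1/z,1/z)$ that contains $\sigma(-S^-_{z,\tau})\cup\sigma(S^+_{z,\tau})$ and such that for every integer $M\ge1$ with $e_{M+1,\tau}\ne e_{M,\tau}$ there is $L_*\in\mathbb N$ such that for all $L>L_*$: (i) $S^{(M)}_{z,\tau,L}$ has rank $2M$; (ii) $\sigma(S^{(M)}_{z,\tau,L})\subseteq\tilde I_{z,\tau}$. Moreover: (iii) for every such $M$, as $L\to\infty$, $S^{(M)}_{z,\tau,L}$ converges in operator norm, and spectrally, to $S^{(M)}_{z,\tau}$; (iv) as $M\to\infty$, $S^{(M)}_{z,\tau}$ converges in operator norm, and spectrally, to $S_{z,\tau}$.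 -/

import Mathlib

open MeasureTheory Filter Topology
open scoped InnerProductSpace

noncomputable section

namespace ResolventCompactification

section OperatorTheory

variable {E : Type*} [NormedAddCommGroup E] [InnerProductSpace ℂ E] [CompleteSpace E]

/-- `R` is the bounded inverse `(z I - V)⁻¹` of the (possibly unbounded) operator `z I - V`. -/
def IsResolventAt (V : E →ₗ.[ℂ] E) (z : ℂ) (R : E →L[ℂ] E) : Prop :=
  (∀ f : V.domain, R (z • (f : E) - V f) = f) ∧
    ∀ f : E, ∃ h : R f ∈ V.domain, z • R f - V ⟨R f, h⟩ = f

open Classical in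
/-- The resolvent `R_z(V) = (z I - V)⁻¹`, a bounded operator if `z` is in the resolvent set of `V`
(and `0` by convention otherwise). -/
def resolventOp (V : E →ₗ.[ℂ] E) (z : ℂ) : E →L[ℂ] E :=
  if h : ∃ R : E →L[ℂ] E, IsResolventAt V z R then h.choose else 0

/-- `ν` is the spectral measure of the vector `f` for the unitary group `U`: the finite Borel
measure on the frequency axis with `⟨f, U^t f⟩ = ∫ e^{i ω t} dν(ω)` for all `t`, that is,
`ν(Θ) = ⟨f, E(iΘ) f⟩` for the projection-valued measure `E` with `U^t = ∫ e^{t λ} dE(λ)`. -/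
def IsVectorSpectralMeasure (U : ℝ → E →L[ℂ] E) (f : E) (ν : Measure ℝ) : Prop :=
  IsFiniteMeasure ν ∧
    ∀ t : ℝ, ⟪f, U t f⟫_ℂ = ∫ ω : ℝ, Complex.exp (Complex.I * (ω : ℂ) * (t : ℂ)) ∂ν

/-- The spectral subspace `ran E(iΘ)` of the unitary group `U = ∫ e^{t λ} dE(λ)`, for a Borel set
`Θ ⊆ ℝ` of frequencies: the closed subspace of the vectors whose spectral measure is concentrated
on `Θ` (these are the `f` with `‖E(iΘᶜ) f‖² = ν(Θᶜ) = 0`). -/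
def spectralSubspace (U : ℝ → E →L[ℂ] E) (Θ : Set ℝ) : Submodule ℂ E :=
  (Submodule.span ℂ {f : E | ∃ ν : Measure ℝ,
    IsVectorSpectralMeasure U f ν ∧ ν Θᶜ = 0}).topologicalClosure

/-- The spectral projection `E(iΘ)` of the unitary group `U`. -/
def spectralProjection (U : ℝ → E →L[ℂ] E) (Θ : Set ℝ) : E →L[ℂ] E :=
  haveI : CompleteSpace (spectralSubspace U Θ) :=
    (Submodule.isClosed_topologicalClosure _).completeSpace_coe
  (spectralSubspace U Θ).starProjection

/-- The compression of `A` to the closed subspace `W`; for an operator leaving `W` invariant this is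
its restriction `A|_W : W → W`. -/
def restrictTo (W : Submodule ℂ E) [W.HasOrthogonalProjection] (A : E →L[ℂ] E) : W →L[ℂ] W :=
  W.orthogonalProjectionOnto ∘L A ∘L W.subtypeL

/-- The orthogonal projection onto the closed linear span of a set of vectors. -/
def projSpan (s : Set E) : E →L[ℂ] E :=
  haveI : CompleteSpace (Submodule.span ℂ s).topologicalClosure :=
    (Submodule.isClosed_topologicalClosure _).completeSpace_coe
  (Submodule.span ℂ s).topologicalClosure.starProjection

/-- The modulus `|A| = √(A^* A)`. -/
def opAbs (A : E →L[ℂ] E) : E →L[ℂ] E := CFC.abs A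

/-- `√B G √B` for a positive operator `B`. -/
def sandwich (B G : E →L[ℂ] E) : E →L[ℂ] E :=
  CFC.sqrt B ∘L G ∘L CFC.sqrt B

/-- `v 1, v 2, …` is an orthonormal basis of the closed subspace `W` that consists of eigenvectors
of `A` with real eigenvalues `e 1 ≥ e 2 ≥ …` (repeated according to multiplicity). -/
structure IsEigendecomposition (A : E →L[ℂ] E) (W : Submodule ℂ E) (e : ℕ+ → ℝ) (v : ℕ+ → E) :
    Prop where
  orthonormal : Orthonormal ℂ v
  closure_span : (Submodule.span ℂ (Set.range v)).topologicalClosure = W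
  apply_eq : ∀ j, A (v j) = (e j : ℂ) • v j
  antitone : Antitone e

/-- The eigenspace of `A` with eigenvalue `c`. -/
def eigSpace (A : E →L[ℂ] E) (c : ℂ) : Submodule ℂ E :=
  Module.End.eigenspace (A : E →ₗ[ℂ] E) c

/-- For a self-adjoint `A`: the orthogonal projection onto the span of the eigenspaces of `A` with
eigenvalues in `O`. -/
def eigProjection (A : E →L[ℂ] E) (O : Set ℂ) : E →L[ℂ] E :=
  projSpan {f : E | ∃ c ∈ O, f ∈ eigSpace A c}

/-- Spectral convergence of self-adjoint operators `A n` to the compact self-adjoint operator `B`.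
For each nonzero eigenvalue `c` of `B`, of multiplicity `m`, and each open neighborhood `O` of `c`
whose closure meets the spectrum of `B` in `c` only: eventually the spectrum of `A n` in `O` consists
of at most `m` eigenvalues, whose multiplicities sum to `m`; all elements of these sets converge to
`c`; and the corresponding spectral projections converge strongly. (Multiplicities are dimensions of
eigenspaces, the operators being self-adjoint.) -/
def SpectrallyConverges {ι : Type*} (l : Filter ι) (A : ι → E →L[ℂ] E) (B : E →L[ℂ] E) : Prop :=
  ∀ c : ℂ, c ≠ 0 → eigSpace B c ≠ ⊥ →
    ∀ O : Set ℂ, IsOpen O → c ∈ O → spectrum ℂ B ∩ closure O = {c} →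
      FiniteDimensional ℂ (eigSpace B c) ∧
      (∀ᶠ n in l,
        (spectrum ℂ (A n) ∩ O).Finite ∧
        (spectrum ℂ (A n) ∩ O).ncard ≤ Module.finrank ℂ (eigSpace B c) ∧
        (∀ b ∈ spectrum ℂ (A n) ∩ O,
          eigSpace (A n) b ≠ ⊥ ∧ FiniteDimensional ℂ (eigSpace (A n) b)) ∧
        ∑ᶠ b ∈ spectrum ℂ (A n) ∩ O, Module.finrank ℂ (eigSpace (A n) b) =
          Module.finrank ℂ (eigSpace B c)) ∧
      (∀ b : ι → ℂ, (∀ᶠ n in l, b n ∈ spectrum ℂ (A n) ∩ O) → Tendsto b l (𝓝 c)) ∧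
      ∀ f : E, Tendsto (fun n => eigProjection (A n) (spectrum ℂ (A n) ∩ O) f) l
        (𝓝 (eigProjection B {c} f))

end OperatorTheory

/-- A continuous flow on a metric space with an ergodic invariant Borel probability measure `μ` of
compact support `X`, and a compact forward-invariant set `K ⊇ X`. -/
structure ErgodicFlow (𝓜 : Type*) [MetricSpace 𝓜] [MeasurableSpace 𝓜] [BorelSpace 𝓜] where
  flow : Flow ℝ 𝓜
  μ : Measure 𝓜
  isProbabilityMeasure : IsProbabilityMeasure μ
  invariant : ∀ t : ℝ, MeasurePreserving (flow t) μ μ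
  ergodic : ∀ s : Set 𝓜, MeasurableSet s → (∀ t : ℝ, flow t ⁻¹' s = s) → μ s = 0 ∨ μ s = 1
  isCompact_support : IsCompact μ.support
  measure_compl_support : μ μ.supportᶜ = 0
  K : Set 𝓜
  isCompact_K : IsCompact K
  forward_invariant : ∀ t : ℝ, 0 ≤ t → Set.MapsTo (flow t) K K
  support_subset : μ.support ⊆ K

namespace ErgodicFlow

variable {𝓜 : Type*} [MetricSpace 𝓜] [MeasurableSpace 𝓜] [BorelSpace 𝓜] (D : ErgodicFlow 𝓜)

instance : IsProbabilityMeasure D.μ := D.isProbabilityMeasure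

/-- The Hilbert space `H = L²(μ)`. -/
abbrev H : Type _ := Lp ℂ 2 D.μ

/-- The constant function `1`, as an element of `H`. -/
def one : D.H := Lp.const 2 D.μ (1 : ℂ)

/-- The closed subspace `H̃ = {f ∈ H : ⟨1, f⟩ = 0}` of zero-mean functions. -/
abbrev Htilde : Submodule ℂ D.H := (Submodule.span ℂ {D.one})ᗮ

/-- The Koopman operators `U^t f = f ∘ Φ^t` on `H`. -/
def koopman (t : ℝ) : D.H →L[ℂ] D.H :=
  (Lp.compMeasurePreservingₗᵢ ℂ (D.flow t) (D.invariant t)).toContinuousLinearMap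

/-- The generator of the Koopman group: `V f = lim_{t → 0} (U^t f - f) / t`, on the domain of all `f`
for which this limit exists in `H`. -/
def generator : D.H →ₗ.[ℂ] D.H where
  domain :=
    { carrier := {f | DifferentiableAt ℝ (fun t : ℝ => D.koopman t f) 0}
      zero_mem' := by simp
      add_mem' := by
        intro f g hf hg
        simp only [Set.mem_ofPred_eq, map_add] at *
        exact hf.add hg
      smul_mem' := by
        intro c f hf
        simp only [Set.mem_ofPred_eq, map_smul] at *
        exact hf.const_smul c }
  toFun :=
    { toFun := fun f => deriv (fun t : ℝ => D.koopman t (f : D.H)) 0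
      map_add' := by
        intro f g
        simp only [Submodule.coe_add, map_add]
        exact deriv_fun_add f.2 g.2
      map_smul' := by
        intro c f
        simp only [Submodule.coe_smul, map_smul, RingHom.id_apply]
        exact deriv_fun_const_smul c f.2 }

/-- The positive-frequency subspace `H₊ = ran E(i(0,∞))`. -/
def Hplus : Submodule ℂ D.H := spectralSubspace D.koopman (Set.Ioi 0)

/-- The spectral projection `Π₊ = E(i(0,∞))`. -/
def projPlus : D.H →L[ℂ] D.H := spectralProjection D.koopman (Set.Ioi 0)

/-- The spectral projection `Π₋ = E(i(-∞,0))`. -/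
def projMinus : D.H →L[ℂ] D.H := spectralProjection D.koopman (Set.Iio 0)

/-- The positive-frequency part `R_z⁺(V) = Π₊ R_z(V)` of the resolvent. -/
def resPlus (z : ℝ) : D.H →L[ℂ] D.H := D.projPlus ∘L resolventOp D.generator (z : ℂ)

/-- The negative-frequency part `R_z⁻(V) = Π₋ R_z(V)` of the resolvent. -/
def resMinus (z : ℝ) : D.H →L[ℂ] D.H := D.projMinus ∘L resolventOp D.generator (z : ℂ)

theorem star_mem_Htilde {f : D.H} (hf : f ∈ D.Htilde) : star f ∈ D.Htilde := by
  have key : ∀ g : D.H, ⟪D.one, g⟫_ℂ = ∫ x, g x ∂D.μ := by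
    intro g
    rw [L2.inner_def]
    refine integral_congr_ae ?_
    filter_upwards [Lp.coeFn_const (p := 2) (μ := D.μ) (1 : ℂ)] with x hx
    have hx' : (D.one : D.H) x = 1 := hx
    simp [hx']
  rw [Submodule.mem_orthogonal_singleton_iff_inner_right, key] at *
  have h : ∫ x, (star f : D.H) x ∂D.μ = ∫ x, (starRingEnd ℂ) (f x) ∂D.μ := by
    refine integral_congr_ae ?_
    filter_upwards [Lp.coeFn_star f] with x hx
    rw [hx]
    rfl
  rw [h, integral_conj, hf, map_zero]

/-- Complex conjugation `J f = f^*` on `H̃`. -/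
def conj (f : D.Htilde) : D.Htilde := ⟨star (f : D.H), D.star_mem_Htilde f.2⟩

/-- `G` is the integral operator `G f = ∫ k(·, x) f(x) dμ(x)` on `H`. -/
def IsIntegralOperator (k : 𝓜 → 𝓜 → ℝ) (G : D.H →L[ℂ] D.H) : Prop :=
  ∀ f : D.H, (G f : 𝓜 → ℂ) =ᵐ[D.μ] fun x => ∫ y, (k x y : ℂ) * f y ∂D.μ

open Classical in
/-- The integral operator on `H` with kernel `k` (and `0` by convention if the kernel does not
induce a bounded operator on `H`). -/
def integralOperator (k : 𝓜 → 𝓜 → ℝ) : D.H →L[ℂ] D.H :=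
  if h : ∃ G : D.H →L[ℂ] D.H, D.IsIntegralOperator k G then h.choose else 0

end ErgodicFlow

/-- A family of kernels `p_τ`, `τ > 0`, that are measurable, continuous on `K × K` and Markovian with
respect to `μ`, and whose integral operators `G_τ` form a strongly continuous, strictly positive,
ergodic semigroup on `H`. -/
structure MarkovKernelFamily {𝓜 : Type*} [MetricSpace 𝓜] [MeasurableSpace 𝓜] [BorelSpace 𝓜]
    (D : ErgodicFlow 𝓜) where
  p : ℝ → 𝓜 → 𝓜 → ℝ
  measurable : ∀ τ, 0 < τ → Measurable (Function.uncurry (p τ))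
  continuousOn : ∀ τ, 0 < τ → ContinuousOn (Function.uncurry (p τ)) (D.K ×ˢ D.K)
  nonneg : ∀ τ, 0 < τ → ∀ x y, 0 ≤ p τ x y
  integral_eq_one : ∀ τ, 0 < τ → ∀ x ∈ D.K, ∫ y, p τ x y ∂D.μ = 1
  semigroup : ∀ τ τ', 0 < τ → 0 < τ' →
    D.integralOperator (p τ) ∘L D.integralOperator (p τ') = D.integralOperator (p (τ + τ'))
  tendsto_zero : ∀ f : D.H, Tendsto (fun τ => D.integralOperator (p τ) f) (𝓝[>] 0) (𝓝 f)
  strictly_positive : ∀ τ, 0 < τ → ∀ f : D.H, f ≠ 0 →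
    0 < (⟪f, D.integralOperator (p τ) f⟫_ℂ).re ∧ (⟪f, D.integralOperator (p τ) f⟫_ℂ).im = 0
  ergodic : ∀ f : D.H, (∀ τ, 0 < τ → D.integralOperator (p τ) f = f) ↔
    ∃ c : ℂ, (f : 𝓜 → ℂ) =ᵐ[D.μ] fun _ => c

namespace MarkovKernelFamily

variable {𝓜 : Type*} [MetricSpace 𝓜] [MeasurableSpace 𝓜] [BorelSpace 𝓜] {D : ErgodicFlow 𝓜}
  (P : MarkovKernelFamily D)

/-- The Markov operator `G_τ` on `H`. -/
def G (τ : ℝ) : D.H →L[ℂ] D.H := D.integralOperator (P.p τ)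

/-- The Markov operator `G_τ` on `H̃`. -/
def Gtilde (τ : ℝ) : D.Htilde →L[ℂ] D.Htilde := restrictTo D.Htilde (P.G τ)

/-- `S⁺_{z,τ} = √S_z⁺ G_τ √S_z⁺` with `S_z⁺ = |R_z⁺(V)|`, viewed as an operator on `H̃`. -/
def SPlus (z τ : ℝ) : D.Htilde →L[ℂ] D.Htilde :=
  restrictTo D.Htilde (sandwich (opAbs (D.resPlus z)) (P.G τ))

/-- `S⁻_{z,τ} = √S_z⁻ G_τ √S_z⁻` with `S_z⁻ = |R_z⁻(V)|`, viewed as an operator on `H̃`. -/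
def SMinus (z τ : ℝ) : D.Htilde →L[ℂ] D.Htilde :=
  restrictTo D.Htilde (sandwich (opAbs (D.resMinus z)) (P.G τ))

/-- `S_{z,τ} = S⁺_{z,τ} - S⁻_{z,τ}` on `H̃`. -/
def S (z τ : ℝ) : D.Htilde →L[ℂ] D.Htilde := P.SPlus z τ - P.SMinus z τ

/-- The projection onto the span of the first `M` vectors of the sequence `v`. -/
def leadProj (v : ℕ+ → D.Htilde) (M : ℕ) : D.Htilde →L[ℂ] D.Htilde :=
  projSpan {f | ∃ j : ℕ+, (j : ℕ) ≤ M ∧ f = v j}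

/-- The projection onto the span of the complex conjugates of the first `M` vectors of `v`. -/
def leadProjConj (v : ℕ+ → D.Htilde) (M : ℕ) : D.Htilde →L[ℂ] D.Htilde :=
  leadProj (fun j => D.conj (v j)) M

/-- `S^{(M)}_{z,τ} = Ψ⁺ S⁺_{z,τ} Ψ⁺ - Ψ⁻ S⁻_{z,τ} Ψ⁻`, where `Ψ⁺` and `Ψ⁻` are the projections onto
`span {ψ_1, …, ψ_M}` and `span {ψ_1^*, …, ψ_M^*}`. -/
def SM (z τ : ℝ) (ψ : ℕ+ → D.Htilde) (M : ℕ) : D.Htilde →L[ℂ] D.Htilde :=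
  leadProj ψ M ∘L P.SPlus z τ ∘L leadProj ψ M -
    leadProjConj ψ M ∘L P.SMinus z τ ∘L leadProjConj ψ M

/-- `|Π_L R_z⁺(V) Π_L|` on `H̃`, where `Π_L` projects onto `span {φ_1, …, φ_L}`. -/
def absPlusL (z : ℝ) (φ : ℕ+ → D.Htilde) (L : ℕ) : D.Htilde →L[ℂ] D.Htilde :=
  opAbs (leadProj φ L ∘L restrictTo D.Htilde (D.resPlus z) ∘L leadProj φ L)

/-- `|Π_L R_z⁻(V) Π_L|` on `H̃`, where `Π_L` projects onto `span {φ_1, …, φ_L}`. -/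
def absMinusL (z : ℝ) (φ : ℕ+ → D.Htilde) (L : ℕ) : D.Htilde →L[ℂ] D.Htilde :=
  opAbs (leadProj φ L ∘L restrictTo D.Htilde (D.resMinus z) ∘L leadProj φ L)

/-- `S⁺_{z,τ,L}` on `H̃`. -/
def SPlusL (z τ : ℝ) (φ : ℕ+ → D.Htilde) (L : ℕ) : D.Htilde →L[ℂ] D.Htilde :=
  sandwich (absPlusL z φ L) (P.Gtilde τ)

/-- `S⁻_{z,τ,L}` on `H̃`. -/
def SMinusL (z τ : ℝ) (φ : ℕ+ → D.Htilde) (L : ℕ) : D.Htilde →L[ℂ] D.Htilde :=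
  sandwich (absMinusL z φ L) (P.Gtilde τ)

/-- `S^{(M)}_{z,τ,L} = Ξ S⁺_{z,τ,L} Ξ - Ξ̄ S⁻_{z,τ,L} Ξ̄`, where `Ξ` and `Ξ̄` are the projections onto
`span {ξ_1, …, ξ_M}` and `span {ξ_1^*, …, ξ_M^*}`. -/
def SML (z τ : ℝ) (φ : ℕ+ → D.Htilde) (ξ : ℕ+ → D.Htilde) (M L : ℕ) :
    D.Htilde →L[ℂ] D.Htilde :=
  leadProj ξ M ∘L P.SPlusL z τ φ L ∘L leadProj ξ M -
    leadProjConj ξ M ∘L P.SMinusL z τ φ L ∘L leadProjConj ξ M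

end MarkovKernelFamily

end ResolventCompactification

end

set_option linter.unusedSectionVars false
set_option linter.style.haveILetI false

noncomputable section

namespace ResolventCompactification

universe u

/-! ### Eigenbases of compact self-adjoint operators; pairs of projections -/

section Spectral

variable {E : Type u} [NormedAddCommGroup E] [InnerProductSpace ℂ E] [CompleteSpace E]

/-! Complex conjugation `J` on the zero-mean functions is antiunitary, commutes with the Koopman
group and with `G_τ`, and exchanges positive and negative frequencies. Hence every minus operator is
`J A J⁻¹` for the corresponding plus operator `A` (`SMinus_eq`, and `SMinusL_eq`, where the reality
of the `φ_j` enters). All differences in the statement then have the form `X - J X J⁻¹` with `X`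
equal to `A` or to a compression of `A` to leading eigenvectors, so only the plus part has to be
studied. The abstract conclusion is `diffCompr_convergence`.

Norm convergence in `L` comes from compactness of `G_τ`, a Hilbert–Schmidt operator because its
kernel is bounded on `K × K`. The compressions `Π_L R Π_L` and their adjoints converge only
strongly, and strong convergence passes to `|·|` and to `√|·|`. Multiplying by the compact `G_τ` on
both sides turns it into norm convergence (`tendsto_SPlusL`). When `e_{M+1} ≠ e_M`, the spectral gap
makes the leading spectral projections converge in norm as well, by Weyl's inequality and a
Davis–Kahan estimate (`IsPosEigendecomposition.tendsto_headProj`). In `M`, the leading projections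
converge strongly to the projection onto `H₊`, and compactness of the operator again gives norm
convergence. Norm convergence of compact self-adjoint operators on an infinite-dimensional space
implies spectral convergence (`spectrallyConverges_of_tendsto`).

The interval is `[-λ₁/z, λ₁/z]`, where `λ₁` is the largest eigenvalue of `G_τ` on zero-mean
functions. The resolvent has norm at most `1/z`, the Markov property and ergodicity give `λ₁ < 1`
(`eigenvalue_lt_one`), and a difference of two positive operators of norm at most `c` again has norm
at most `c`.

For the rank, `H₊` and `J H₊` are orthogonal, so the limit acts as `e_j` on `ψ_j` and as `-e_j` on
`J ψ_j`, with `e_j ≥ e_M > e_{M+1} ≥ 0` for `j ≤ M`. It has rank `2M`; the rank of the approximants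
cannot exceed `2M` and, near the limit, cannot fall below it. -/

theorem mem_eigSpace {A : E →L[ℂ] E} {c : ℂ} {f : E} : f ∈ eigSpace A c ↔ A f = c • f := by
  simp [eigSpace]

/-- The Hilbert bases of the single eigenspaces, the kernel included, are glued together. The
spectral theorem for compact operators says that nothing is orthogonal to all of them. -/
theorem exists_hilbertBasis_eigenvectors {A : E →L[ℂ] E} (hA : IsCompactOperator A)
    (hs : (A : E →ₗ[ℂ] E).IsSymmetric) :
    ∃ (ι : Type u) (b : HilbertBasis ι ℂ E) (d : ι → ℂ), ∀ i, A (b i) = d i • b i := by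
  let V : ℂ → Submodule ℂ E := fun μ => Module.End.eigenspace (A : E →ₗ[ℂ] E) μ
  have hcl : ∀ μ, IsClosed (V μ : Set E) := fun μ => by
    have : (V μ : Set E) = {x | A x = μ • x} := by
      ext x; simp [V]
    rw [this]
    exact isClosed_eq A.continuous (continuous_const_smul μ)
  haveI : ∀ μ, CompleteSpace (V μ) := fun μ => (hcl μ).completeSpace_coe
  choose w b hb using fun μ => exists_hilbertBasis ℂ (V μ)
  let v : (Σ μ, w μ) → E := fun p => (b p.1 p.2 : V p.1)
  have hv : Orthonormal ℂ v :=
    hs.orthogonalFamily_eigenspaces.orthonormal_sigma_orthonormal (fun μ => (b μ).orthonormal)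
  have hbot : (Submodule.span ℂ (Set.range v))ᗮ = ⊥ := by
    rw [eq_bot_iff, ← ContinuousLinearMap.orthogonalComplement_iSup_eigenspaces_eq_bot hA hs]
    intro x hx
    rw [← Submodule.iInf_orthogonal, Submodule.mem_iInf]
    intro μ
    rw [Submodule.mem_orthogonal]
    intro u hu
    have h1 : ∀ i, ⟪((b μ i : V μ) : E), x⟫_ℂ = 0 := fun i =>
      (Submodule.mem_orthogonal _ _).1 hx _ (Submodule.subset_span ⟨⟨μ, i⟩, rfl⟩)
    have h2 : (V μ).orthogonalProjectionOnto x = 0 := by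
      apply (b μ).repr.injective
      ext i
      rw [(b μ).repr_apply_apply, map_zero]
      exact (Submodule.inner_orthogonalProjectionOnto_eq_of_mem_left (b μ i) x).trans (h1 i)
    have h3 := Submodule.inner_orthogonalProjectionOnto_eq_of_mem_left (⟨u, hu⟩ : V μ) x
    rw [← h3, h2, inner_zero_right]
  refine ⟨_, HilbertBasis.mkOfOrthogonalEqBot hv hbot, fun p => p.1, fun p => ?_⟩
  rw [HilbertBasis.coe_mkOfOrthogonalEqBot]
  exact Module.End.mem_eigenspace_iff.1 (b p.1 p.2).2

theorem norm_le_of_coords_le {ι : Type*} (b : HilbertBasis ι ℂ E) {x y : E}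
    (h : ∀ i, ‖⟪b i, x⟫_ℂ‖ ≤ ‖⟪b i, y⟫_ℂ‖) : ‖x‖ ≤ ‖y‖ := by
  rw [← b.repr.norm_map x, ← b.repr.norm_map y]
  refine lp.norm_mono (by simp) fun i => ?_
  simpa [b.repr_apply_apply] using h i

theorem inner_sub_smul_eigenvector {A : E →L[ℂ] E} (hs : (A : E →ₗ[ℂ] E).IsSymmetric)
    {u : E} {d : ℂ} (hu : A u = d • u) (b : ℂ) (w : E) :
    ⟪u, A w - b • w⟫_ℂ = (d - b) * ⟪u, w⟫_ℂ := by
  by_cases h0 : u = 0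
  · simp [h0]
  have hd : (starRingEnd ℂ) d = d :=
    hs.conj_eigenvalue_eq_self
      (Module.End.hasEigenvalue_of_hasEigenvector
        (Module.End.hasEigenvector_iff.2 ⟨Module.End.mem_eigenspace_iff.2 hu, h0⟩))
  have h1 : ⟪u, A w⟫_ℂ = ⟪A u, w⟫_ℂ := (hs u w).symm
  rw [inner_sub_right, h1, hu, inner_smul_left, inner_smul_right, hd]
  ring

/-- In an eigenbasis `A - b` multiplies coordinates by `d - b`, and `w` has no coordinate along the
eigenspaces closer to `b` than `r`. With its counterpart below, this does the work of resolvent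
estimates. -/
theorem mul_norm_le_norm_sub_smul {A : E →L[ℂ] E} (hA : IsCompactOperator A)
    (hs : (A : E →ₗ[ℂ] E).IsSymmetric) {b : ℂ} {r : ℝ} (hr : 0 ≤ r) {w : E}
    (h : ∀ d : ℂ, eigSpace A d ≠ ⊥ → r ≤ ‖d - b‖ ∨ ∀ u ∈ eigSpace A d, ⟪u, w⟫_ℂ = 0) :
    r * ‖w‖ ≤ ‖A w - b • w‖ := by
  obtain ⟨ι, v, d, hv⟩ := exists_hilbertBasis_eigenvectors hA hs
  have : ‖(r : ℂ) • w‖ ≤ ‖A w - b • w‖ := by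
    refine norm_le_of_coords_le v fun i => ?_
    rw [inner_sub_smul_eigenvector hs (hv i), inner_smul_right, norm_mul, norm_mul,
      Complex.norm_of_nonneg hr]
    have hmem : v i ∈ eigSpace A (d i) := mem_eigSpace.2 (hv i)
    have hne : eigSpace A (d i) ≠ ⊥ := fun hb => by
      rw [hb, Submodule.mem_bot] at hmem
      exact v.orthonormal.ne_zero i hmem
    rcases h (d i) hne with h | h
    · gcongr
    · simp [h _ hmem]
  rwa [norm_smul, Complex.norm_of_nonneg hr] at this

theorem norm_sub_smul_le_mul_norm {A : E →L[ℂ] E} (hA : IsCompactOperator A)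
    (hs : (A : E →ₗ[ℂ] E).IsSymmetric) {b : ℂ} {r : ℝ} (hr : 0 ≤ r) {w : E}
    (h : ∀ d : ℂ, eigSpace A d ≠ ⊥ → ‖d - b‖ ≤ r ∨ ∀ u ∈ eigSpace A d, ⟪u, w⟫_ℂ = 0) :
    ‖A w - b • w‖ ≤ r * ‖w‖ := by
  obtain ⟨ι, v, d, hv⟩ := exists_hilbertBasis_eigenvectors hA hs
  have : ‖A w - b • w‖ ≤ ‖(r : ℂ) • w‖ := by
    refine norm_le_of_coords_le v fun i => ?_
    rw [inner_sub_smul_eigenvector hs (hv i), inner_smul_right, norm_mul, norm_mul,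
      Complex.norm_of_nonneg hr]
    have hmem : v i ∈ eigSpace A (d i) := mem_eigSpace.2 (hv i)
    have hne : eigSpace A (d i) ≠ ⊥ := fun hb => by
      rw [hb, Submodule.mem_bot] at hmem
      exact v.orthonormal.ne_zero i hmem
    rcases h (d i) hne with h | h
    · gcongr
    · simp [h _ hmem]
  rwa [norm_smul, Complex.norm_of_nonneg hr] at this

theorem starProjection_commute_of_mapsTo {A : E →L[ℂ] E} {W : Submodule ℂ E}
    [W.HasOrthogonalProjection] (h1 : ∀ x ∈ W, A x ∈ W) (h2 : ∀ x ∈ Wᗮ, A x ∈ Wᗮ) (x : E) :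
    W.starProjection (A x) = A (W.starProjection x) := by
  apply Submodule.eq_starProjection_of_mem_orthogonal (h1 _ (W.starProjection_apply_mem x))
  rw [← map_sub]
  exact h2 _ (W.sub_starProjection_mem_orthogonal x)

/-- With `P`, `Q` the two projections, `P - Q = P(1 - Q) - (1 - P)Q`, and `P(1 - Q)` is the adjoint
of `(1 - Q)P`; each hypothesis controls one term. -/
theorem norm_starProjection_sub_le {U V : Submodule ℂ E} [U.HasOrthogonalProjection]
    [V.HasOrthogonalProjection] {a b : ℝ} (ha : 0 ≤ a) (hb : 0 ≤ b)
    (hU : ∀ u ∈ U, ‖u - V.starProjection u‖ ≤ a * ‖u‖)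
    (hV : ∀ v ∈ V, ‖v - U.starProjection v‖ ≤ b * ‖v‖) :
    ‖U.starProjection - V.starProjection‖ ≤ a + b := by
  have hUV : ‖(1 - V.starProjection) * U.starProjection‖ ≤ a := by
    refine ContinuousLinearMap.opNorm_le_bound _ ha fun x => ?_
    refine (hU _ (U.starProjection_apply_mem x)).trans ?_
    gcongr
    exact U.norm_starProjection_apply_le x
  have hVU : ‖(1 - U.starProjection) * V.starProjection‖ ≤ b := by
    refine ContinuousLinearMap.opNorm_le_bound _ hb fun x => ?_
    refine (hV _ (V.starProjection_apply_mem x)).trans ?_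
    gcongr
    exact V.norm_starProjection_apply_le x
  have h : U.starProjection - V.starProjection =
      star ((1 - V.starProjection) * U.starProjection) - (1 - U.starProjection) * V.starProjection := by
    have h1 : star U.starProjection = U.starProjection := isSelfAdjoint_starProjection U
    have h2 : star V.starProjection = V.starProjection := isSelfAdjoint_starProjection V
    rw [star_mul, star_sub, star_one, h1, h2]
    noncomm_ring
  rw [h]
  refine (norm_sub_le _ _).trans ?_
  rw [norm_star]
  exact add_le_add hUV hVU

/-- A vector of `U` annihilated by the projection onto `V` would be fixed by the difference, which
has norm below 1. So that projection is injective on `U`. -/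
theorem finrank_le_of_norm_starProjection_sub_lt {U V : Submodule ℂ E}
    [U.HasOrthogonalProjection] [V.HasOrthogonalProjection] [FiniteDimensional ℂ V]
    (h : ‖U.starProjection - V.starProjection‖ < 1) :
    FiniteDimensional ℂ U ∧ Module.finrank ℂ U ≤ Module.finrank ℂ V := by
  let T : U →ₗ[ℂ] V := (V.orthogonalProjectionOnto ∘L U.subtypeL : U →L[ℂ] V)
  have hT : Function.Injective T := by
    rw [injective_iff_map_eq_zero]
    intro u hu
    by_contra hne
    have h0 : V.starProjection (u : E) = 0 := congrArg Subtype.val hu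
    have h1 : (U.starProjection - V.starProjection) (u : E) = u := by
      simp [h0, U.starProjection_eq_self_iff.2 u.2]
    have h2 := (U.starProjection - V.starProjection).le_opNorm (u : E)
    rw [h1] at h2
    have : 0 < ‖(u : E)‖ := norm_pos_iff.2 (by simpa using hne)
    nlinarith
  haveI := FiniteDimensional.of_injective T hT
  exact ⟨this, LinearMap.finrank_le_finrank_of_injective hT⟩

theorem span_eigenvectors_eq (A : E →L[ℂ] E) (T : Set ℂ) :
    Submodule.span ℂ {f : E | ∃ c ∈ T, f ∈ eigSpace A c} = ⨆ c ∈ T, eigSpace A c := by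
  apply le_antisymm
  · rw [Submodule.span_le]
    rintro f ⟨c, hc, hf⟩
    exact (le_iSup₂_of_le (f := fun c (_ : c ∈ T) => eigSpace A c) c hc le_rfl) hf
  · exact iSup₂_le fun c hc f hf => Submodule.subset_span ⟨c, hc, hf⟩

theorem finite_of_iSup_eigSpace_finiteDimensional {A : E →L[ℂ] E} {T : Set ℂ}
    (hT : ∀ c ∈ T, eigSpace A c ≠ ⊥) {W : Submodule ℂ E} [FiniteDimensional ℂ W]
    (hW : ∀ c ∈ T, eigSpace A c ≤ W) : T.Finite := by
  choose! u hu hu0 using fun c hc => (Submodule.ne_bot_iff _).1 (hT c hc)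
  have hli : LinearIndependent ℂ (fun c : T => (⟨u c, hW c c.2 (hu c c.2)⟩ : W)) := by
    apply LinearIndependent.of_comp W.subtype
    exact Module.End.eigenvectors_linearIndependent (A : E →ₗ[ℂ] E) T (fun c => u c)
      fun c => Module.End.hasEigenvector_iff.2 ⟨hu c c.2, hu0 c c.2⟩
  haveI := hli.finite
  exact Set.toFinite T

theorem finrank_iSup_eigSpace (A : E →L[ℂ] E) (T : Finset ℂ)
    (hT : ∀ c ∈ T, FiniteDimensional ℂ (eigSpace A c)) :
    FiniteDimensional ℂ (⨆ c ∈ T, eigSpace A c : Submodule ℂ E) ∧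
    Module.finrank ℂ (⨆ c ∈ T, eigSpace A c : Submodule ℂ E) =
      ∑ c ∈ T, Module.finrank ℂ (eigSpace A c) := by
  classical
  induction T using Finset.induction_on with
  | empty =>
    have h0 : (⨆ c ∈ (∅ : Finset ℂ), eigSpace A c : Submodule ℂ E) = ⊥ := by simp
    rw [h0]
    exact ⟨inferInstance, by simp⟩
  | insert a s ha ih =>
    obtain ⟨h1, h2⟩ := ih fun c hc => hT c (Finset.mem_insert_of_mem hc)
    haveI := hT a (Finset.mem_insert_self _ _)
    rw [Finset.iSup_insert]
    refine ⟨inferInstance, ?_⟩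
    have hdis : eigSpace A a ⊓ (⨆ c ∈ s, eigSpace A c) = ⊥ := by
      rw [← disjoint_iff]
      refine ((Module.End.eigenspaces_iSupIndep (A : E →ₗ[ℂ] E)) a).mono_right ?_
      refine iSup₂_le fun c hc => ?_
      exact le_iSup₂_of_le (f := fun j (_ : j ≠ a) => Module.End.eigenspace (A : E →ₗ[ℂ] E) j) c
        (fun h => ha (h ▸ hc)) le_rfl
    have := Submodule.finrank_sup_add_finrank_inf_eq (eigSpace A a) (⨆ c ∈ s, eigSpace A c)
    rw [hdis, finrank_bot, add_zero] at this
    rw [this, Finset.sum_insert ha, h2]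

end Spectral

/-! ### Norm convergence of compact self-adjoint operators implies spectral convergence -/

section SpectralConvergence

variable {E : Type*} [NormedAddCommGroup E] [InnerProductSpace ℂ E] [CompleteSpace E]

/-- The closed span of the eigenspaces of `A` with eigenvalues in `T`. -/
def closedEigSpan (A : E →L[ℂ] E) (T : Set ℂ) : Submodule ℂ E :=
  (Submodule.span ℂ {f : E | ∃ c ∈ T, f ∈ eigSpace A c}).topologicalClosure

instance (A : E →L[ℂ] E) (T : Set ℂ) : CompleteSpace (closedEigSpan A T) :=
  (Submodule.isClosed_topologicalClosure _).completeSpace_coe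

theorem eigProjection_eq (A : E →L[ℂ] E) (T : Set ℂ) :
    eigProjection A T = (closedEigSpan A T).starProjection := rfl

theorem eigSpace_le_closedEigSpan {A : E →L[ℂ] E} {T : Set ℂ} {c : ℂ} (hc : c ∈ T) :
    eigSpace A c ≤ closedEigSpan A T := fun _ hf =>
  Submodule.le_topologicalClosure _ (Submodule.subset_span ⟨c, hc, hf⟩)

theorem closedEigSpan_le {A : E →L[ℂ] E} {T : Set ℂ} {W : Submodule ℂ E}
    (hW : IsClosed (W : Set E)) (h : ∀ c ∈ T, eigSpace A c ≤ W) : closedEigSpan A T ≤ W := by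
  refine Submodule.topologicalClosure_minimal _ (Submodule.span_le.2 ?_) hW
  rintro f ⟨c, hc, hf⟩
  exact h c hc hf

theorem isClosed_eigSpace (A : E →L[ℂ] E) (c : ℂ) : IsClosed (eigSpace A c : Set E) := by
  have : (eigSpace A c : Set E) = {x | A x = c • x} := by
    ext x; exact mem_eigSpace
  rw [this]
  exact isClosed_eq A.continuous (continuous_const_smul c)

theorem closedEigSpan_singleton (A : E →L[ℂ] E) (c : ℂ) :
    closedEigSpan A {c} = eigSpace A c := by
  apply le_antisymm
  · exact closedEigSpan_le (isClosed_eigSpace A c) fun d hd => by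
      rw [Set.mem_singleton_iff.1 hd]
  · exact eigSpace_le_closedEigSpan rfl

theorem inner_eq_zero_of_eigenvectors {A : E →L[ℂ] E} (hs : (A : E →ₗ[ℂ] E).IsSymmetric)
    {u v : E} {a b : ℂ} (hu : A u = a • u) (hv : A v = b • v) (hab : a ≠ b) : ⟪u, v⟫_ℂ = 0 := by
  have h := inner_sub_smul_eigenvector hs hu b v
  rw [hv, sub_self, inner_zero_right] at h
  exact (mul_eq_zero.1 h.symm).resolve_left (sub_ne_zero.2 hab)

theorem inner_eq_zero_of_mem_closedEigSpan {A : E →L[ℂ] E} (hs : (A : E →ₗ[ℂ] E).IsSymmetric)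
    {T : Set ℂ} {d : ℂ} (hd : d ∉ T) {f u : E} (hf : f ∈ eigSpace A d)
    (hu : u ∈ closedEigSpan A T) : ⟪f, u⟫_ℂ = 0 := by
  have : closedEigSpan A T ≤ (eigSpace A d)ᗮ := by
    refine closedEigSpan_le (Submodule.isClosed_orthogonal _) fun c hc g hg => ?_
    rw [Submodule.mem_orthogonal]
    intro k hk
    exact inner_eq_zero_of_eigenvectors hs (mem_eigSpace.1 hk) (mem_eigSpace.1 hg)
      (fun h => hd (h ▸ hc))
  exact (Submodule.mem_orthogonal _ _).1 (this hu) f hf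

theorem starProjection_closedEigSpan_commute {A : E →L[ℂ] E}
    (hs : (A : E →ₗ[ℂ] E).IsSymmetric) (T : Set ℂ) (x : E) :
    (closedEigSpan A T).starProjection (A x) = A ((closedEigSpan A T).starProjection x) := by
  have h1 : ∀ x ∈ closedEigSpan A T, A x ∈ closedEigSpan A T := by
    have : closedEigSpan A T ≤ (closedEigSpan A T).comap (A : E →ₗ[ℂ] E) := by
      refine closedEigSpan_le ?_ fun c hc f hf => ?_
      · exact (Submodule.isClosed_topologicalClosure _).preimage A.continuous
      · have : A f = c • f := mem_eigSpace.1 hf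
        change A f ∈ closedEigSpan A T
        rw [this]
        exact Submodule.smul_mem _ _ (eigSpace_le_closedEigSpan hc hf)
    exact fun x hx => this hx
  refine starProjection_commute_of_mapsTo h1 (fun x hx => ?_) x
  rw [Submodule.mem_orthogonal] at hx ⊢
  intro u hu
  rw [← hx (A u) (h1 u hu)]
  exact (hs u x).symm

theorem mem_spectrum_iff_eigSpace_ne_bot {A : E →L[ℂ] E} (hA : IsCompactOperator A) {c : ℂ}
    (hc : c ≠ 0) : c ∈ spectrum ℂ A ↔ eigSpace A c ≠ ⊥ := by
  rw [← hA.hasEigenvalue_iff_mem_spectrum hc, Module.End.hasEigenvalue_iff]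
  rfl

/-- An inverse of `A` would make the identity compact. This is what keeps 0 out of every admissible
neighborhood of a nonzero eigenvalue. -/
theorem zero_mem_spectrum_of_isCompactOperator {A : E →L[ℂ] E} (hA : IsCompactOperator A)
    (hE : ¬ FiniteDimensional ℂ E) : (0 : ℂ) ∈ spectrum ℂ A := by
  by_contra h
  rw [spectrum.zero_notMem_iff] at h
  obtain ⟨C, hC⟩ := h.exists_right_inv
  apply hE
  apply FiniteDimensional.of_isCompactOperator_id (𝕜 := ℂ)
  have h1 := hA.comp_clm C
  have h2 : (A : E → E) ∘ C = id := by
    ext x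
    exact congrArg (fun T : E →L[ℂ] E => T x) hC
  rwa [h2] at h1

theorem mem_spectrum_of_eigSpace_ne_bot {A : E →L[ℂ] E} (hA : IsCompactOperator A)
    (hE : ¬ FiniteDimensional ℂ E) {c : ℂ} (hc : eigSpace A c ≠ ⊥) : c ∈ spectrum ℂ A := by
  by_cases h0 : c = 0
  · rw [h0]; exact zero_mem_spectrum_of_isCompactOperator hA hE
  · exact (mem_spectrum_iff_eigSpace_ne_bot hA h0).2 hc

section Perturbation

variable {A B : E →L[ℂ] E} {c : ℂ} {O : Set ℂ} {η ρ ε : ℝ}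

/-- A unit eigenvector of `A` for `b` is an approximate eigenvector of `B` with error at most `‖A -
B‖ < ρ`, so `B` has an eigenvalue within `ρ` of `b`; by the separation hypothesis it can only be
`c`. -/
theorem norm_sub_lt_of_mem_spectrum_inter
    (hA : IsCompactOperator A)
    (hB : IsCompactOperator B) (hBs : (B : E →ₗ[ℂ] E).IsSymmetric)
    (h0 : (0 : ℂ) ∉ O) (hη : ∀ d, eigSpace B d ≠ ⊥ → d ≠ c → ∀ b ∈ O, η ≤ ‖d - b‖)
    (hρ : 0 ≤ ρ) (hρη : ρ ≤ η) (hAB : ‖A - B‖ < ρ) {b : ℂ} (hb : b ∈ spectrum ℂ A ∩ O) :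
    ‖b - c‖ < ρ := by
  by_contra! hcon
  have hb0 : b ≠ 0 := fun h => h0 (h ▸ hb.2)
  obtain ⟨u, hu, hu0⟩ :=
    (Submodule.ne_bot_iff _).1 ((mem_spectrum_iff_eigSpace_ne_bot hA hb0).1 hb.1)
  have h1 : ρ * ‖u‖ ≤ ‖B u - b • u‖ := by
    refine mul_norm_le_norm_sub_smul hB hBs hρ fun d hd => Or.inl ?_
    by_cases hdc : d = c
    · rw [hdc, norm_sub_rev]; exact hcon
    · exact hρη.trans (hη d hd hdc b hb.2)
  have h2 : B u - b • u = -((A - B) u) := by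
    rw [← mem_eigSpace.1 hu]; simp
  rw [h2, norm_neg] at h1
  have h3 := (A - B).le_opNorm u
  have : 0 < ‖u‖ := norm_pos_iff.2 hu0
  nlinarith

/-- A Davis–Kahan estimate. On the cluster space of `A`, `B - c` is of size `2ρ` (one `ρ` from `A -
B`, one from the width of the cluster), while it is at least `η` off the `c`-eigenspace of `B`. The
converse comparison costs a single `ρ`, hence the factor 3. -/
theorem norm_eigProjection_sub_le (hE : ¬ FiniteDimensional ℂ E)
    (hA : IsCompactOperator A) (hAs : (A : E →ₗ[ℂ] E).IsSymmetric)
    (hB : IsCompactOperator B) (hBs : (B : E →ₗ[ℂ] E).IsSymmetric)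
    (h0 : (0 : ℂ) ∉ O) (hη0 : 0 < η) (hη : ∀ d, eigSpace B d ≠ ⊥ → d ≠ c → ∀ b ∈ O, η ≤ ‖d - b‖)
    (hball : Metric.ball c η ⊆ O)
    (hρ : 0 ≤ ρ) (hρη : ρ ≤ η) (hAB : ‖A - B‖ < ρ) :
    ‖eigProjection A (spectrum ℂ A ∩ O) - eigProjection B {c}‖ ≤ 3 * ρ / η := by
  have hcO : c ∈ O := hball (Metric.mem_ball_self hη0)
  rw [eigProjection_eq, eigProjection_eq]
  set U := closedEigSpan A (spectrum ℂ A ∩ O) with hU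
  set V := closedEigSpan B {c} with hV
  have hVmem : ∀ v ∈ V, B v = c • v := fun v hv => by
    rw [hV, closedEigSpan_singleton] at hv
    exact mem_eigSpace.1 hv
  have key : ∀ x, ‖B x - A x‖ ≤ ρ * ‖x‖ := fun x => by
    have := (A - B).le_of_opNorm_le hAB.le x
    rwa [sub_apply, norm_sub_rev] at this
  have hsplit : 3 * ρ / η = 2 * ρ / η + ρ / η := by ring
  rw [hsplit]
  refine norm_starProjection_sub_le (by positivity) (by positivity) (fun u hu => ?_) fun v hv => ?_
  · have h1 : ‖A u - c • u‖ ≤ ρ * ‖u‖ := by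
      refine norm_sub_smul_le_mul_norm hA hAs hρ fun d hd => ?_
      by_cases hdT : d ∈ spectrum ℂ A ∩ O
      · exact Or.inl (norm_sub_lt_of_mem_spectrum_inter hA hB hBs h0 hη hρ hρη hAB hdT).le
      · exact Or.inr fun f hf => inner_eq_zero_of_mem_closedEigSpan hAs hdT hf hu
    have h2 : η * ‖u - V.starProjection u‖ ≤
        ‖B (u - V.starProjection u) - c • (u - V.starProjection u)‖ := by
      refine mul_norm_le_norm_sub_smul hB hBs hη0.le fun d hd => ?_
      by_cases hdc : d = c
      · right
        intro f hf
        have hfV : f ∈ V := eigSpace_le_closedEigSpan (T := {c}) hdc hf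
        exact (Submodule.mem_orthogonal _ _).1 (V.sub_starProjection_mem_orthogonal u) f hfV
      · exact Or.inl (hη d hd hdc c hcO)
    have h3 : B (u - V.starProjection u) - c • (u - V.starProjection u) =
        (B u - A u) + (A u - c • u) := by
      rw [map_sub, hVmem _ (V.starProjection_apply_mem u), smul_sub]; abel
    rw [h3] at h2
    have h4 := h2.trans ((norm_add_le _ _).trans (add_le_add (key u) h1))
    rw [div_mul_eq_mul_div, le_div_iff₀ hη0]
    linarith
  · have h2 : η * ‖v - U.starProjection v‖ ≤
        ‖A (v - U.starProjection v) - c • (v - U.starProjection v)‖ := by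
      refine mul_norm_le_norm_sub_smul hA hAs hη0.le fun d hd => ?_
      by_cases hdT : d ∈ spectrum ℂ A ∩ O
      · right
        intro f hf
        have hfU : f ∈ U := eigSpace_le_closedEigSpan hdT hf
        exact (Submodule.mem_orthogonal _ _).1 (U.sub_starProjection_mem_orthogonal v) f hfU
      · left
        by_contra! hlt
        exact hdT ⟨mem_spectrum_of_eigSpace_ne_bot hA hE hd,
          hball (by rwa [Metric.mem_ball, dist_eq_norm])⟩
    have h3 : A (v - U.starProjection v) - c • (v - U.starProjection v) =
        Uᗮ.starProjection (A v - B v) := by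
      have hcomm : U.starProjection (A v) = A (U.starProjection v) :=
        starProjection_closedEigSpan_commute hAs _ v
      rw [hVmem v hv, Submodule.starProjection_orthogonal_val, map_sub, map_sub, map_smul, hcomm,
        smul_sub]
      abel
    rw [h3] at h2
    have h4 := h2.trans ((Submodule.norm_starProjection_apply_le _ _).trans
      ((norm_sub_rev _ _).le.trans (key v)))
    rw [div_mul_eq_mul_div, le_div_iff₀ hη0]
    linarith

/-- Projections at distance below 1 have equal rank, and the rank on the side of `A` is the sum of
the multiplicities because eigenspaces are independent. -/
theorem eigenvalue_count_of_norm_eigProjection_sub_lt (hA : IsCompactOperator A)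
    (h0 : (0 : ℂ) ∉ O) [FiniteDimensional ℂ (eigSpace B c)]
    (h : ‖eigProjection A (spectrum ℂ A ∩ O) - eigProjection B {c}‖ < 1) :
    (spectrum ℂ A ∩ O).Finite ∧
        (spectrum ℂ A ∩ O).ncard ≤ Module.finrank ℂ (eigSpace B c) ∧
        (∀ b ∈ spectrum ℂ A ∩ O,
          eigSpace A b ≠ ⊥ ∧ FiniteDimensional ℂ (eigSpace A b)) ∧
        ∑ᶠ b ∈ spectrum ℂ A ∩ O, Module.finrank ℂ (eigSpace A b) =
          Module.finrank ℂ (eigSpace B c) := by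
  have hne : ∀ b ∈ spectrum ℂ A ∩ O, eigSpace A b ≠ ⊥ := fun b hb =>
    (mem_spectrum_iff_eigSpace_ne_bot hA (fun h => h0 (h ▸ hb.2))).1 hb.1
  have hfd : ∀ b ∈ spectrum ℂ A ∩ O, FiniteDimensional ℂ (eigSpace A b) := fun b hb =>
    ContinuousLinearMap.finite_dimensional_eigenspace hA b (fun h => h0 (h ▸ hb.2))
  rw [eigProjection_eq, eigProjection_eq] at h
  haveI : FiniteDimensional ℂ (closedEigSpan B {c}) := by
    rw [closedEigSpan_singleton]; infer_instance
  obtain ⟨hU, hle⟩ := finrank_le_of_norm_starProjection_sub_lt h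
  rw [norm_sub_rev] at h
  have hge := (finrank_le_of_norm_starProjection_sub_lt h).2
  have heq := le_antisymm hle hge
  rw [closedEigSpan_singleton] at heq
  have hfin : (spectrum ℂ A ∩ O).Finite :=
    finite_of_iSup_eigSpace_finiteDimensional (A := A) hne
      (W := closedEigSpan A (spectrum ℂ A ∩ O)) fun c hc => eigSpace_le_closedEigSpan hc
  obtain ⟨h1, h2⟩ := finrank_iSup_eigSpace A hfin.toFinset
    fun b hb => hfd b (hfin.mem_toFinset.1 hb)
  have hsup : (⨆ b ∈ hfin.toFinset, eigSpace A b) = closedEigSpan A (spectrum ℂ A ∩ O) := by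
    have hmem : (⨆ b ∈ hfin.toFinset, eigSpace A b) = ⨆ b ∈ spectrum ℂ A ∩ O, eigSpace A b := by
      simp only [Set.Finite.mem_toFinset]
    rw [closedEigSpan, span_eigenvectors_eq, ← hmem]
    exact (Submodule.closed_of_finiteDimensional _).submodule_topologicalClosure_eq.symm
  rw [hsup, heq] at h2
  refine ⟨hfin, ?_, fun b hb => ⟨hne b hb, hfd b hb⟩, ?_⟩
  · rw [h2, Set.ncard_eq_toFinset_card _ hfin, Finset.card_eq_sum_ones]
    refine Finset.sum_le_sum fun b hb => ?_
    have hb := hfin.mem_toFinset.1 hb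
    haveI := hfd b hb
    exact Submodule.one_le_finrank_iff.2 (hne b hb)
  · rw [finsum_mem_eq_finite_toFinset_sum _ hfin, h2]

end Perturbation

theorem spectrallyConverges_of_tendsto {ι : Type*} {l : Filter ι} {A : ι → E →L[ℂ] E}
    {B : E →L[ℂ] E} (hE : ¬ FiniteDimensional ℂ E)
    (hA : ∀ n, IsCompactOperator (A n)) (hAs : ∀ n, (A n : E →ₗ[ℂ] E).IsSymmetric)
    (hB : IsCompactOperator B) (hBs : (B : E →ₗ[ℂ] E).IsSymmetric) (h : Tendsto A l (𝓝 B)) :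
    SpectrallyConverges l A B := by
  intro c hc0 hc O hO hcO hOB
  -- In infinite dimension 0 lies in the spectrum of `B`, so `0 ∈ O` would force `c = 0`.
  have h0 : (0 : ℂ) ∉ O := fun h0 => by
    have : (0 : ℂ) ∈ spectrum ℂ B ∩ closure O :=
      ⟨zero_mem_spectrum_of_isCompactOperator hB hE, subset_closure h0⟩
    rw [hOB, Set.mem_singleton_iff] at this
    exact hc0 this.symm
  haveI hfd : FiniteDimensional ℂ (eigSpace B c) :=
    ContinuousLinearMap.finite_dimensional_eigenspace hB c hc0
  -- The part of the spectrum outside `O` is compact and misses the closure of `O`, so the two have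
  -- positive distance.
  obtain ⟨η₁, hη₁, hdisj⟩ : ∃ δ, 0 < δ ∧ Disjoint (Metric.thickening δ (spectrum ℂ B ∩ Oᶜ))
      (Metric.thickening δ (closure O)) := by
    refine Disjoint.exists_thickenings ?_ ((spectrum.isCompact B).inter_right hO.isClosed_compl)
      isClosed_closure
    rw [Set.disjoint_left]
    rintro d ⟨hd, hdO⟩ hd'
    have : d ∈ spectrum ℂ B ∩ closure O := ⟨hd, hd'⟩
    rw [hOB, Set.mem_singleton_iff] at this
    exact hdO (this ▸ hcO)
  obtain ⟨η₂, hη₂, hball⟩ := Metric.isOpen_iff.1 hO c hcO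
  set η := min η₁ η₂ with hηdef
  have hη0 : 0 < η := lt_min hη₁ hη₂
  have hη : ∀ d, eigSpace B d ≠ ⊥ → d ≠ c → ∀ b ∈ O, η ≤ ‖d - b‖ := by
    intro d hd hdc b hb
    by_contra! hlt
    have hdB := mem_spectrum_of_eigSpace_ne_bot hB hE hd
    have hdO : d ∉ O := fun hdO => hdc (by
      have : d ∈ spectrum ℂ B ∩ closure O := ⟨hdB, subset_closure hdO⟩
      rwa [hOB, Set.mem_singleton_iff] at this)
    refine Set.disjoint_left.1 hdisj (Metric.self_subset_thickening hη₁ _ ⟨hdB, hdO⟩) ?_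
    rw [Metric.mem_thickening_iff]
    exact ⟨b, subset_closure hb, by rw [dist_eq_norm]; exact hlt.trans_le (min_le_left _ _)⟩
  have hball' : Metric.ball c η ⊆ O := (Metric.ball_subset_ball (min_le_right _ _)).trans hball
  have hev : ∀ ρ, 0 < ρ → ∀ᶠ n in l, ‖A n - B‖ < ρ := fun ρ hρ => by
    have := Metric.tendsto_nhds.1 h ρ hρ
    simpa only [dist_eq_norm] using this
  have hproj : Tendsto (fun n => eigProjection (A n) (spectrum ℂ (A n) ∩ O)) l
      (𝓝 (eigProjection B {c})) := by
    rw [Metric.tendsto_nhds]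
    intro ε hε
    -- With `ρ ≤ ηε/6` the bound `3ρ/η` is at most `ε/2`.
    have hρ : 0 < min η (η * ε / 6) := lt_min hη0 (by positivity)
    filter_upwards [hev _ hρ] with n hn
    rw [dist_eq_norm]
    refine (norm_eigProjection_sub_le hE (hA n) (hAs n) hB hBs h0 hη0 hη hball' hρ.le
      (min_le_left _ _) hn).trans_lt ?_
    rw [div_lt_iff₀ hη0]
    have := min_le_right η (η * ε / 6)
    nlinarith [mul_pos hη0 hε]
  refine ⟨hfd, ?_, fun b hb => ?_, fun f => ?_⟩
  · filter_upwards [Metric.tendsto_nhds.1 hproj 1 one_pos] with n hn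
    rw [dist_eq_norm] at hn
    exact eigenvalue_count_of_norm_eigProjection_sub_lt (hA n) h0 hn
  · rw [Metric.tendsto_nhds]
    intro ε hε
    have hρ : 0 < min η ε := lt_min hη0 hε
    filter_upwards [hev _ hρ, hb] with n hn hbn
    rw [dist_eq_norm]
    exact (norm_sub_lt_of_mem_spectrum_inter (hA n) hB hBs h0 hη hρ.le (min_le_left _ _) hn
      hbn).trans_le (min_le_right _ _)
  · exact (ContinuousLinearMap.apply ℂ E f).continuous.continuousAt.tendsto.comp hproj

end SpectralConvergence

/-! ### Strong convergence of square roots and moduli; compactness turns it into norm convergence -/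

section StrongConvergence

variable {E : Type*} [NormedAddCommGroup E] [InnerProductSpace ℂ E]
variable {ι : Type*} {l : Filter ι}

theorem tendsto_apply_of_norm_le {A : ι → E →L[ℂ] E} {B : E →L[ℂ] E} {C : ℝ}
    (hC : ∀ n, ‖A n‖ ≤ C) {x : ι → E} {y : E} (hA : Tendsto (fun n => A n y) l (𝓝 (B y)))
    (hx : Tendsto x l (𝓝 y)) : Tendsto (fun n => A n (x n)) l (𝓝 (B y)) := by
  have h1 : Tendsto (fun n => A n (x n - y)) l (𝓝 0) := by
    refine squeeze_zero_norm (fun n => (A n).le_of_opNorm_le (hC n) (x n - y)) ?_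
    have := ((hx.sub_const y).norm).const_mul C
    simpa using this
  have h2 := h1.add hA
  simpa using h2

theorem tendsto_pow_apply {A : ι → E →L[ℂ] E} {B : E →L[ℂ] E} {C : ℝ}
    (hC : ∀ n, ‖A n‖ ≤ C) (hA : ∀ x, Tendsto (fun n => A n x) l (𝓝 (B x))) (k : ℕ) (x : E) :
    Tendsto (fun n => (A n ^ k) x) l (𝓝 ((B ^ k) x)) := by
  induction k with
  | zero => simpa using tendsto_const_nhds
  | succ k ih =>
    simp only [pow_succ', mul_apply_eq_comp]
    exact tendsto_apply_of_norm_le hC (hA _) ih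

theorem tendsto_aeval_apply {A : ι → E →L[ℂ] E} {B : E →L[ℂ] E} {C : ℝ}
    (hC : ∀ n, ‖A n‖ ≤ C) (hA : ∀ x, Tendsto (fun n => A n x) l (𝓝 (B x)))
    (p : Polynomial ℝ) (x : E) :
    Tendsto (fun n => (Polynomial.aeval (A n) p) x) l (𝓝 ((Polynomial.aeval B p) x)) := by
  induction p using Polynomial.induction_on' with
  | add p q hp hq => simpa using hp.add hq
  | monomial k a =>
    simp only [Polynomial.aeval_monomial, ← Algebra.smul_def, smul_apply]
    exact (tendsto_pow_apply hC hA k x).const_smul a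

variable [CompleteSpace E]

theorem norm_sqrt_sub_aeval_le {A : E →L[ℂ] E} (hA : 0 ≤ A) {C ε : ℝ} (hC : ‖A‖ ≤ C)
    (hε : 0 ≤ ε) {p : Polynomial ℝ} (hp : ∀ x ∈ Set.Icc 0 C, |p.eval x - √x| ≤ ε) :
    ‖CFC.sqrt A - Polynomial.aeval A p‖ ≤ ε := by
  have hsa : IsSelfAdjoint A := hA.isSelfAdjoint
  have h1 : CFC.sqrt A = cfc Real.sqrt A := by
    rw [CFC.sqrt_eq_real_sqrt A hA, cfcₙ_eq_cfc]
  rw [h1, ← cfc_polynomial p A hsa, ← cfc_sub Real.sqrt p.eval A]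
  refine norm_cfc_le hε fun x hx => ?_
  rw [Real.norm_eq_abs, abs_sub_comm]
  refine hp x ⟨spectrum_nonneg_of_nonneg hA hx, ?_⟩
  rcases subsingleton_or_nontrivial (E →L[ℂ] E) with h | h
  · rw [spectrum.of_subsingleton] at hx
    exact hx.elim
  · exact (le_abs_self x).trans ((spectrum.norm_le_norm_of_mem hx).trans hC)

/-- One polynomial approximates the square root uniformly on `[0, C]`, hence for all `A n` and `B`
at once, and polynomials respect strong convergence of bounded families. -/
theorem tendsto_sqrt_apply {A : ι → E →L[ℂ] E} {B : E →L[ℂ] E} {C : ℝ}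
    (hA0 : ∀ n, 0 ≤ A n) (hB0 : 0 ≤ B)
    (hC : ∀ n, ‖A n‖ ≤ C) (hBC : ‖B‖ ≤ C) (hA : ∀ x, Tendsto (fun n => A n x) l (𝓝 (B x)))
    (x : E) : Tendsto (fun n => CFC.sqrt (A n) x) l (𝓝 (CFC.sqrt B x)) := by
  rw [Metric.tendsto_nhds]
  intro ε hε
  set δ := ε / (3 * (‖x‖ + 1)) with hδ
  have hx0 : 0 < ‖x‖ + 1 := by positivity
  have hδ0 : 0 < δ := by positivity
  obtain ⟨p, hp⟩ := exists_polynomial_near_of_continuousOn 0 C Real.sqrt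
    Real.continuous_sqrt.continuousOn δ hδ0
  have hp' : ∀ x ∈ Set.Icc 0 C, |p.eval x - √x| ≤ δ := fun x hx => (hp x hx).le
  have hδx : δ * ‖x‖ < ε / 3 := by
    rw [hδ, div_mul_eq_mul_div, div_lt_div_iff₀ (by positivity) (by positivity)]
    nlinarith
  have happ : ∀ T : E →L[ℂ] E, 0 ≤ T → ‖T‖ ≤ C →
      ‖CFC.sqrt T x - Polynomial.aeval T p x‖ < ε / 3 := fun T h0 hT =>
    (((CFC.sqrt T - Polynomial.aeval T p).le_of_opNorm_le
      (norm_sqrt_sub_aeval_le h0 hT hδ0.le hp') x)).trans_lt hδx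
  filter_upwards [Metric.tendsto_nhds.1 (tendsto_aeval_apply hC hA p x) (ε / 3) (by positivity)]
    with n hn
  have h1 := happ (A n) (hA0 n) (hC n)
  have h2 := happ B hB0 hBC
  rw [← dist_eq_norm] at h1 h2
  rw [dist_comm] at h2
  calc dist (CFC.sqrt (A n) x) (CFC.sqrt B x) ≤ _ := dist_triangle4 _ _ _ _
    _ < ε / 3 + ε / 3 + ε / 3 := add_lt_add (add_lt_add h1 hn) h2
    _ = ε := by ring

/-- A bounded strongly convergent family converges uniformly on totally bounded sets, here on the
image of the unit ball under `K`. -/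
theorem tendsto_comp_of_isCompactOperator {A : ι → E →L[ℂ] E} {B : E →L[ℂ] E} {C : ℝ}
    (hC : ∀ n, ‖A n‖ ≤ C) (hA : ∀ x, Tendsto (fun n => A n x) l (𝓝 (B x)))
    {K : E →L[ℂ] E} (hK : IsCompactOperator K) :
    Tendsto (fun n => A n ∘L K) l (𝓝 (B ∘L K)) := by
  rw [Metric.tendsto_nhds]
  intro ε hε
  set C' := |C| + ‖B‖ + 1 with hC'
  have hC'0 : 0 < C' := by positivity
  have htb : TotallyBounded (K '' Metric.closedBall 0 1) :=
    (hK.isCompact_closure_image_closedBall 1).totallyBounded.subset subset_closure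
  obtain ⟨t, ht, hcov⟩ := Metric.totallyBounded_iff.1 htb (ε / (4 * C')) (by positivity)
  have hev : ∀ᶠ n in l, ∀ y ∈ t, dist (A n y) (B y) < ε / 4 :=
    (Filter.eventually_all_finite ht).2 fun y _ => Metric.tendsto_nhds.1 (hA y) _ (by positivity)
  filter_upwards [hev] with n hn
  rw [dist_eq_norm, ← ContinuousLinearMap.sub_comp]
  have hle : ‖(A n - B) ∘L K‖ ≤ ε / 2 := by
    refine ContinuousLinearMap.opNorm_le_of_unit_norm (by positivity) fun x hx => ?_
    have hmem : K x ∈ K '' Metric.closedBall 0 1 := ⟨x, by simp [hx], rfl⟩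
    obtain ⟨y, hy, hxy⟩ := Set.mem_iUnion₂.1 (hcov hmem)
    rw [Metric.mem_ball, dist_eq_norm] at hxy
    have h1 : ‖(A n - B) (K x - y)‖ ≤ C' * (ε / (4 * C')) := by
      refine ((A n - B).le_of_opNorm_le (?_ : _ ≤ C') _).trans (by gcongr)
      refine (norm_sub_le _ _).trans ?_
      have := (hC n).trans (le_abs_self C)
      linarith
    have h2 : ‖(A n - B) y‖ < ε / 4 := by
      have := hn y hy
      rwa [dist_eq_norm] at this
    have h3 : ((A n - B) ∘L K) x = (A n - B) (K x - y) + (A n - B) y := by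
      rw [map_sub]; simp
    have h4 : C' * (ε / (4 * C')) = ε / 4 := by field_simp
    rw [h3]
    refine (norm_add_le _ _).trans ?_
    linarith
  linarith

/-- Compactness gives `A n K → B K` in norm, and taking adjoints gives `K A n → K B`;
self-adjointness is what makes the second step possible. -/
theorem tendsto_sandwich_comp {A : ι → E →L[ℂ] E} {B K : E →L[ℂ] E} {C : ℝ}
    (hC : ∀ n, ‖A n‖ ≤ C) (hA : ∀ x, Tendsto (fun n => A n x) l (𝓝 (B x)))
    (hAs : ∀ n, IsSelfAdjoint (A n)) (hBs : IsSelfAdjoint B) (hK : IsCompactOperator K)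
    (hKs : IsSelfAdjoint K) :
    Tendsto (fun n => A n ∘L K ∘L A n) l (𝓝 (B ∘L K ∘L B)) := by
  have h1 : Tendsto (fun n => A n * K) l (𝓝 (B * K)) :=
    tendsto_comp_of_isCompactOperator hC hA hK
  have h2 : Tendsto (fun n => K * A n) l (𝓝 (K * B)) := by
    have := (continuous_star.tendsto _).comp h1
    simpa only [Function.comp_def, star_mul, hKs.star_eq, hBs.star_eq, (hAs _).star_eq] using this
  have h3 : Tendsto (fun n => A n * (K * A n - K * B)) l (𝓝 0) := by
    refine squeeze_zero_norm (a := fun n => |C| * ‖K * A n - K * B‖) (fun n => ?_) ?_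
    · refine (norm_mul_le _ _).trans ?_
      gcongr
      exact (hC n).trans (le_abs_self C)
    · have := ((h2.sub_const (K * B)).norm).const_mul |C|
      simpa using this
  have h4 := h3.add (h1.mul_const B)
  have h5 : ∀ n, A n * (K * A n - K * B) + A n * K * B = A n * (K * A n) := fun n => by
    noncomm_ring
  simp only [h5, zero_add] at h4
  rw [mul_assoc] at h4
  exact h4

theorem isSelfAdjoint_sqrt (A : E →L[ℂ] E) : IsSelfAdjoint (CFC.sqrt A) :=
  (CFC.sqrt_nonneg A).isSelfAdjoint

theorem norm_sqrt_le {A : E →L[ℂ] E} (hA : 0 ≤ A) {C : ℝ} (hC : ‖A‖ ≤ C) :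
    ‖CFC.sqrt A‖ ≤ √C := by
  apply Real.le_sqrt_of_sq_le
  rw [← (isSelfAdjoint_sqrt A).norm_mul_self, CFC.sqrt_mul_sqrt_self A hA]
  exact hC

theorem norm_sandwich_le {A : E →L[ℂ] E} (hA : 0 ≤ A) (K : E →L[ℂ] E) :
    ‖sandwich A K‖ ≤ ‖A‖ * ‖K‖ := by
  have h := norm_sqrt_le hA le_rfl
  calc ‖CFC.sqrt A * (K * CFC.sqrt A)‖
      ≤ ‖CFC.sqrt A‖ * (‖K‖ * ‖CFC.sqrt A‖) :=
        (norm_mul_le _ _).trans (by gcongr; exact norm_mul_le _ _)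
    _ ≤ √‖A‖ * (‖K‖ * √‖A‖) := by gcongr
    _ = √‖A‖ * √‖A‖ * ‖K‖ := by ring
    _ = ‖A‖ * ‖K‖ := by rw [Real.mul_self_sqrt (norm_nonneg A)]

theorem sandwich_nonneg (A : E →L[ℂ] E) {K : E →L[ℂ] E} (hK : 0 ≤ K) : 0 ≤ sandwich A K := by
  have := star_left_conjugate_nonneg hK (CFC.sqrt A)
  rw [(isSelfAdjoint_sqrt A).star_eq] at this
  exact this

theorem opAbs_nonneg (A : E →L[ℂ] E) : 0 ≤ opAbs A := CFC.abs_nonneg A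

theorem norm_opAbs (A : E →L[ℂ] E) : ‖opAbs A‖ = ‖A‖ := CFC.norm_abs

theorem opAbs_eq (A : E →L[ℂ] E) : opAbs A = CFC.sqrt (star A * A) := rfl

/-- Taking adjoints is not strongly continuous, so convergence of the adjoints is a separate
hypothesis; both are needed for `A* A`. -/
theorem tendsto_opAbs_apply {A : ι → E →L[ℂ] E} {B : E →L[ℂ] E} {C : ℝ}
    (hC : ∀ n, ‖A n‖ ≤ C) (hBC : ‖B‖ ≤ C) (hA : ∀ x, Tendsto (fun n => A n x) l (𝓝 (B x)))
    (hA' : ∀ x, Tendsto (fun n => star (A n) x) l (𝓝 (star B x))) (x : E) :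
    Tendsto (fun n => opAbs (A n) x) l (𝓝 (opAbs B x)) := by
  have h1 : ∀ x, Tendsto (fun n => (star (A n) * A n) x) l (𝓝 ((star B * B) x)) := fun x =>
    tendsto_apply_of_norm_le (A := fun n => star (A n)) (B := star B) (C := C)
      (fun n => (norm_star (A n)).trans_le (hC n)) (hA' (B x)) (hA x)
  have hmul : ∀ T : E →L[ℂ] E, ‖T‖ ≤ C → ‖star T * T‖ ≤ C * C := fun T hT => by
    rw [CStarRing.norm_star_mul_self]
    exact mul_le_mul hT hT (norm_nonneg _) ((norm_nonneg _).trans hT)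
  simp only [opAbs_eq]
  exact tendsto_sqrt_apply (C := C * C) (fun n => star_mul_self_nonneg (A n))
    (star_mul_self_nonneg B) (fun n => hmul _ (hC n)) (hmul _ hBC) h1 x

theorem tendsto_sandwich_opAbs {A : ι → E →L[ℂ] E} {B K : E →L[ℂ] E} {C : ℝ}
    (hC : ∀ n, ‖A n‖ ≤ C) (hBC : ‖B‖ ≤ C) (hA : ∀ x, Tendsto (fun n => A n x) l (𝓝 (B x)))
    (hA' : ∀ x, Tendsto (fun n => star (A n) x) l (𝓝 (star B x)))
    (hK : IsCompactOperator K) (hKs : IsSelfAdjoint K) :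
    Tendsto (fun n => sandwich (opAbs (A n)) K) l (𝓝 (sandwich (opAbs B) K)) := by
  have h3 : ∀ x, Tendsto (fun n => CFC.sqrt (opAbs (A n)) x) l (𝓝 (CFC.sqrt (opAbs B) x)) :=
    tendsto_sqrt_apply (C := C) (fun n => opAbs_nonneg _) (opAbs_nonneg _)
      (fun n => by rw [norm_opAbs]; exact hC n) (by rw [norm_opAbs]; exact hBC)
      (tendsto_opAbs_apply hC hBC hA hA')
  exact tendsto_sandwich_comp (C := √C)
    (fun n => norm_sqrt_le (opAbs_nonneg _) (by rw [norm_opAbs]; exact hC n)) h3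
    (fun n => isSelfAdjoint_sqrt _) (isSelfAdjoint_sqrt _) hK hKs

end StrongConvergence

/-! ### Leading eigenvectors of positive operators: min-max, Weyl and Davis–Kahan bounds -/

section LeadingEigenvectors

variable {E : Type*} [NormedAddCommGroup E] [InnerProductSpace ℂ E] [CompleteSpace E]

/-- The span of the first `M` vectors of a sequence. -/
def headSpan (v : ℕ+ → E) (M : ℕ) : Submodule ℂ E :=
  (Submodule.span ℂ {f : E | ∃ j : ℕ+, (j : ℕ) ≤ M ∧ f = v j}).topologicalClosure

instance (v : ℕ+ → E) (M : ℕ) : CompleteSpace (headSpan v M) :=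
  (Submodule.isClosed_topologicalClosure _).completeSpace_coe

/-- The orthogonal projection onto the span of the first `M` vectors of a sequence. -/
def headProj (v : ℕ+ → E) (M : ℕ) : E →L[ℂ] E :=
  projSpan {f : E | ∃ j : ℕ+, (j : ℕ) ≤ M ∧ f = v j}

theorem headProj_eq (v : ℕ+ → E) (M : ℕ) : headProj v M = (headSpan v M).starProjection := rfl

theorem head_set_eq (v : ℕ+ → E) (M : ℕ) :
    {f : E | ∃ j : ℕ+, (j : ℕ) ≤ M ∧ f = v j} =
      Set.range fun i : Fin M => v (Nat.succPNat i) := by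
  ext f
  constructor
  · rintro ⟨j, hj, rfl⟩
    have := j.pos
    refine ⟨⟨j - 1, by omega⟩, ?_⟩
    refine congrArg v (PNat.eq ?_)
    simp only [Nat.succPNat_coe]
    omega
  · rintro ⟨i, rfl⟩
    exact ⟨_, by simp only [Nat.succPNat_coe]; omega, rfl⟩

theorem headSpan_eq (v : ℕ+ → E) (M : ℕ) :
    headSpan v M = Submodule.span ℂ (Set.range fun i : Fin M => v (Nat.succPNat i)) := by
  rw [headSpan, head_set_eq]
  haveI : FiniteDimensional ℂ (Submodule.span ℂ (Set.range fun i : Fin M => v (Nat.succPNat i))) :=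
    FiniteDimensional.span_of_finite ℂ (Set.finite_range _)
  exact (Submodule.closed_of_finiteDimensional _).submodule_topologicalClosure_eq

instance (v : ℕ+ → E) (M : ℕ) : FiniteDimensional ℂ (headSpan v M) := by
  rw [headSpan_eq]
  exact FiniteDimensional.span_of_finite ℂ (Set.finite_range _)

theorem finrank_headSpan_le (v : ℕ+ → E) (M : ℕ) : Module.finrank ℂ (headSpan v M) ≤ M := by
  rw [headSpan_eq]
  exact (finrank_range_le_card _).trans (Fintype.card_fin M).le

theorem mem_headSpan (v : ℕ+ → E) {M : ℕ} {j : ℕ+} (hj : (j : ℕ) ≤ M) : v j ∈ headSpan v M :=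
  Submodule.le_topologicalClosure _ (Submodule.subset_span ⟨j, hj, rfl⟩)

theorem headSpan_le {v : ℕ+ → E} {M : ℕ} {W : Submodule ℂ E}
    (h : ∀ j : ℕ+, (j : ℕ) ≤ M → v j ∈ W) : headSpan v M ≤ W := by
  rw [headSpan_eq, ← head_set_eq, Submodule.span_le]
  rintro f ⟨j, hj, rfl⟩
  exact h j hj

theorem headSpan_mono (v : ℕ+ → E) : Monotone (headSpan v) := fun _ _ hMN =>
  headSpan_le fun _ hj => mem_headSpan v (hj.trans hMN)

theorem tendsto_headProj_apply (v : ℕ+ → E) (W : Submodule ℂ E) [CompleteSpace W]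
    (hW : (Submodule.span ℂ (Set.range v)).topologicalClosure = W) (x : E) :
    Tendsto (fun M => headProj v M x) atTop (𝓝 (W.starProjection x)) := by
  subst hW
  have h : (⨆ M, headSpan v M).topologicalClosure =
      (Submodule.span ℂ (Set.range v)).topologicalClosure := by
    congr 1
    apply le_antisymm
    · exact iSup_le fun M => headSpan_le fun j _ => Submodule.subset_span ⟨j, rfl⟩
    · rw [Submodule.span_le]
      rintro _ ⟨j, rfl⟩
      exact (le_iSup (headSpan v) (j : ℕ)) (mem_headSpan v le_rfl)
  haveI : CompleteSpace (⨆ M, headSpan v M).topologicalClosure := by rw [h]; infer_instance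
  have := Submodule.starProjection_tendsto_closure_iSup (headSpan v) (headSpan_mono v) x
  simp only [h] at this
  exact this

theorem norm_headProj_le (v : ℕ+ → E) (M : ℕ) : ‖headProj v M‖ ≤ 1 :=
  Submodule.starProjection_norm_le _

theorem isSelfAdjoint_headProj (v : ℕ+ → E) (M : ℕ) : IsSelfAdjoint (headProj v M) :=
  isSelfAdjoint_starProjection _

/-- Each coefficient is at most `‖x‖`. The factor `M` is crude but harmless, since `M` stays fixed
in the limit. -/
theorem norm_apply_le_of_mem_span {M : ℕ} {w : Fin M → E} (hw : Orthonormal ℂ w) {T : E →L[ℂ] E}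
    {δ : ℝ} (hT : ∀ i, ‖T (w i)‖ ≤ δ) {x : E} (hx : x ∈ Submodule.span ℂ (Set.range w)) :
    ‖T x‖ ≤ M * δ * ‖x‖ := by
  obtain ⟨c, rfl⟩ := (Submodule.mem_span_range_iff_exists_fun ℂ).1 hx
  have hc : ∀ i, ‖c i‖ ≤ ‖∑ i, c i • w i‖ := fun i => by
    have h1 : ⟪w i, ∑ i, c i • w i⟫_ℂ = c i := hw.inner_right_fintype c i
    have h2 := norm_inner_le_norm (𝕜 := ℂ) (w i) (∑ i, c i • w i)
    rwa [h1, hw.1 i, one_mul] at h2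
  set x := ∑ i, c i • w i with hxdef
  calc ‖T x‖ = ‖∑ i, c i • T (w i)‖ := by rw [hxdef, map_sum]; simp
    _ ≤ ∑ i, ‖c i • T (w i)‖ := norm_sum_le _ _
    _ ≤ ∑ _i : Fin M, ‖x‖ * δ := by
        refine Finset.sum_le_sum fun i _ => ?_
        rw [norm_smul]
        exact mul_le_mul (hc i) (hT i) (norm_nonneg _) (norm_nonneg _)
    _ = M * δ * ‖x‖ := by simp; ring

/-- Here `n` linear conditions meet `n + 1` unknowns: the dimension count of the min-max principle.
-/
theorem exists_mem_span_orthogonal {n : ℕ} {v : Fin (n + 1) → E} (hv : Orthonormal ℂ v)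
    (w : Fin n → E) : ∃ c : Fin (n + 1) → ℂ, ∑ i, c i • v i ≠ 0 ∧
      ∀ j, ⟪w j, ∑ i, c i • v i⟫_ℂ = 0 := by
  let T : (Fin (n + 1) → ℂ) →ₗ[ℂ] (Fin n → ℂ) :=
    LinearMap.pi fun j => (innerSL ℂ (w j) : E →ₗ[ℂ] ℂ) ∘ₗ Fintype.linearCombination ℂ v
  have hker : LinearMap.ker T ≠ ⊥ := LinearMap.ker_ne_bot_of_finrank_lt (by simp)
  obtain ⟨c, hc, hc0⟩ := (Submodule.ne_bot_iff _).1 hker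
  refine ⟨c, fun h => hc0 ?_, fun j => ?_⟩
  · exact funext fun i => Fintype.linearIndependent_iff.1 hv.linearIndependent c h i
  · have := congrFun (LinearMap.mem_ker.1 hc) j
    change ⟪w j, Fintype.linearCombination ℂ v c⟫_ℂ = 0 at this
    rwa [Fintype.linearCombination_apply] at this

/-- A positive operator with an eigendecomposition of `W` and vanishing on `Wᗮ`. -/
structure IsPosEigendecomposition (A : E →L[ℂ] E) (W : Submodule ℂ E) (e : ℕ+ → ℝ) (v : ℕ+ → E) :
    Prop extends IsEigendecomposition A W e v where
  nonneg : 0 ≤ A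
  apply_eq_zero : ∀ x ∈ Wᗮ, A x = 0

namespace IsPosEigendecomposition

variable {A B : E →L[ℂ] E} {W W' : Submodule ℂ E} {e f : ℕ+ → ℝ} {v w : ℕ+ → E}

theorem isSymmetric (h : IsPosEigendecomposition A W e v) : (A : E →ₗ[ℂ] E).IsSymmetric :=
  ((ContinuousLinearMap.nonneg_iff_isPositive A).1 h.nonneg).isSymmetric

theorem orthonormal_fin (h : IsPosEigendecomposition A W e v) (M : ℕ) :
    Orthonormal ℂ fun i : Fin M => v (Nat.succPNat i) :=
  h.orthonormal.comp _ fun _ _ hij => Fin.ext (Nat.succPNat_injective hij)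

theorem mem (h : IsPosEigendecomposition A W e v) (j : ℕ+) : v j ∈ W := by
  rw [← h.closure_span]
  exact Submodule.le_topologicalClosure _ (Submodule.subset_span ⟨j, rfl⟩)

theorem eigenvalue_nonneg (h : IsPosEigendecomposition A W e v) (j : ℕ+) : 0 ≤ e j := by
  have h1 := ((ContinuousLinearMap.nonneg_iff_isPositive A).1 h.nonneg).re_inner_nonneg_right (v j)
  rw [h.apply_eq, inner_smul_right, inner_self_eq_norm_sq_to_K, h.orthonormal.1 j] at h1
  simpa using h1

theorem headProj_commute (h : IsPosEigendecomposition A W e v) (M : ℕ) (x : E) :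
    headProj v M (A x) = A (headProj v M x) := by
  have h1 : ∀ x ∈ headSpan v M, A x ∈ headSpan v M := by
    have : headSpan v M ≤ (headSpan v M).comap (A : E →ₗ[ℂ] E) := by
      refine headSpan_le fun j hj => ?_
      change A (v j) ∈ headSpan v M
      rw [h.apply_eq]
      exact Submodule.smul_mem _ _ (mem_headSpan v hj)
    exact fun x hx => this hx
  refine starProjection_commute_of_mapsTo h1 (fun x hx => ?_) x
  rw [Submodule.mem_orthogonal] at hx ⊢
  intro u hu
  rw [← hx (A u) (h1 u hu)]
  exact (h.isSymmetric u x).symm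

/-- `A` sees only the component of `x` in `W`. In the eigenbasis of `W` the coordinates before `j₀`
vanish and the others are scaled by at most `e j₀`. -/
theorem norm_apply_le (h : IsPosEigendecomposition A W e v) (j₀ : ℕ+) {x : E}
    (hx : ∀ j < j₀, ⟪v j, x⟫_ℂ = 0) : ‖A x‖ ≤ e j₀ * ‖x‖ := by
  haveI : CompleteSpace W := by
    rw [← h.closure_span]
    exact (Submodule.isClosed_topologicalClosure _).completeSpace_coe
  have hWcl : IsClosed (W : Set E) := by
    rw [← h.closure_span]; exact Submodule.isClosed_topologicalClosure _
  have hAW : ∀ y ∈ W, A y ∈ W := by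
    have : W ≤ W.comap (A : E →ₗ[ℂ] E) := by
      conv_lhs => rw [← h.closure_span]
      refine Submodule.topologicalClosure_minimal _ (Submodule.span_le.2 ?_)
        (hWcl.preimage A.continuous)
      rintro _ ⟨j, rfl⟩
      change A (v j) ∈ W
      rw [h.apply_eq]
      exact W.smul_mem _ (h.mem j)
    exact fun y hy => this hy
  set y : E := W.starProjection x with hy
  have hyW : y ∈ W := W.starProjection_apply_mem x
  have hAx : A x = A y := by
    have := h.apply_eq_zero _ (W.sub_starProjection_mem_orthogonal x)
    rwa [map_sub, sub_eq_zero] at this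
  let u : ℕ+ → W := fun j => ⟨v j, h.mem j⟩
  have hu : Orthonormal ℂ u := by
    have := h.orthonormal
    exact (W.subtypeₗᵢ.orthonormal_comp_iff (v := u)).1 this
  have hsp : ⊤ ≤ (Submodule.span ℂ (Set.range u)).topologicalClosure := by
    have hotop : (Submodule.span ℂ (Set.range u))ᗮ = ⊥ := by
      rw [eq_bot_iff]
      intro z hz
      rw [Submodule.mem_bot]
      have hperp : ∀ z : E, (∀ j, ⟪v j, z⟫_ℂ = 0) → z ∈ Wᗮ := fun z hz => by
        rw [← h.closure_span, Submodule.orthogonal_closure, Submodule.mem_orthogonal]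
        intro t ht
        induction ht using Submodule.span_induction with
        | mem t ht =>
          obtain ⟨j, rfl⟩ := ht
          exact hz j
        | zero => exact inner_zero_left _
        | add a b _ _ ha hb => rw [inner_add_left, ha, hb, add_zero]
        | smul c a _ ha => rw [inner_smul_left, ha, mul_zero]
      have hz' := hperp z fun j =>
        (Submodule.mem_orthogonal _ _).1 hz (u j) (Submodule.subset_span ⟨j, rfl⟩)
      have := (Submodule.mem_orthogonal _ _).1 hz' z z.2
      exact Subtype.ext (inner_self_eq_zero.1 this)
    rw [(Submodule.topologicalClosure_eq_top_iff).2 hotop]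
  let b := HilbertBasis.mk hu hsp
  have hle : ‖(⟨A y, hAW y hyW⟩ : W)‖ ≤ ‖((e j₀ : ℝ) : ℂ) • (⟨y, hyW⟩ : W)‖ := by
    refine norm_le_of_coords_le b fun j => ?_
    have hbj : b j = u j := by rw [HilbertBasis.coe_mk]
    rw [hbj, inner_smul_right]
    have h1 : ⟪u j, (⟨A y, hAW y hyW⟩ : W)⟫_ℂ = (e j : ℂ) * ⟪v j, y⟫_ℂ := by
      change ⟪v j, A y⟫_ℂ = _
      have : ⟪A (v j), y⟫_ℂ = ⟪v j, A y⟫_ℂ := h.isSymmetric (v j) y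
      rw [← this, h.apply_eq, inner_smul_left, Complex.conj_ofReal]
    have h2 : ⟪u j, (⟨y, hyW⟩ : W)⟫_ℂ = ⟪v j, y⟫_ℂ := rfl
    have h3 : ⟪v j, y⟫_ℂ = ⟪v j, x⟫_ℂ := by
      have := (Submodule.mem_orthogonal _ _).1 (W.sub_starProjection_mem_orthogonal x) (v j)
        (h.mem j)
      rw [inner_sub_right, sub_eq_zero] at this
      exact this.symm
    rw [h1, h2, h3, norm_mul, norm_mul, Complex.norm_of_nonneg (h.eigenvalue_nonneg j),
      Complex.norm_of_nonneg (h.eigenvalue_nonneg j₀)]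
    rcases lt_or_ge j j₀ with hj | hj
    · rw [hx j hj]; simp
    · gcongr
      exact h.antitone hj
  rw [norm_smul, Complex.norm_of_nonneg (h.eigenvalue_nonneg j₀)] at hle
  rw [hAx]
  refine hle.trans ?_
  gcongr
  · exact h.eigenvalue_nonneg j₀
  · exact W.norm_starProjection_apply_le x

theorem le_re_inner (h : IsPosEigendecomposition A W e v) (n : ℕ) (c : Fin (n + 1) → ℂ) :
    e (Nat.succPNat n) * ‖∑ i, c i • v (Nat.succPNat i)‖ ^ 2 ≤
      (⟪∑ i, c i • v (Nat.succPNat i), A (∑ i, c i • v (Nat.succPNat i))⟫_ℂ).re := by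
  have ho := h.orthonormal_fin (n + 1)
  have hA : A (∑ i, c i • v (Nat.succPNat i)) =
      ∑ i : Fin (n + 1), ((e (Nat.succPNat i) : ℂ) * c i) • v (Nat.succPNat i) := by
    rw [map_sum]
    refine Finset.sum_congr rfl fun i _ => ?_
    rw [map_smul, h.apply_eq, smul_smul, mul_comm]
  have hn : ‖∑ i : Fin (n + 1), c i • v (Nat.succPNat i)‖ ^ 2 = ∑ i, ‖c i‖ ^ 2 := by
    have := ho.inner_sum c c Finset.univ
    rw [inner_self_eq_norm_sq_to_K] at this
    have h2 := congrArg Complex.re this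
    simp only [Complex.conj_mul', Complex.re_sum] at h2
    norm_cast at h2
  rw [hA, ho.inner_sum c _ Finset.univ, hn, Complex.re_sum, Finset.mul_sum]
  refine Finset.sum_le_sum fun i _ => ?_
  have : (starRingEnd ℂ) (c i) * ((e (Nat.succPNat i) : ℂ) * c i) =
      ((e (Nat.succPNat i) * ‖c i‖ ^ 2 : ℝ) : ℂ) := by
    push_cast
    rw [← Complex.conj_mul']
    ring
  rw [this, Complex.ofReal_re]
  gcongr
  refine h.antitone ?_
  rw [← PNat.coe_le_coe]
  simp only [Nat.succPNat_coe]
  omega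

/-- Weyl's inequality. A nonzero `x` in the span of the first `j` eigenvectors of `B`, orthogonal to
the first `j - 1` eigenvectors of `A`, has Rayleigh quotient at least `e j` for `B` and at most `f
j` for `A`. -/
theorem eigenvalue_le (hB : IsPosEigendecomposition B W e v)
    (hA : IsPosEigendecomposition A W' f w) (j : ℕ+) : e j ≤ f j + ‖A - B‖ := by
  obtain ⟨n, rfl⟩ : ∃ n : ℕ, j = Nat.succPNat n := ⟨j.natPred, (PNat.succPNat_natPred j).symm⟩
  obtain ⟨c, hc0, hc⟩ := exists_mem_span_orthogonal (hB.orthonormal_fin (n + 1))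
    (fun i : Fin n => w (Nat.succPNat i))
  set x := ∑ i, c i • v (Nat.succPNat i) with hx
  have h1 : e (Nat.succPNat n) * ‖x‖ ^ 2 ≤ (⟪x, B x⟫_ℂ).re := hB.le_re_inner n c
  have h2 : ‖A x‖ ≤ f (Nat.succPNat n) * ‖x‖ := by
    refine hA.norm_apply_le _ fun k hk => ?_
    rw [← PNat.coe_lt_coe, Nat.succPNat_coe] at hk
    have hk' : k.natPred < n := by
      have := PNat.natPred_add_one k
      omega
    have := hc ⟨k.natPred, hk'⟩
    simpa only [PNat.succPNat_natPred] using this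
  have h3 : ⟪x, B x⟫_ℂ = ⟪x, A x⟫_ℂ - ⟪x, (A - B) x⟫_ℂ := by
    rw [sub_apply, inner_sub_right]; ring
  have h4 : (⟪x, A x⟫_ℂ).re ≤ ‖x‖ * ‖A x‖ := (Complex.re_le_norm _).trans (norm_inner_le_norm _ _)
  have h5 : -(⟪x, (A - B) x⟫_ℂ).re ≤ ‖x‖ * (‖A - B‖ * ‖x‖) := by
    refine (neg_le_abs _).trans ((Complex.abs_re_le_norm _).trans
      ((norm_inner_le_norm _ _).trans ?_))
    gcongr
    exact (A - B).le_opNorm x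
  have h6 : e (Nat.succPNat n) * ‖x‖ ^ 2 ≤ (f (Nat.succPNat n) + ‖A - B‖) * ‖x‖ ^ 2 := by
    rw [h3, Complex.sub_re] at h1
    nlinarith [mul_le_mul_of_nonneg_left h2 (norm_nonneg x)]
  exact le_of_mul_le_mul_right h6 (by positivity)

/-- Projecting `(A - B) u = (a - B) u` off the leading span of `B` gives `(a - B) y`, where `y` is
the component of `u` off that span. There `B` is bounded by `e (M + 1)`, so `a - B` is at least `g`.
-/
theorem norm_sub_headProj_le (hB : IsPosEigendecomposition B W e v) (M : ℕ+) {u : E}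
    (hu1 : ‖u‖ = 1) {a g : ℝ} (hu : A u = (a : ℂ) • u) (hg : 0 < g) (hag : g ≤ a - e (M + 1)) :
    ‖u - headProj v M u‖ ≤ ‖A - B‖ / g := by
  have ha : 0 ≤ a := by have := hB.eigenvalue_nonneg (M + 1); linarith
  set y := u - headProj v M u with hy
  have hyo : y ∈ (headSpan v M)ᗮ := (headSpan v M).sub_starProjection_mem_orthogonal u
  have h1 : ‖B y‖ ≤ e (M + 1) * ‖y‖ := hB.norm_apply_le _ fun j hj =>
    (Submodule.mem_orthogonal _ _).1 hyo _ (mem_headSpan v (by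
      rw [PNat.lt_add_one_iff] at hj; exact_mod_cast hj))
  have h2 : (a : ℂ) • y = B y + (headSpan v M)ᗮ.starProjection ((A - B) u) := by
    have hc := hB.headProj_commute M u
    rw [headProj_eq] at hc
    have hP : (headSpan v M).starProjection ((A - B) u) =
        (a : ℂ) • (headSpan v M).starProjection u - B ((headSpan v M).starProjection u) := by
      rw [sub_apply, map_sub, hc, hu, map_smul]
    rw [Submodule.starProjection_orthogonal_val, hP, hy, headProj_eq, map_sub, smul_sub,
      sub_apply, hu]
    abel
  have h3 : a * ‖y‖ ≤ e (M + 1) * ‖y‖ + ‖A - B‖ := by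
    have h4 : a * ‖y‖ = ‖(a : ℂ) • y‖ := by rw [norm_smul, Complex.norm_of_nonneg ha]
    rw [h4, h2]
    refine (norm_add_le _ _).trans (add_le_add h1 ?_)
    refine (Submodule.norm_starProjection_apply_le _ _).trans ?_
    simpa [hu1] using (A - B).le_opNorm u
  rw [le_div_iff₀ hg]
  nlinarith [norm_nonneg y]

theorem tendsto_headProj {ι : Type*} {l : Filter ι} {A : ι → E →L[ℂ] E}
    {W' : ι → Submodule ℂ E} {f : ι → ℕ+ → ℝ} {w : ι → ℕ+ → E}
    (hA : ∀ n, IsPosEigendecomposition (A n) (W' n) (f n) (w n))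
    (hB : IsPosEigendecomposition B W e v) (hAB : Tendsto A l (𝓝 B)) {M : ℕ+}
    (hM : e (M + 1) ≠ e M) :
    Tendsto (fun n => headProj (w n) M) l (𝓝 (headProj v M)) := by
  have hgap : 0 < e M - e (M + 1) :=
    sub_pos.2 (lt_of_le_of_ne (hB.antitone (PNat.lt_add_right M 1).le) hM)
  -- Half the gap: by Weyl's inequality one eigenvalue of the pair moves by less than `g`, so a gap
  -- of at least `g` remains between the `M`-th eigenvalue of one operator and the next eigenvalue
  -- of the other.
  set g := (e M - e (M + 1)) / 2 with hg
  have hg0 : 0 < g := by positivity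
  have hn : Tendsto (fun n => ‖A n - B‖) l (𝓝 0) := tendsto_iff_norm_sub_tendsto_zero.1 hAB
  rw [tendsto_iff_norm_sub_tendsto_zero]
  refine squeeze_zero' (g := fun n => (M : ℕ) * (‖A n - B‖ / g) + (M : ℕ) * (‖A n - B‖ / g))
    (Eventually.of_forall fun n => norm_nonneg _) ?_ ?_
  · filter_upwards [hn.eventually (gt_mem_nhds hg0)] with n hn
    have key : ∀ {T S : E →L[ℂ] E} {U U' : Submodule ℂ E} {p q : ℕ+ → ℝ} {a b : ℕ+ → E}
        (_ : IsPosEigendecomposition T U p a) (_ : IsPosEigendecomposition S U' q b)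
        (_ : g ≤ p M - q (M + 1)), ∀ u ∈ headSpan a M,
        ‖u - (headSpan b M).starProjection u‖ ≤ (M : ℕ) * (‖T - S‖ / g) * ‖u‖ := by
      intro T S U U' p q a b hT hS hpq u hu
      rw [headSpan_eq] at hu
      refine norm_apply_le_of_mem_span (T := 1 - headProj b M) (hT.orthonormal_fin M)
        (fun i => ?_) hu
      refine hS.norm_sub_headProj_le M (hT.orthonormal.1 _) (hT.apply_eq _) hg0 (hpq.trans ?_)
      gcongr
      refine hT.antitone ?_
      rw [← PNat.coe_le_coe, Nat.succPNat_coe]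
      omega
    have hlow := hB.eigenvalue_le (hA n) M
    have hup := (hA n).eigenvalue_le hB (M + 1)
    rw [norm_sub_rev] at hup
    refine norm_starProjection_sub_le (by positivity) (by positivity)
      (key (hA n) hB (by linarith)) ?_
    have := key hB (hA n) (by linarith)
    rwa [norm_sub_rev B (A n)] at this
  · have := ((hn.div_const g).const_mul ((M : ℕ) : ℝ))
    simpa using this.add this

end IsPosEigendecomposition

end LeadingEigenvectors

/-! ### Conjugation of operators by an antiunitary -/

section Conjugation

variable {E : Type*} [NormedAddCommGroup E] [InnerProductSpace ℂ E]

/-- Polarization: the real terms are unchanged, and antilinearity swaps the two imaginary ones. -/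
theorem inner_map_map_conjugation (J : E ≃ₗᵢ⋆[ℂ] E) (x y : E) : ⟪J x, J y⟫_ℂ = ⟪y, x⟫_ℂ := by
  have h1 : ∀ a b : E, ‖J a + J b‖ = ‖a + b‖ := fun a b => by rw [← map_add, J.norm_map]
  have h2 : ∀ a b : E, ‖J a - J b‖ = ‖a - b‖ := fun a b => by rw [← map_sub, J.norm_map]
  have h3 : ‖J x - Complex.I • J y‖ = ‖x + Complex.I • y‖ := by
    rw [← h1]; congr 1; rw [J.map_smulₛₗ]; simp [sub_eq_add_neg]
  have h4 : ‖J x + Complex.I • J y‖ = ‖x - Complex.I • y‖ := by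
    rw [← h2]; congr 1; rw [J.map_smulₛₗ]; simp
  have h5 : ‖y - Complex.I • x‖ = ‖x + Complex.I • y‖ := by
    have : x + Complex.I • y = Complex.I • (y - Complex.I • x) := by
      rw [smul_sub, smul_smul, Complex.I_mul_I, neg_one_smul]; abel
    rw [this, norm_smul, Complex.norm_I, one_mul]
  have h6 : ‖y + Complex.I • x‖ = ‖x - Complex.I • y‖ := by
    have : x - Complex.I • y = -(Complex.I • (y + Complex.I • x)) := by
      rw [smul_add, smul_smul, Complex.I_mul_I, neg_one_smul]; abel
    rw [this, norm_neg, norm_smul, Complex.norm_I, one_mul]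
  rw [inner_eq_sum_norm_sq_div_four, inner_eq_sum_norm_sq_div_four]
  simp only [RCLike.I_to_complex]
  rw [h1, h2, h3, h4, h5, h6, add_comm y x, norm_sub_rev y x]

/-- The operator `J A J⁻¹` for an antiunitary `J`. -/
def conjOp (J : E ≃ₗᵢ⋆[ℂ] E) (A : E →L[ℂ] E) : E →L[ℂ] E :=
  (J.toContinuousLinearEquiv : E →SL[starRingEnd ℂ] E).comp
    (A.comp (J.symm.toContinuousLinearEquiv : E →SL[starRingEnd ℂ] E))

variable (J : E ≃ₗᵢ⋆[ℂ] E)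

theorem conjOp_apply (A : E →L[ℂ] E) (x : E) : conjOp J A x = J (A (J.symm x)) := rfl

theorem conjOp_sub (A B : E →L[ℂ] E) : conjOp J (A - B) = conjOp J A - conjOp J B := by
  ext x; simp [conjOp_apply]

theorem conjOp_mul (A B : E →L[ℂ] E) : conjOp J (A * B) = conjOp J A * conjOp J B := by
  ext x; simp [conjOp_apply]

theorem norm_conjOp_le (A : E →L[ℂ] E) : ‖conjOp J A‖ ≤ ‖A‖ := by
  refine ContinuousLinearMap.opNorm_le_bound _ (norm_nonneg _) fun x => ?_
  rw [conjOp_apply, J.norm_map]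
  simpa using A.le_opNorm (J.symm x)

theorem tendsto_conjOp {ι : Type*} {l : Filter ι} {A : ι → E →L[ℂ] E} {B : E →L[ℂ] E}
    (h : Tendsto A l (𝓝 B)) : Tendsto (fun n => conjOp J (A n)) l (𝓝 (conjOp J B)) := by
  rw [tendsto_iff_norm_sub_tendsto_zero] at h ⊢
  refine squeeze_zero (fun n => norm_nonneg _) (fun n => ?_) h
  rw [← conjOp_sub]
  exact norm_conjOp_le J _

theorem isCompactOperator_conjOp {A : E →L[ℂ] E} (hA : IsCompactOperator A) :
    IsCompactOperator (conjOp J A) :=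
  (hA.comp_clm (J.symm.toContinuousLinearEquiv : E →SL[starRingEnd ℂ] E)).continuous_comp
    J.continuous

theorem inner_conjugation_left (x y : E) : ⟪J x, y⟫_ℂ = ⟪J.symm y, x⟫_ℂ := by
  conv_lhs => rw [← J.apply_symm_apply y]
  exact inner_map_map_conjugation J _ _

theorem inner_conjugation_right (x y : E) : ⟪x, J y⟫_ℂ = ⟪y, J.symm x⟫_ℂ := by
  conv_lhs => rw [← J.apply_symm_apply x]
  exact inner_map_map_conjugation J _ _

variable [CompleteSpace E]

theorem star_conjOp (A : E →L[ℂ] E) : star (conjOp J A) = conjOp J (star A) := by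
  symm
  simp only [ContinuousLinearMap.star_eq_adjoint]
  rw [ContinuousLinearMap.eq_adjoint_iff]
  intro x y
  rw [conjOp_apply, conjOp_apply, inner_conjugation_left, inner_conjugation_right,
    ContinuousLinearMap.adjoint_inner_right]

theorem conjOp_nonneg {A : E →L[ℂ] E} (hA : 0 ≤ A) : 0 ≤ conjOp J A := by
  have h : conjOp J A = star (conjOp J (CFC.sqrt A)) * conjOp J (CFC.sqrt A) := by
    rw [star_conjOp, (isSelfAdjoint_sqrt A).star_eq, ← conjOp_mul, CFC.sqrt_mul_sqrt_self A hA]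
  rw [h]
  exact star_mul_self_nonneg _

/-- By uniqueness of the positive square root. It lets conjugation pass through the modulus and the
whole sandwich. -/
theorem conjOp_sqrt {A : E →L[ℂ] E} (hA : 0 ≤ A) :
    conjOp J (CFC.sqrt A) = CFC.sqrt (conjOp J A) := by
  symm
  refine CFC.sqrt_unique ?_ (conjOp_nonneg J (CFC.sqrt_nonneg A))
  rw [← conjOp_mul, CFC.sqrt_mul_sqrt_self A hA]

theorem conjOp_opAbs (A : E →L[ℂ] E) : conjOp J (opAbs A) = opAbs (conjOp J A) := by
  rw [opAbs_eq, opAbs_eq, conjOp_sqrt J (star_mul_self_nonneg A), conjOp_mul, star_conjOp]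

theorem conjOp_sandwich_opAbs (A G : E →L[ℂ] E) :
    conjOp J (sandwich (opAbs A) G) = sandwich (opAbs (conjOp J A)) (conjOp J G) := by
  change conjOp J (CFC.sqrt (opAbs A) * (G * CFC.sqrt (opAbs A))) =
    CFC.sqrt (opAbs (conjOp J A)) * (conjOp J G * CFC.sqrt (opAbs (conjOp J A)))
  rw [conjOp_mul, conjOp_mul, conjOp_sqrt J (opAbs_nonneg A), conjOp_opAbs]

theorem conjOp_starProjection {U V : Submodule ℂ E} [U.HasOrthogonalProjection]
    [V.HasOrthogonalProjection] (hU : ∀ x ∈ U, J x ∈ V) (hV : ∀ x ∈ V, J.symm x ∈ U) :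
    conjOp J U.starProjection = V.starProjection := by
  ext x
  symm
  refine Submodule.eq_starProjection_of_mem_of_inner_eq_zero (hU _ (U.starProjection_apply_mem _))
    fun w hw => ?_
  have h := U.starProjection_inner_eq_zero (J.symm x) _ (hV w hw)
  rw [← inner_map_map_conjugation J, map_sub, J.apply_symm_apply, J.apply_symm_apply,
    ← inner_conj_symm] at h
  exact (map_eq_zero _).1 h

theorem conjOp_headProj (v : ℕ+ → E) (M : ℕ) :
    conjOp J (headProj v M) = headProj (fun j => J (v j)) M := by
  rw [headProj_eq, headProj_eq]
  refine conjOp_starProjection J (fun x hx => ?_) fun x hx => ?_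
  · rw [headSpan_eq] at hx
    induction hx using Submodule.span_induction with
    | mem x hx =>
      obtain ⟨i, rfl⟩ := hx
      exact mem_headSpan (fun j => J (v j)) (by simp only [Nat.succPNat_coe]; omega)
    | zero => rw [map_zero]; exact Submodule.zero_mem _
    | add a b _ _ ha hb => rw [map_add]; exact Submodule.add_mem _ ha hb
    | smul c a _ ha => rw [J.map_smulₛₗ]; exact Submodule.smul_mem _ _ ha
  · rw [headSpan_eq] at hx
    induction hx using Submodule.span_induction with
    | mem x hx =>
      obtain ⟨i, rfl⟩ := hx
      simp only [LinearIsometryEquiv.symm_apply_apply]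
      exact mem_headSpan v (by simp only [Nat.succPNat_coe]; omega)
    | zero => rw [map_zero]; exact Submodule.zero_mem _
    | add a b _ _ ha hb => rw [map_add]; exact Submodule.add_mem _ ha hb
    | smul c a _ ha => rw [J.symm.map_smulₛₗ]; exact Submodule.smul_mem _ _ ha

end Conjugation

/-! ### Restriction of moduli and square roots to a reducing subspace -/

section Restriction

variable {E : Type*} [NormedAddCommGroup E] [InnerProductSpace ℂ E]
variable (W : Submodule ℂ E)

theorem coe_restrictTo_apply [W.HasOrthogonalProjection] (A : E →L[ℂ] E) (x : W) :
    (restrictTo W A x : E) = W.starProjection (A x) := rfl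

theorem coe_restrictTo_apply_of_mem [W.HasOrthogonalProjection] {A : E →L[ℂ] E} {x : W}
    (h : A x ∈ W) : (restrictTo W A x : E) = A x := by
  rw [coe_restrictTo_apply, W.starProjection_eq_self_iff.2 h]

theorem restrictTo_mul [W.HasOrthogonalProjection] (A : E →L[ℂ] E) {B : E →L[ℂ] E}
    (hB : ∀ x ∈ W, B x ∈ W) : restrictTo W (A * B) = restrictTo W A * restrictTo W B := by
  ext x
  have h : (restrictTo W B x : E) = B x := coe_restrictTo_apply_of_mem W (hB x x.2)
  change W.starProjection (A (B x)) = W.starProjection (A (restrictTo W B x : E))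
  rw [h]

theorem norm_restrictTo_le [W.HasOrthogonalProjection] (A : E →L[ℂ] E) :
    ‖restrictTo W A‖ ≤ ‖A‖ := by
  refine ContinuousLinearMap.opNorm_le_bound _ (norm_nonneg _) fun x => ?_
  exact (W.norm_starProjection_apply_le _).trans (A.le_opNorm x)

theorem mem_of_commute_starProjection [W.HasOrthogonalProjection] {A : E →L[ℂ] E}
    (h : Commute A W.starProjection) {x : E} (hx : x ∈ W) : A x ∈ W := by
  have h1 : A (W.starProjection x) = W.starProjection (A x) :=
    congrArg (fun T : E →L[ℂ] E => T x) h.eq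
  rw [W.starProjection_eq_self_iff.2 hx] at h1
  rw [h1]
  exact W.starProjection_apply_mem _

variable [CompleteSpace E] [CompleteSpace W]

theorem star_restrictTo (A : E →L[ℂ] E) : star (restrictTo W A) = restrictTo W (star A) := by
  symm
  simp only [ContinuousLinearMap.star_eq_adjoint]
  rw [ContinuousLinearMap.eq_adjoint_iff]
  intro x y
  change ⟪W.orthogonalProjectionOnto (A.adjoint (x : E)), y⟫_ℂ =
    ⟪x, W.orthogonalProjectionOnto (A (y : E))⟫_ℂ
  rw [Submodule.inner_orthogonalProjectionOnto_eq_of_mem_right,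
    Submodule.inner_orthogonalProjectionOnto_eq_of_mem_left,
    ContinuousLinearMap.adjoint_inner_left]

theorem restrictTo_nonneg {A : E →L[ℂ] E} (hA : 0 ≤ A) : 0 ≤ restrictTo W A := by
  rw [ContinuousLinearMap.nonneg_iff_isPositive] at hA ⊢
  exact hA.orthogonalProjectionOnto_comp W

/-- The positive square root of a positive operator. -/
def opSqrt (A : E →L[ℂ] E) : E →L[ℂ] E := CFC.sqrt A

theorem opSqrt_nonneg (A : E →L[ℂ] E) : 0 ≤ opSqrt A := CFC.sqrt_nonneg A

theorem opSqrt_mul_self {A : E →L[ℂ] E} (hA : 0 ≤ A) : opSqrt A * opSqrt A = A :=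
  CFC.sqrt_mul_sqrt_self A hA

theorem opSqrt_unique {A B : E →L[ℂ] E} (h : B * B = A) (hB : 0 ≤ B) : opSqrt A = B :=
  CFC.sqrt_unique h hB

theorem opAbs_eq_opSqrt (A : E →L[ℂ] E) : opAbs A = opSqrt (star A * A) := rfl

theorem sandwich_eq (A G : E →L[ℂ] E) : sandwich A G = opSqrt A * (G * opSqrt A) := rfl

theorem commute_opSqrt_of_commute {A T : E →L[ℂ] E} (h : Commute A T) : Commute (opSqrt A) T :=
  h.cfcₙ_nnreal _

theorem restrictTo_opSqrt {A : E →L[ℂ] E} (hA : 0 ≤ A) (h : Commute A W.starProjection) :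
    restrictTo W (opSqrt A) = opSqrt (restrictTo W A) := by
  symm
  refine opSqrt_unique ?_ (restrictTo_nonneg W (opSqrt_nonneg A))
  rw [← restrictTo_mul W _ fun x hx =>
    mem_of_commute_starProjection W (commute_opSqrt_of_commute h) hx, opSqrt_mul_self hA]

theorem commute_star_mul_self {A : E →L[ℂ] E} (h : Commute A W.starProjection) :
    Commute (star A * A) W.starProjection := by
  have h2 : star W.starProjection = W.starProjection := isSelfAdjoint_starProjection W
  have h1 := h.star_star
  rw [h2] at h1
  exact h1.mul_left h

theorem commute_opAbs {A : E →L[ℂ] E} (h : Commute A W.starProjection) :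
    Commute (opAbs A) W.starProjection :=
  commute_opSqrt_of_commute (commute_star_mul_self W h)

theorem restrictTo_opAbs {A : E →L[ℂ] E} (h : Commute A W.starProjection) :
    restrictTo W (opAbs A) = opAbs (restrictTo W A) := by
  rw [opAbs_eq_opSqrt, opAbs_eq_opSqrt,
    restrictTo_opSqrt W (star_mul_self_nonneg A) (commute_star_mul_self W h),
    restrictTo_mul W _ fun x hx => mem_of_commute_starProjection W h hx, star_restrictTo]

/-- Reconciles two constructions: `S⁺_{z,τ}` is built on the full space and then restricted to
zero-mean functions, whereas its approximants are built on the zero-mean functions from the start.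
-/
theorem restrictTo_sandwich_opAbs {A G : E →L[ℂ] E} (h : Commute A W.starProjection)
    (hG : ∀ x ∈ W, G x ∈ W) :
    restrictTo W (sandwich (opAbs A) G) = sandwich (opAbs (restrictTo W A)) (restrictTo W G) := by
  have hs : ∀ x ∈ W, opSqrt (opAbs A) x ∈ W := fun x hx =>
    mem_of_commute_starProjection W (commute_opSqrt_of_commute (commute_opAbs W h)) hx
  rw [sandwich_eq, sandwich_eq,
    restrictTo_mul W (opSqrt (opAbs A)) (B := G * opSqrt (opAbs A)) fun x hx => hG _ (hs x hx),
    restrictTo_mul W G hs, restrictTo_opSqrt W (opAbs_nonneg A) (commute_opAbs W h),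
    restrictTo_opAbs W h]

end Restriction

/-! ### Compressions to leading eigenvectors and the abstract convergence theorem -/

section Compression

variable {E : Type*} [NormedAddCommGroup E] [InnerProductSpace ℂ E] [CompleteSpace E]

theorem spectrum_subset_of_norm_le {A : E →L[ℂ] E} (hA : IsSelfAdjoint A) {c : ℝ} (hc : ‖A‖ ≤ c) :
    spectrum ℂ A ⊆ Complex.ofReal '' Set.Icc (-c) c := by
  intro x hx
  rcases subsingleton_or_nontrivial (E →L[ℂ] E) with h | h
  · rw [spectrum.of_subsingleton] at hx
    exact hx.elim
  have hre : x = (x.re : ℂ) := hA.mem_spectrum_eq_re hx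
  have hn : |x.re| ≤ c :=
    (Complex.abs_re_le_norm x).trans ((spectrum.norm_le_norm_of_mem hx).trans hc)
  exact ⟨x.re, abs_le.1 hn, hre.symm⟩

/-- Both Rayleigh quotients lie in `[0, c]`, so their difference lies in `[-c, c]`. The triangle
inequality would only give `2c`, too weak for the interval claimed. -/
theorem norm_sub_le_of_nonneg {A B : E →L[ℂ] E} (hA : 0 ≤ A) (hB : 0 ≤ B) {c : ℝ}
    (hAc : ‖A‖ ≤ c) (hBc : ‖B‖ ≤ c) : ‖A - B‖ ≤ c := by
  have hc : 0 ≤ c := (norm_nonneg A).trans hAc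
  have hsa : IsSelfAdjoint (A - B) := hA.isSelfAdjoint.sub hB.isSelfAdjoint
  have hs := ContinuousLinearMap.isSelfAdjoint_iff_isSymmetric.1 hsa
  rw [ContinuousLinearMap.norm_eq_iSup_rayleighQuotient _ hs]
  refine ciSup_le fun x => ?_
  rw [ContinuousLinearMap.rayleighQuotient, ContinuousLinearMap.reApplyInnerSelf]
  by_cases hx : x = 0
  · simp [hx, hc]
  have hx0 : 0 < ‖x‖ ^ 2 := by positivity
  rw [abs_div, abs_of_pos hx0, div_le_iff₀ hx0, sub_apply, inner_sub_left, map_sub]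
  have key : ∀ T : E →L[ℂ] E, 0 ≤ T → ‖T‖ ≤ c →
      0 ≤ RCLike.re ⟪T x, x⟫_ℂ ∧ RCLike.re ⟪T x, x⟫_ℂ ≤ c * ‖x‖ ^ 2 := fun T h0 hT => by
    refine ⟨((ContinuousLinearMap.nonneg_iff_isPositive T).1 h0).re_inner_nonneg_left x, ?_⟩
    refine (RCLike.re_le_norm _).trans ((norm_inner_le_norm _ _).trans ?_)
    have := T.le_of_opNorm_le hT x
    nlinarith [norm_nonneg x]
  obtain ⟨h1, h2⟩ := key A hA hAc
  obtain ⟨h3, h4⟩ := key B hB hBc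
  rw [abs_le]
  constructor <;> linarith

/-- The compression of `A` to the span of the first `M` vectors of a sequence. -/
def headCompr (v : ℕ+ → E) (M : ℕ) (A : E →L[ℂ] E) : E →L[ℂ] E :=
  headProj v M ∘L A ∘L headProj v M

theorem headCompr_nonneg (v : ℕ+ → E) (M : ℕ) {A : E →L[ℂ] E} (hA : 0 ≤ A) :
    0 ≤ headCompr v M A := by
  have := star_left_conjugate_nonneg hA (headProj v M)
  rw [(isSelfAdjoint_headProj v M).star_eq] at this
  exact this

theorem norm_headProj_mul_mul_le (v : ℕ+ → E) (M : ℕ) (A : E →L[ℂ] E) :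
    ‖headProj v M ∘L A ∘L headProj v M‖ ≤ ‖A‖ := by
  have h := norm_headProj_le v M
  refine (ContinuousLinearMap.opNorm_comp_le _ _).trans ?_
  refine (mul_le_of_le_one_left (norm_nonneg _) h).trans ?_
  refine (ContinuousLinearMap.opNorm_comp_le _ _).trans ?_
  exact mul_le_of_le_one_right (norm_nonneg _) h

theorem isCompactOperator_headCompr (v : ℕ+ → E) (M : ℕ) {A : E →L[ℂ] E}
    (hA : IsCompactOperator A) : IsCompactOperator (headCompr v M A) :=
  (hA.comp_clm (headProj v M)).clm_comp (headProj v M)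

theorem tendsto_headCompr {ι : Type*} {l : Filter ι} {A : ι → E →L[ℂ] E} {B : E →L[ℂ] E}
    {w : ι → ℕ+ → E} {v : ℕ+ → E} {M : ℕ} (hA : Tendsto A l (𝓝 B))
    (hw : Tendsto (fun n => headProj (w n) M) l (𝓝 (headProj v M))) :
    Tendsto (fun n => headCompr (w n) M (A n)) l (𝓝 (headCompr v M B)) :=
  hw.mul (hA.mul hw)

/-- The leading projections converge strongly to the projection onto `W`; compactness of `A` makes
this norm convergence, and `A` is unchanged by compression to `W`. -/
theorem IsPosEigendecomposition.tendsto_headCompr {A : E →L[ℂ] E} {W : Submodule ℂ E}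
    {e : ℕ+ → ℝ} {v : ℕ+ → E} (h : IsPosEigendecomposition A W e v) (hc : IsCompactOperator A) :
    Tendsto (fun M => headCompr v M A) atTop (𝓝 A) := by
  haveI : CompleteSpace W := by
    rw [← h.closure_span]
    exact (Submodule.isClosed_topologicalClosure _).completeSpace_coe
  have hsa : IsSelfAdjoint A := h.nonneg.isSelfAdjoint
  have h1 := tendsto_sandwich_comp (norm_headProj_le v) (tendsto_headProj_apply v W h.closure_span)
    (isSelfAdjoint_headProj v) (isSelfAdjoint_starProjection W) hc hsa
  have h2 : A * W.starProjection = A := by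
    ext x
    have := h.apply_eq_zero _ (W.sub_starProjection_mem_orthogonal x)
    rw [map_sub, sub_eq_zero] at this
    exact this.symm
  have h3 : W.starProjection * A = A := by
    have := congrArg star h2
    rwa [star_mul, hsa.star_eq, (isSelfAdjoint_starProjection W).star_eq] at this
  have h4 : W.starProjection ∘L A ∘L W.starProjection = A := by
    change W.starProjection * (A * W.starProjection) = A
    rw [h2, h3]
  rwa [h4] at h1

variable (J : E ≃ₗᵢ⋆[ℂ] E)

/-- The difference of the compressions of `A` and `J A J⁻¹` to the spans of the first `M` vectors
of a sequence and of its image under `J`. -/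
def diffCompr (v : ℕ+ → E) (M : ℕ) (A : E →L[ℂ] E) : E →L[ℂ] E :=
  headCompr v M A - headCompr (fun j => J (v j)) M (conjOp J A)

theorem headCompr_conj (v : ℕ+ → E) (M : ℕ) (A : E →L[ℂ] E) :
    headCompr (fun j => J (v j)) M (conjOp J A) = conjOp J (headCompr v M A) := by
  change headProj _ M * (conjOp J A * headProj _ M) =
    conjOp J (headProj v M * (A * headProj v M))
  rw [conjOp_mul, conjOp_mul, conjOp_headProj]

theorem diffCompr_eq (v : ℕ+ → E) (M : ℕ) (A : E →L[ℂ] E) :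
    diffCompr J v M A = headCompr v M A - conjOp J (headCompr v M A) := by
  rw [diffCompr, headCompr_conj]

variable {J}

theorem tendsto_diffCompr_of_tendsto {ι : Type*} {l : Filter ι} {w : ι → ℕ+ → E} {M : ι → ℕ}
    {A : ι → E →L[ℂ] E} {X : E →L[ℂ] E}
    (h : Tendsto (fun n => headCompr (w n) (M n) (A n)) l (𝓝 X)) :
    Tendsto (fun n => diffCompr J (w n) (M n) (A n)) l (𝓝 (X - conjOp J X)) := by
  simp only [diffCompr_eq]
  exact h.sub (tendsto_conjOp J h)

theorem isSelfAdjoint_sub_conjOp {A : E →L[ℂ] E} (hA : 0 ≤ A) :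
    IsSelfAdjoint (A - conjOp J A) :=
  hA.isSelfAdjoint.sub (conjOp_nonneg J hA).isSelfAdjoint

theorem isSymmetric_sub_conjOp {A : E →L[ℂ] E} (hA : 0 ≤ A) :
    ((A - conjOp J A : E →L[ℂ] E) : E →ₗ[ℂ] E).IsSymmetric :=
  ContinuousLinearMap.isSelfAdjoint_iff_isSymmetric.1 (isSelfAdjoint_sub_conjOp hA)

theorem isCompactOperator_sub_conjOp {A : E →L[ℂ] E} (hA : IsCompactOperator A) :
    IsCompactOperator (A - conjOp J A : E →L[ℂ] E) :=
  hA.sub (isCompactOperator_conjOp J hA)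

theorem spectrum_diffCompr_subset (v : ℕ+ → E) (M : ℕ) {A : E →L[ℂ] E} (hA : 0 ≤ A) {c : ℝ}
    (hc : ‖A‖ ≤ c) : spectrum ℂ (diffCompr J v M A) ⊆ Complex.ofReal '' Set.Icc (-c) c := by
  have h0 := headCompr_nonneg v M hA
  have hn : ‖headCompr v M A‖ ≤ c := (norm_headProj_mul_mul_le v M A).trans hc
  rw [diffCompr_eq]
  exact spectrum_subset_of_norm_le (isSelfAdjoint_sub_conjOp h0)
    (norm_sub_le_of_nonneg h0 (conjOp_nonneg J h0) hn ((norm_conjOp_le J _).trans hn))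

theorem finrank_range_diffCompr_le (v : ℕ+ → E) (M : ℕ) (A : E →L[ℂ] E) :
    FiniteDimensional ℂ (LinearMap.range (diffCompr J v M A : E →ₗ[ℂ] E)) ∧
    Module.finrank ℂ (LinearMap.range (diffCompr J v M A : E →ₗ[ℂ] E)) ≤ 2 * M := by
  have hle : LinearMap.range (diffCompr J v M A : E →ₗ[ℂ] E) ≤
      headSpan v M ⊔ headSpan (fun j => J (v j)) M := by
    rintro _ ⟨x, rfl⟩
    exact Submodule.sub_mem_sup (Submodule.starProjection_apply_mem _ _)
      (Submodule.starProjection_apply_mem _ _)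
  refine ⟨Submodule.finiteDimensional_of_le hle, (Submodule.finrank_mono hle).trans ?_⟩
  have h1 := Submodule.finrank_add_le_finrank_add_finrank (headSpan v M)
    (headSpan (fun j => J (v j)) M)
  have h2 := finrank_headSpan_le v M
  have h3 := finrank_headSpan_le (fun j => J (v j)) M
  omega

section Rank

variable {A : E →L[ℂ] E} {W : Submodule ℂ E} {e : ℕ+ → ℝ} {v : ℕ+ → E}

theorem headCompr_apply_of_le (h : IsPosEigendecomposition A W e v) {M : ℕ} {j : ℕ+}
    (hj : (j : ℕ) ≤ M) : headCompr v M A (v j) = (e j : ℂ) • v j := by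
  have hP : headProj v M (v j) = v j :=
    (headSpan v M).starProjection_eq_self_iff.2 (mem_headSpan v hj)
  change headProj v M (A (headProj v M (v j))) = _
  rw [hP, h.apply_eq, map_smul, hP]

theorem headCompr_apply_of_orthogonal (h : IsPosEigendecomposition A W e v) (M : ℕ) {x : E}
    (hx : ∀ y ∈ W, ⟪y, x⟫_ℂ = 0) : headCompr v M A x = 0 := by
  have hP : headProj v M x = 0 := by
    rw [headProj_eq, Submodule.starProjection_apply_eq_zero_iff, Submodule.mem_orthogonal]
    exact fun u hu => hx u (headSpan_le (fun j _ => h.mem j) hu)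
  change headProj v M (A (headProj v M x)) = 0
  rw [hP, map_zero, map_zero]

/-- As `W` and `J W` are orthogonal, the difference acts as `e_j` on `v_j` and as `-e_j` on `J v_j`:
the images are nonzero multiples of an orthonormal family. -/
theorem linearIndependent_diffCompr (h : IsPosEigendecomposition A W e v)
    (hJ : ∀ x ∈ W, ∀ y ∈ W, ⟪x, J y⟫_ℂ = 0) {M : ℕ}
    (hpos : ∀ j : ℕ+, (j : ℕ) ≤ M → 0 < e j) :
    LinearIndependent ℂ (diffCompr J v M A ∘ Sum.elim
      (fun i : Fin M => v (Nat.succPNat i)) fun i : Fin M => J (v (Nat.succPNat i))) := by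
  have ho : Orthonormal ℂ (Sum.elim
      (fun i : Fin M => v (Nat.succPNat i)) fun i : Fin M => J (v (Nat.succPNat i))) := by
    have h1 := h.orthonormal_fin M
    have h2 := fun i j => orthonormal_iff_ite.1 h1 i j
    rw [orthonormal_iff_ite]
    rintro (i | i) (j | j)
    · simpa using h2 i j
    · simpa using hJ _ (h.mem _) _ (h.mem _)
    · have := inner_eq_zero_symm.1 (hJ _ (h.mem (Nat.succPNat j)) _ (h.mem (Nat.succPNat i)))
      simpa using this
    · simp only [Sum.elim_inr, Sum.inr.injEq]
      rw [inner_map_map_conjugation, h2 j i]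
      simp only [eq_comm]
  let u : Fin M ⊕ Fin M → ℂˣ := Sum.elim
    (fun i => Units.mk0 (e (Nat.succPNat i) : ℂ) (by
      exact_mod_cast (hpos _ (by simp only [Nat.succPNat_coe]; omega)).ne'))
    (fun i => Units.mk0 (-(e (Nat.succPNat i) : ℂ)) (by
      rw [neg_ne_zero]
      exact_mod_cast (hpos _ (by simp only [Nat.succPNat_coe]; omega)).ne'))
  have hr : ∀ (r : ℝ) (x : E), J (r • x) = r • J x := fun r x => by
    rw [← Complex.coe_smul, J.map_smulₛₗ, Complex.conj_ofReal, Complex.coe_smul]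
  convert! ho.linearIndependent.units_smul u using 1
  ext i
  rw [diffCompr_eq]
  rcases i with i | i
  · have h1 : headCompr v M A (J.symm (v (Nat.succPNat i))) = 0 :=
      headCompr_apply_of_orthogonal h M fun y hy => by
        rw [← inner_map_map_conjugation J, J.apply_symm_apply]
        exact hJ _ (h.mem _) _ hy
    have h2 := headCompr_apply_of_le h (M := M) (j := Nat.succPNat i)
      (by simp only [Nat.succPNat_coe]; omega)
    simp [u, conjOp_apply, h1, h2, Units.smul_def]
  · have h1 : headCompr v M A (J (v (Nat.succPNat i))) = 0 :=
      headCompr_apply_of_orthogonal h M fun y hy => hJ _ hy _ (h.mem _)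
    have h2 := headCompr_apply_of_le h (M := M) (j := Nat.succPNat i)
      (by simp only [Nat.succPNat_coe]; omega)
    simp [u, conjOp_apply, h1, h2, hr, Units.smul_def]

/-- Linear independence of a finite family is an open condition, so the `2M` independent images
survive a small perturbation; the opposite bound always holds. -/
theorem eventually_finrank_range_diffCompr {ι : Type*} {l : Filter ι} {w : ι → ℕ+ → E}
    {B : ι → E →L[ℂ] E}
    (h : IsPosEigendecomposition A W e v) (hJ : ∀ x ∈ W, ∀ y ∈ W, ⟪x, J y⟫_ℂ = 0) {M : ℕ}
    (hpos : ∀ j : ℕ+, (j : ℕ) ≤ M → 0 < e j)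
    (hT : Tendsto (fun n => diffCompr J (w n) M (B n)) l (𝓝 (diffCompr J v M A))) :
    ∀ᶠ n in l, Module.finrank ℂ
      (LinearMap.range (diffCompr J (w n) M (B n) : E →ₗ[ℂ] E)) = 2 * M := by
  set u := Sum.elim
      (fun i : Fin M => v (Nat.succPNat i)) fun i : Fin M => J (v (Nat.succPNat i)) with hu
  have h1 : Tendsto (fun n => diffCompr J (w n) M (B n) ∘ u) l (𝓝 (diffCompr J v M A ∘ u)) := by
    rw [tendsto_pi_nhds]
    exact fun i => (ContinuousLinearMap.apply ℂ E (u i)).continuous.continuousAt.tendsto.comp hT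
  have h2 := h1.eventually ((isOpen_setOfPred_linearIndependent (𝕜 := ℂ) (E := E)).mem_nhds
    (linearIndependent_diffCompr h hJ hpos))
  filter_upwards [h2] with n hn
  obtain ⟨hfd, hle⟩ := finrank_range_diffCompr_le (J := J) (w n) M (B n)
  refine le_antisymm hle ?_
  have hli : LinearIndependent ℂ (fun i => (⟨diffCompr J (w n) M (B n) (u i), ⟨u i, rfl⟩⟩ :
      LinearMap.range (diffCompr J (w n) M (B n) : E →ₗ[ℂ] E))) :=
    LinearIndependent.of_comp (Submodule.subtype _) hn
  have := hli.fintype_card_le_finrank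
  simp only [Fintype.card_sum, Fintype.card_fin] at this
  omega

end Rank

/-- The operator-theoretic core. The dynamics enters only through the orthogonality of `W` and `J
W`, compactness, positivity, the norm limit and the uniform bound `c`. -/
theorem diffCompr_convergence (hE : ¬ FiniteDimensional ℂ E) {A : E →L[ℂ] E} {B : ℕ → E →L[ℂ] E}
    {W : Submodule ℂ E} {e : ℕ+ → ℝ} {v : ℕ+ → E} {f : ℕ → ℕ+ → ℝ} {w : ℕ → ℕ+ → E}
    (hA : IsPosEigendecomposition A W e v) (hB : ∀ n, IsPosEigendecomposition (B n) ⊤ (f n) (w n))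
    (hJ : ∀ x ∈ W, ∀ y ∈ W, ⟪x, J y⟫_ℂ = 0)
    (hAc : IsCompactOperator A) (hBc : ∀ n, IsCompactOperator (B n))
    (hBA : Tendsto B atTop (𝓝 A)) {c : ℝ} (hn : ∀ n, ‖B n‖ ≤ c) :
    (∀ M : ℕ+, e (M + 1) ≠ e M →
      (∃ N : ℕ, ∀ n : ℕ, N < n →
        Module.finrank ℂ (LinearMap.range
          (diffCompr J (w n) M (B n) : E →ₗ[ℂ] E)) = 2 * (M : ℕ) ∧
        spectrum ℂ (diffCompr J (w n) M (B n)) ⊆ Complex.ofReal '' Set.Icc (-c) c) ∧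
      Tendsto (fun n => diffCompr J (w n) M (B n)) atTop (𝓝 (diffCompr J v M A)) ∧
      SpectrallyConverges atTop (fun n => diffCompr J (w n) M (B n)) (diffCompr J v M A)) ∧
    Tendsto (fun M => diffCompr J v M A) atTop (𝓝 (A - conjOp J A)) ∧
    SpectrallyConverges atTop (fun M => diffCompr J v M A) (A - conjOp J A) := by
  have hcomp : ∀ {S : E →L[ℂ] E} (a : ℕ+ → E) (M : ℕ), IsCompactOperator S →
      IsCompactOperator (diffCompr J a M S) := fun a M hS => by
    rw [diffCompr_eq]
    exact isCompactOperator_sub_conjOp (isCompactOperator_headCompr a M hS)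
  have hsymm : ∀ {S : E →L[ℂ] E} (a : ℕ+ → E) (M : ℕ), 0 ≤ S →
      (diffCompr J a M S : E →ₗ[ℂ] E).IsSymmetric := fun a M hS => by
    rw [diffCompr_eq]
    exact isSymmetric_sub_conjOp (headCompr_nonneg a M hS)
  refine ⟨fun M hM => ?_, ?_⟩
  · have hT : Tendsto (fun n => diffCompr J (w n) M (B n)) atTop (𝓝 (diffCompr J v M A)) := by
      rw [diffCompr_eq]
      exact tendsto_diffCompr_of_tendsto (M := fun _ => (M : ℕ))
        (tendsto_headCompr hBA (IsPosEigendecomposition.tendsto_headProj hB hA hBA hM))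
    -- The gap at `M` also forces positivity: `e j ≥ e M > e (M + 1) ≥ 0`.
    have hpos : ∀ j : ℕ+, (j : ℕ) ≤ M → 0 < e j := fun j hj => by
      have h1 := hA.eigenvalue_nonneg (M + 1)
      have h2 : e (M + 1) < e M := lt_of_le_of_ne (hA.antitone (PNat.lt_add_right M 1).le) hM
      exact (h1.trans_lt h2).trans_le (hA.antitone hj)
    refine ⟨?_, hT, spectrallyConverges_of_tendsto hE (fun n => hcomp _ _ (hBc n))
      (fun n => hsymm _ _ (hB n).nonneg) (hcomp _ _ hAc) (hsymm _ _ hA.nonneg) hT⟩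
    obtain ⟨N, hN⟩ := eventually_atTop.1 (eventually_finrank_range_diffCompr hA hJ hpos hT)
    exact ⟨N, fun n hNn => ⟨hN n hNn.le, spectrum_diffCompr_subset _ _ (hB n).nonneg (hn n)⟩⟩
  · have hT : Tendsto (fun M => diffCompr J v M A) atTop (𝓝 (A - conjOp J A)) :=
      tendsto_diffCompr_of_tendsto (w := fun _ => v) (M := id) (A := fun _ => A)
        (hA.tendsto_headCompr hAc)
    exact ⟨hT, spectrallyConverges_of_tendsto hE (fun n => hcomp _ _ hAc)
      (fun n => hsymm _ _ hA.nonneg) (isCompactOperator_sub_conjOp hAc)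
      (isSymmetric_sub_conjOp hA.nonneg) hT⟩

end Compression

/-! ### Frequency cutoffs as polynomials in the sine of the generator -/

section UnitaryGroup

variable {E : Type*} [NormedAddCommGroup E] [InnerProductSpace ℂ E]

/-- A one-parameter group of unitary operators (without any continuity assumption). -/
structure IsUnitaryGroup (U : ℝ → E →L[ℂ] E) : Prop where
  zero : U 0 = 1
  add : ∀ s t, U (s + t) = U s * U t
  inner : ∀ t f g, ⟪U t f, U t g⟫_ℂ = ⟪f, g⟫_ℂ

variable {U : ℝ → E →L[ℂ] E}

theorem IsUnitaryGroup.apply_neg_apply (hU : IsUnitaryGroup U) (t : ℝ) (f : E) :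
    U t (U (-t) f) = f := by
  have := congrArg (fun T : E →L[ℂ] E => T f) (hU.add t (-t))
  simpa [hU.zero] using this.symm

theorem IsUnitaryGroup.inner_left (hU : IsUnitaryGroup U) (t : ℝ) (f g : E) :
    ⟪U t f, g⟫_ℂ = ⟪f, U (-t) g⟫_ℂ := by
  rw [← hU.inner t f, hU.apply_neg_apply]

/-- The sine `(U^a - U^{-a}) / (2 i)` of the generator of a unitary group. -/
def groupSin (U : ℝ → E →L[ℂ] E) (a : ℝ) : E →L[ℂ] E := (2 * Complex.I)⁻¹ • (U a - U (-a))

theorem integrable_exp_mul_sin_pow (ν : Measure ℝ) [IsFiniteMeasure ν] (a t : ℝ) (k : ℕ) :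
    Integrable (fun ω : ℝ => Complex.exp (Complex.I * ω * t) * (Real.sin (a * ω) : ℂ) ^ k) ν := by
  refine Integrable.of_bound (C := 1) (by fun_prop) (Eventually.of_forall fun ω => ?_)
  have h1 : Complex.I * (ω : ℂ) * (t : ℂ) = ((ω * t : ℝ) : ℂ) * Complex.I := by push_cast; ring
  rw [norm_mul, norm_pow, h1, Complex.norm_exp_ofReal_mul_I, one_mul, Complex.norm_real]
  exact pow_le_one₀ (norm_nonneg _) (Real.abs_sin_le_one _)

/-- The bounded operator `groupSin U a` corresponds to multiplication by `sin (a ω)` in frequency.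
This replaces the spectral theorem: polynomials in it can be tested against spectral measures alone.
The time `t` stays free because each power shifts it by `±a`. -/
theorem inner_groupSin_pow (hU : IsUnitaryGroup U) {f : E} {ν : Measure ℝ}
    (hν : IsVectorSpectralMeasure U f ν) (a : ℝ) (k : ℕ) (t : ℝ) :
    ⟪f, U t ((groupSin U a ^ k) f)⟫_ℂ =
      ∫ ω : ℝ, Complex.exp (Complex.I * ω * t) * (Real.sin (a * ω) : ℂ) ^ k ∂ν := by
  haveI := hν.1
  induction k generalizing t with
  | zero => simpa using hν.2 t
  | succ k ih =>
    have h1 : U t ((groupSin U a ^ (k + 1)) f) = (2 * Complex.I)⁻¹ •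
        (U (t + a) ((groupSin U a ^ k) f) - U (t + -a) ((groupSin U a ^ k) f)) := by
      rw [pow_succ', hU.add, hU.add]
      simp [groupSin]
    rw [h1, inner_smul_right, inner_sub_right, ih, ih,
      ← integral_sub (integrable_exp_mul_sin_pow ν a _ k) (integrable_exp_mul_sin_pow ν a _ k),
      ← integral_const_mul]
    refine integral_congr_ae (Eventually.of_forall fun ω => ?_)
    have h2 : Complex.exp (Complex.I * ω * ((t + a : ℝ) : ℂ)) =
        Complex.exp (Complex.I * ω * t) * Complex.exp (((a * ω : ℝ) : ℂ) * Complex.I) := by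
      rw [← Complex.exp_add]; congr 1; push_cast; ring
    have h3 : Complex.exp (Complex.I * ω * ((t + -a : ℝ) : ℂ)) =
        Complex.exp (Complex.I * ω * t) * Complex.exp (-((a * ω : ℝ) : ℂ) * Complex.I) := by
      rw [← Complex.exp_add]; congr 1; push_cast; ring
    simp only [h2, h3]
    rw [pow_succ, Complex.ofReal_sin, Complex.sin, mul_inv, Complex.inv_I]
    ring

theorem inner_aeval_groupSin (hU : IsUnitaryGroup U) {f : E} {ν : Measure ℝ}
    (hν : IsVectorSpectralMeasure U f ν) (a : ℝ) (p : Polynomial ℝ) :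
    ⟪f, Polynomial.aeval (groupSin U a) p f⟫_ℂ = ((∫ ω : ℝ, p.eval (Real.sin (a * ω)) ∂ν : ℝ) : ℂ) := by
  haveI := hν.1
  have hint : ∀ q : Polynomial ℝ, Integrable (fun ω : ℝ => q.eval (Real.sin (a * ω))) ν := by
    intro q
    obtain ⟨C, hC⟩ := (isCompact_Icc (a := (-1 : ℝ)) (b := 1)).exists_bound_of_continuousOn
      (f := fun y => q.eval y) q.continuous.continuousOn
    refine Integrable.of_bound (C := C) ?_ (Eventually.of_forall fun ω => ?_)
    · exact (q.continuous.comp (by fun_prop)).aestronglyMeasurable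
    · exact hC _ ⟨Real.neg_one_le_sin _, Real.sin_le_one _⟩
  induction p using Polynomial.induction_on' with
  | add p q hp hq =>
    simp only [map_add, Polynomial.eval_add, add_apply, inner_add_right, hp, hq]
    rw [integral_add (hint p) (hint q)]
    push_cast; rfl
  | monomial k c =>
    have h0 := inner_groupSin_pow hU hν a k 0
    simp only [hU.zero, one_apply_eq_self, Complex.ofReal_zero, mul_zero, Complex.exp_zero,
      one_mul] at h0
    simp only [Polynomial.aeval_monomial, ← Algebra.smul_def, smul_apply, Polynomial.eval_monomial]
    rw [integral_const_mul, ← Complex.coe_smul, inner_smul_right, h0]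
    push_cast
    congr 1
    rw [← integral_complex_ofReal]
    simp

variable [CompleteSpace E]

theorem isSelfAdjoint_groupSin (hU : IsUnitaryGroup U) (a : ℝ) : IsSelfAdjoint (groupSin U a) := by
  rw [ContinuousLinearMap.isSelfAdjoint_iff_isSymmetric]
  intro x y
  change ⟪(2 * Complex.I)⁻¹ • (U a x - U (-a) x), y⟫_ℂ = ⟪x, (2 * Complex.I)⁻¹ • (U a y - U (-a) y)⟫_ℂ
  rw [inner_smul_left, inner_smul_right, inner_sub_left, inner_sub_right, hU.inner_left,
    hU.inner_left, neg_neg]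
  have : (starRingEnd ℂ) (2 * Complex.I)⁻¹ = -(2 * Complex.I)⁻¹ := by
    rw [map_inv₀, map_mul, Complex.conj_I, Complex.conj_ofNat, mul_neg, inv_neg]
  rw [this]; ring

theorem isSelfAdjoint_aeval {A : E →L[ℂ] E} (hA : IsSelfAdjoint A) (p : Polynomial ℝ) :
    IsSelfAdjoint (Polynomial.aeval A p) := by
  rw [← cfc_polynomial p A hA]
  exact cfc_predicate _ _

theorem norm_sq_aeval_groupSin (hU : IsUnitaryGroup U) {f : E} {ν : Measure ℝ}
    (hν : IsVectorSpectralMeasure U f ν) (a : ℝ) (p : Polynomial ℝ) :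
    ‖Polynomial.aeval (groupSin U a) p f‖ ^ 2 = ∫ ω : ℝ, (p.eval (Real.sin (a * ω))) ^ 2 ∂ν := by
  have hsa := isSelfAdjoint_aeval (isSelfAdjoint_groupSin hU a) p
  have hs := ContinuousLinearMap.isSelfAdjoint_iff_isSymmetric.1 hsa
  have h1 := inner_aeval_groupSin hU hν a (p * p)
  rw [map_mul] at h1
  have h2 : ⟪f, (Polynomial.aeval (groupSin U a) p * Polynomial.aeval (groupSin U a) p) f⟫_ℂ =
      ⟪Polynomial.aeval (groupSin U a) p f, Polynomial.aeval (groupSin U a) p f⟫_ℂ :=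
    (hs f _).symm
  rw [h2, inner_self_eq_norm_sq_to_K] at h1
  have h3 : ‖Polynomial.aeval (groupSin U a) p f‖ ^ 2 =
      ∫ ω : ℝ, (p * p).eval (Real.sin (a * ω)) ∂ν :=
    Complex.ofReal_injective (by rw [Complex.ofReal_pow]; exact h1)
  simp only [h3, Polynomial.eval_mul, sq]

/-- A continuous cutoff that increases to the indicator of `(0, ∞)`. -/
def rampCutoff (n : ℕ) (y : ℝ) : ℝ := max 0 (min 1 ((n + 1 : ℝ) ^ 2 * y))

theorem exists_polynomial_near_rampCutoff (n : ℕ) : ∃ p : Polynomial ℝ,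
    ∀ y ∈ Set.Icc (-1 : ℝ) 1, |p.eval y - rampCutoff n y| < 1 / (n + 1 : ℝ) :=
  exists_polynomial_near_of_continuousOn _ _ _ (by unfold rampCutoff; fun_prop) _ (by positivity)

/-- By Jordan's inequality `sin (ω/(n+1)) ≥ 2ω/(π(n+1))` for large `n`; the slope `(n+1)²` outgrows
this decay and the ramp saturates. -/
theorem rampCutoff_sin_of_pos {ω : ℝ} (hω : 0 < ω) :
    ∀ᶠ n : ℕ in atTop, rampCutoff n (Real.sin (1 / (n + 1 : ℝ) * ω)) = 1 := by
  obtain ⟨N, hN⟩ := exists_nat_gt (max ω (Real.pi / (2 * ω)))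
  filter_upwards [eventually_ge_atTop N] with n hn
  have hn1 : (N : ℝ) ≤ n := by exact_mod_cast hn
  have hnp : (0 : ℝ) < n + 1 := by positivity
  have h1 : ω < n + 1 := by have := (le_max_left _ _).trans_lt hN; linarith
  have h2 : Real.pi / (2 * ω) < n + 1 := by have := (le_max_right _ _).trans_lt hN; linarith
  have h3 : 1 / (n + 1 : ℝ) * ω ≤ 1 := by
    rw [one_div_mul_eq_div, div_le_one hnp]; exact h1.le
  have h4 := Real.mul_le_sin (x := 1 / (n + 1 : ℝ) * ω) (by positivity)
    (h3.trans (by linarith [Real.pi_gt_three]))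
  have h5 : 1 ≤ (n + 1 : ℝ) ^ 2 * Real.sin (1 / (n + 1 : ℝ) * ω) := by
    have h6 : (n + 1 : ℝ) ^ 2 * (2 / Real.pi * (1 / (n + 1 : ℝ) * ω)) =
        (n + 1 : ℝ) * (2 * ω) / Real.pi := by field_simp
    have h7 : 1 ≤ (n + 1 : ℝ) * (2 * ω) / Real.pi := by
      rw [le_div_iff₀ Real.pi_pos, one_mul]
      rw [div_lt_iff₀ (by positivity)] at h2
      exact h2.le
    rw [← h6] at h7
    exact h7.trans (mul_le_mul_of_nonneg_left h4 (by positivity))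
  rw [rampCutoff, min_eq_left h5, max_eq_right zero_le_one]

theorem rampCutoff_sin_of_nonpos {ω : ℝ} (hω : ω ≤ 0) :
    ∀ᶠ n : ℕ in atTop, rampCutoff n (Real.sin (1 / (n + 1 : ℝ) * ω)) = 0 := by
  obtain ⟨N, hN⟩ := exists_nat_gt (-ω)
  filter_upwards [eventually_ge_atTop N] with n hn
  have hn1 : (N : ℝ) ≤ n := by exact_mod_cast hn
  have hnp : (0 : ℝ) < n + 1 := by positivity
  have h1 : Real.sin (1 / (n + 1 : ℝ) * ω) ≤ 0 := by
    refine Real.sin_nonpos_of_nonpos_of_neg_pi_le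
      (mul_nonpos_of_nonneg_of_nonpos (by positivity) hω) ?_
    have : -1 ≤ 1 / (n + 1 : ℝ) * ω := by
      rw [one_div_mul_eq_div, le_div_iff₀ hnp]; linarith
    linarith [Real.pi_gt_three]
  have h2 : (n + 1 : ℝ) ^ 2 * Real.sin (1 / (n + 1 : ℝ) * ω) ≤ 0 :=
    mul_nonpos_of_nonneg_of_nonpos (by positivity) h1
  rw [rampCutoff, min_eq_right (h2.trans zero_le_one), max_eq_left h2]

theorem tendsto_integral_sq_of_eventually {ν : Measure ℝ} [IsFiniteMeasure ν] {p : ℕ → Polynomial ℝ}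
    (hp : ∀ n, ∀ y ∈ Set.Icc (-1 : ℝ) 1, |(p n).eval y - rampCutoff n y| < 1 / (n + 1 : ℝ))
    {c : ℝ} (hc : |c| ≤ 1)
    (h : ∀ᵐ ω ∂ν, ∀ᶠ n : ℕ in atTop, rampCutoff n (Real.sin (1 / (n + 1 : ℝ) * ω)) = c) :
    Tendsto (fun n : ℕ => ∫ ω : ℝ, ((p n - Polynomial.C c).eval
      (Real.sin (1 / (n + 1 : ℝ) * ω))) ^ 2 ∂ν) atTop (𝓝 0) := by
  have hsin : ∀ x, Real.sin x ∈ Set.Icc (-1 : ℝ) 1 := fun x =>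
    ⟨Real.neg_one_le_sin _, Real.sin_le_one _⟩
  have h0 : (0 : ℝ) = ∫ _ω : ℝ, (0 : ℝ) ∂ν := by simp
  rw [h0]
  -- The polynomial is at most 2 in absolute value (ramp at most 1, error at most 1) and `|c| ≤ 1`,
  -- so the square is at most `3² = 9`.
  refine tendsto_integral_of_dominated_convergence (fun _ => (9 : ℝ)) (fun n => ?_)
    (integrable_const _) (fun n => Eventually.of_forall fun ω => ?_) ?_
  · exact (((p n - Polynomial.C c).continuous.comp (by fun_prop)).pow 2).aestronglyMeasurable
  · have h1 := hp n _ (hsin (1 / (n + 1 : ℝ) * ω))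
    have h2 : 1 / (n + 1 : ℝ) ≤ 1 := by
      rw [div_le_one (by positivity)]; linarith [(Nat.cast_nonneg n : (0 : ℝ) ≤ n)]
    have h3 : |rampCutoff n (Real.sin (1 / (n + 1 : ℝ) * ω))| ≤ 1 := by
      rw [rampCutoff, abs_of_nonneg (le_max_left _ _)]
      exact max_le zero_le_one (min_le_left _ _)
    rw [Real.norm_eq_abs, abs_pow, Polynomial.eval_sub, Polynomial.eval_C]
    have h4 : |(p n).eval (Real.sin (1 / (n + 1 : ℝ) * ω)) - c| ≤ 3 := by
      rw [abs_lt] at h1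
      rw [abs_le] at h3 hc ⊢
      constructor <;> linarith [h1.1, h1.2, h3.1, h3.2, hc.1, hc.2]
    calc |(p n).eval (Real.sin (1 / (n + 1 : ℝ) * ω)) - c| ^ 2 ≤ 3 ^ 2 := by gcongr
      _ = 9 := by norm_num
  · filter_upwards [h] with ω hω
    have h1 : Tendsto (fun n : ℕ => (p n).eval (Real.sin (1 / (n + 1 : ℝ) * ω)) - c) atTop (𝓝 0) := by
      refine squeeze_zero_norm' ?_ tendsto_one_div_add_atTop_nhds_zero_nat
      filter_upwards [hω] with n hn
      have := hp n _ (hsin (1 / (n + 1 : ℝ) * ω))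
      rw [hn] at this
      exact this.le
    have h2 := h1.pow 2
    simpa using h2

/-- Polynomials in the sine of the generator, approximating the ramps, send `f` to `f` and `g` to 0
in the limit. They are self-adjoint, so they move across the inner product. Frequency 0 is allowed
for `g`, which covers the invariant functions. -/
theorem inner_eq_zero_of_spectralMeasures (hU : IsUnitaryGroup U) {f g : E} {ν ν' : Measure ℝ}
    (hf : IsVectorSpectralMeasure U f ν) (hg : IsVectorSpectralMeasure U g ν')
    (hν : ν (Set.Ioi 0)ᶜ = 0) (hν' : ν' (Set.Iic 0)ᶜ = 0) : ⟪f, g⟫_ℂ = 0 := by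
  haveI := hf.1
  haveI := hg.1
  choose p hp using exists_polynomial_near_rampCutoff
  have h1 : ∀ᵐ ω ∂ν, ∀ᶠ n : ℕ in atTop, rampCutoff n (Real.sin (1 / (n + 1 : ℝ) * ω)) = 1 := by
    filter_upwards [measure_eq_zero_iff_ae_notMem.1 hν] with ω hω
    exact rampCutoff_sin_of_pos (by simpa using hω)
  have h2 : ∀ᵐ ω ∂ν', ∀ᶠ n : ℕ in atTop, rampCutoff n (Real.sin (1 / (n + 1 : ℝ) * ω)) = 0 := by
    filter_upwards [measure_eq_zero_iff_ae_notMem.1 hν'] with ω hω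
    exact rampCutoff_sin_of_nonpos (by simpa using hω)
  have key : ∀ {h : E} {ρ : Measure ℝ}, IsVectorSpectralMeasure U h ρ → ∀ {c : ℝ}, |c| ≤ 1 →
      (∀ᵐ ω ∂ρ, ∀ᶠ n : ℕ in atTop, rampCutoff n (Real.sin (1 / (n + 1 : ℝ) * ω)) = c) →
      Tendsto (fun n : ℕ => Polynomial.aeval (groupSin U (1 / (n + 1 : ℝ))) (p n) h) atTop
        (𝓝 ((c : ℂ) • h)) := by
    intro h ρ hρ c hc hae
    haveI := hρ.1
    have h3 := tendsto_integral_sq_of_eventually hp hc hae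
    simp only [← norm_sq_aeval_groupSin hU hρ] at h3
    have h4 := h3.sqrt
    simp only [Real.sqrt_sq (norm_nonneg _), Real.sqrt_zero] at h4
    rw [tendsto_iff_norm_sub_tendsto_zero]
    refine h4.congr fun n => ?_
    rw [map_sub, Polynomial.aeval_C, Algebra.algebraMap_eq_smul_one]
    simp
  have hF := key hf (c := 1) (by simp) h1
  have hG := key hg (c := 0) (by simp) h2
  simp only [Complex.ofReal_one, one_smul, Complex.ofReal_zero, zero_smul] at hF hG
  have h5 := hF.inner (𝕜 := ℂ) (tendsto_const_nhds (x := g))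
  have h6 := (tendsto_const_nhds (x := f)).inner (𝕜 := ℂ) hG
  rw [inner_zero_right] at h6
  refine tendsto_nhds_unique h5 (h6.congr fun n => ?_)
  have hs := ContinuousLinearMap.isSelfAdjoint_iff_isSymmetric.1
    (isSelfAdjoint_aeval (isSelfAdjoint_groupSin hU (1 / (n + 1 : ℝ))) (p n))
  exact (hs f g).symm

end UnitaryGroup

/-! ### Spectral subspaces: invariance, conjugation, orthogonality -/

section SpectralSubspace

variable {E : Type*} [NormedAddCommGroup E] [InnerProductSpace ℂ E] [CompleteSpace E]
  {U : ℝ → E →L[ℂ] E}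

instance (Θ : Set ℝ) : CompleteSpace (spectralSubspace U Θ) :=
  (Submodule.isClosed_topologicalClosure _).completeSpace_coe

theorem spectralSubspace_le {Θ : Set ℝ} {W : Submodule ℂ E} (hW : IsClosed (W : Set E))
    (h : ∀ f ν, IsVectorSpectralMeasure U f ν → ν Θᶜ = 0 → f ∈ W) : spectralSubspace U Θ ≤ W := by
  refine Submodule.topologicalClosure_minimal _ (Submodule.span_le.2 ?_) hW
  rintro f ⟨ν, hν, h0⟩
  exact h f ν hν h0

theorem mem_spectralSubspace {Θ : Set ℝ} {f : E} {ν : Measure ℝ}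
    (hν : IsVectorSpectralMeasure U f ν) (h0 : ν Θᶜ = 0) : f ∈ spectralSubspace U Θ :=
  Submodule.le_topologicalClosure _ (Submodule.subset_span ⟨ν, hν, h0⟩)

theorem IsVectorSpectralMeasure.apply (hU : IsUnitaryGroup U) {f : E} {ν : Measure ℝ}
    (hν : IsVectorSpectralMeasure U f ν) (s : ℝ) : IsVectorSpectralMeasure U (U s f) ν := by
  refine ⟨hν.1, fun t => ?_⟩
  have h1 : U t (U s f) = U s (U t f) := by
    have h2 := hU.add t s
    rw [add_comm, hU.add] at h2
    exact congrArg (fun T : E →L[ℂ] E => T f) h2.symm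
  rw [h1, hU.inner, hν.2]

theorem apply_mem_spectralSubspace (hU : IsUnitaryGroup U) {Θ : Set ℝ} (s : ℝ) {f : E}
    (hf : f ∈ spectralSubspace U Θ) : U s f ∈ spectralSubspace U Θ := by
  have : spectralSubspace U Θ ≤ (spectralSubspace U Θ).comap (U s : E →ₗ[ℂ] E) :=
    spectralSubspace_le ((Submodule.isClosed_topologicalClosure _).preimage (U s).continuous)
      fun f ν hν h0 => mem_spectralSubspace (hν.apply hU s) h0
  exact this hf

theorem starProjection_commute_group (hU : IsUnitaryGroup U) {W : Submodule ℂ E}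
    [W.HasOrthogonalProjection] (hW : ∀ s, ∀ x ∈ W, U s x ∈ W) (s : ℝ) (x : E) :
    W.starProjection (U s x) = U s (W.starProjection x) := by
  refine starProjection_commute_of_mapsTo (hW s) (fun x hx => ?_) x
  rw [Submodule.mem_orthogonal] at hx ⊢
  intro u hu
  have h := hU.inner_left (-s) u x
  rw [neg_neg] at h
  rw [← h]
  exact hx _ (hW (-s) u hu)

variable (J : E ≃ₗᵢ⋆[ℂ] E)

/-- An antiunitary commuting with the group conjugates the correlation function, which reflects
frequencies. -/
theorem IsVectorSpectralMeasure.conjugation {f : E} {ν : Measure ℝ}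
    (hJ : ∀ t f, U t (J f) = J (U t f)) (hν : IsVectorSpectralMeasure U f ν) :
    IsVectorSpectralMeasure U (J f) (ν.map Neg.neg) := by
  haveI := hν.1
  refine ⟨inferInstance, fun t => ?_⟩
  rw [hJ, inner_map_map_conjugation, ← inner_conj_symm, hν.2, ← integral_conj,
    integral_map measurable_neg.aemeasurable (by fun_prop)]
  refine integral_congr_ae (Eventually.of_forall fun ω => ?_)
  simp [← Complex.exp_conj]

theorem conjugation_mem_spectralSubspace (hJ : ∀ t f, U t (J f) = J (U t f)) {Θ : Set ℝ} {f : E}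
    (hf : f ∈ spectralSubspace U Θ) : J f ∈ spectralSubspace U (Neg.neg ⁻¹' Θ) := by
  have : spectralSubspace U Θ ≤
      (spectralSubspace U (Neg.neg ⁻¹' Θ)).comap (J : E ≃ₛₗ[starRingEnd ℂ] E).toLinearMap := by
    refine spectralSubspace_le ((Submodule.isClosed_topologicalClosure _).preimage J.continuous)
      fun f ν hν h0 => ?_
    refine mem_spectralSubspace (hν.conjugation J hJ) ?_
    rw [← Set.preimage_compl]
    have := (MeasurableEquiv.neg ℝ).map_apply (μ := ν) (Neg.neg ⁻¹' Θᶜ)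
    change (ν.map Neg.neg) _ = ν (Neg.neg ⁻¹' (Neg.neg ⁻¹' Θᶜ)) at this
    rw [this, ← Set.preimage_comp]
    simpa [Function.comp_def] using h0
  exact this hf

theorem inner_spectralSubspace_eq_zero (hU : IsUnitaryGroup U) {x y : E}
    (hx : x ∈ spectralSubspace U (Set.Ioi 0)) (hy : y ∈ spectralSubspace U (Set.Iio 0)) :
    ⟪x, y⟫_ℂ = 0 := by
  have h1 : spectralSubspace U (Set.Iio 0) ≤ (spectralSubspace U (Set.Ioi 0))ᗮ := by
    refine spectralSubspace_le (Submodule.isClosed_orthogonal _) fun g ν' hg hν' => ?_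
    have h2 : spectralSubspace U (Set.Ioi 0) ≤ (Submodule.span ℂ {g})ᗮ := by
      refine spectralSubspace_le (Submodule.isClosed_orthogonal _) fun f ν hf hν => ?_
      rw [Submodule.mem_orthogonal_singleton_iff_inner_left]
      exact inner_eq_zero_of_spectralMeasures hU hf hg hν
        (measure_mono_null (Set.compl_subset_compl.2 Set.Iio_subset_Iic_self) hν')
    rw [Submodule.mem_orthogonal]
    exact fun u hu => Submodule.mem_orthogonal_singleton_iff_inner_left.1 (h2 hu)
  exact (Submodule.mem_orthogonal _ _).1 (h1 hy) x hx

/-- The spectral measure of a fixed vector is a point mass `‖g‖²` at frequency 0. -/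
theorem inner_fixed_spectralSubspace_eq_zero (hU : IsUnitaryGroup U) {x g : E}
    (hg : ∀ t, U t g = g) (hx : x ∈ spectralSubspace U (Set.Ioi 0)) : ⟪g, x⟫_ℂ = 0 := by
  have hν : IsVectorSpectralMeasure U g (ENNReal.ofReal (‖g‖ ^ 2) • Measure.dirac 0) := by
    refine ⟨⟨by simp⟩, fun t => ?_⟩
    rw [hg, inner_self_eq_norm_sq_to_K, integral_smul_measure, integral_dirac,
      ENNReal.toReal_ofReal (by positivity)]
    simp
  have h2 : spectralSubspace U (Set.Ioi 0) ≤ (Submodule.span ℂ {g})ᗮ := by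
    refine spectralSubspace_le (Submodule.isClosed_orthogonal _) fun f ν hf hν' => ?_
    rw [Submodule.mem_orthogonal_singleton_iff_inner_left]
    refine inner_eq_zero_of_spectralMeasures hU hf hν hν' ?_
    simp
  exact Submodule.mem_orthogonal_singleton_iff_inner_right.1 (h2 hx)

end SpectralSubspace

/-! ### Vectors annihilated by an operator are annihilated by its sandwich -/

section SandwichKernel

variable {E : Type*} [NormedAddCommGroup E] [InnerProductSpace ℂ E] [CompleteSpace E]

theorem opSqrt_apply_eq_zero {A : E →L[ℂ] E} (hA : 0 ≤ A) {x : E} (hx : A x = 0) :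
    opSqrt A x = 0 := by
  have hs := ContinuousLinearMap.isSelfAdjoint_iff_isSymmetric.1 (opSqrt_nonneg A).isSelfAdjoint
  have h1 : ⟪opSqrt A x, opSqrt A x⟫_ℂ = ⟪x, (opSqrt A * opSqrt A) x⟫_ℂ := hs x _
  rw [opSqrt_mul_self hA, hx, inner_zero_right] at h1
  exact inner_self_eq_zero.1 h1

theorem sandwich_opAbs_apply_eq_zero {A : E →L[ℂ] E} (G : E →L[ℂ] E) {x : E} (hx : A x = 0) :
    sandwich (opAbs A) G x = 0 := by
  have h1 : opAbs A x = 0 := by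
    rw [opAbs_eq_opSqrt]
    refine opSqrt_apply_eq_zero (star_mul_self_nonneg A) ?_
    change star A (A x) = 0
    rw [hx, map_zero]
  have h2 : opSqrt (opAbs A) x = 0 := opSqrt_apply_eq_zero (opAbs_nonneg A) h1
  rw [sandwich_eq]
  change opSqrt (opAbs A) (G (opSqrt (opAbs A) x)) = 0
  rw [h2, map_zero, map_zero]

end SandwichKernel

/-! ### The Koopman group and complex conjugation on `L²(μ)` -/

namespace ErgodicFlow

variable {𝓜 : Type*} [MetricSpace 𝓜] [MeasurableSpace 𝓜] [BorelSpace 𝓜] (D : ErgodicFlow 𝓜)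

theorem coeFn_koopman (t : ℝ) (f : D.H) : D.koopman t f =ᵐ[D.μ] fun x => f (D.flow t x) :=
  Lp.coeFn_compMeasurePreserving f (D.invariant t)

theorem isUnitaryGroup_koopman : IsUnitaryGroup D.koopman where
  zero := by
    ext1 f
    apply Lp.ext
    filter_upwards [D.coeFn_koopman 0 f] with x hx
    rw [hx, D.flow.map_zero_apply]
    rfl
  add s t := by
    ext1 f
    apply Lp.ext
    have h1 := (D.invariant s).quasiMeasurePreserving.ae_eq_comp (D.coeFn_koopman t f)
    filter_upwards [D.coeFn_koopman (s + t) f, D.coeFn_koopman s (D.koopman t f), h1]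
      with x hx hx' hx''
    change _ = (D.koopman s (D.koopman t f) : D.H) x
    rw [hx, hx']
    rw [Function.comp_apply] at hx''
    rw [hx'', Function.comp_apply, add_comm, D.flow.map_add]
  inner t f g := (Lp.compMeasurePreservingₗᵢ ℂ (D.flow t) (D.invariant t)).inner_map_map f g

theorem coeFn_one : (D.one : 𝓜 → ℂ) =ᵐ[D.μ] fun _ => 1 :=
  Lp.coeFn_const (p := 2) (μ := D.μ) (1 : ℂ)

theorem koopman_one (t : ℝ) : D.koopman t D.one = D.one := by
  apply Lp.ext
  have h1 := (D.invariant t).quasiMeasurePreserving.ae_eq_comp D.coeFn_one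
  filter_upwards [D.coeFn_koopman t D.one, D.coeFn_one, h1] with x hx hx' hx''
  rw [Function.comp_apply] at hx''
  rw [hx, hx', hx'', Function.comp_apply]

theorem star_add_H (f g : D.H) : star (f + g) = star f + star g := by
  apply Lp.ext
  filter_upwards [Lp.coeFn_star (f + g), Lp.coeFn_star f, Lp.coeFn_star g, Lp.coeFn_add f g,
    Lp.coeFn_add (star f) (star g)] with x h1 h2 h3 h4 h5
  rw [h1, h5]
  simp only [Pi.star_apply, Pi.add_apply] at *
  rw [h4, h2, h3, star_add]

theorem star_smul_H (c : ℂ) (f : D.H) : star (c • f) = (starRingEnd ℂ) c • star f := by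
  apply Lp.ext
  filter_upwards [Lp.coeFn_star (c • f), Lp.coeFn_star f, Lp.coeFn_smul c f,
    Lp.coeFn_smul ((starRingEnd ℂ) c) (star f)] with x h1 h2 h3 h4
  rw [h1, h4]
  simp only [Pi.star_apply, Pi.smul_apply] at *
  rw [h2, h3, star_smul]
  rfl

theorem norm_star_H (f : D.H) : ‖star f‖ = ‖f‖ := by
  rw [Lp.norm_def, Lp.norm_def]
  congr 1
  refine eLpNorm_congr_norm_ae ?_
  filter_upwards [Lp.coeFn_star f] with x hx
  rw [hx, Pi.star_apply, norm_star]

/-- Complex conjugation on `L²(μ)` as an antiunitary operator. -/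
def conjH : D.H ≃ₗᵢ⋆[ℂ] D.H where
  toFun := star
  invFun := star
  map_add' := D.star_add_H
  map_smul' := D.star_smul_H
  left_inv := star_star
  right_inv := star_star
  norm_map' := D.norm_star_H

/-- Complex conjugation on the zero-mean functions as an antiunitary operator. -/
def conjHtilde : D.Htilde ≃ₗᵢ⋆[ℂ] D.Htilde where
  toFun := D.conj
  invFun := D.conj
  map_add' f g := Subtype.ext (D.star_add_H f g)
  map_smul' c f := Subtype.ext (D.star_smul_H c f)
  left_inv f := Subtype.ext (star_star (f : D.H))
  right_inv f := Subtype.ext (star_star (f : D.H))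
  norm_map' f := D.norm_star_H f

theorem conjH_apply (f : D.H) : D.conjH f = star f := rfl

theorem conjH_symm : D.conjH.symm = D.conjH := rfl

theorem koopman_conjH (t : ℝ) (f : D.H) : D.koopman t (D.conjH f) = D.conjH (D.koopman t f) := by
  apply Lp.ext
  have h1 := (D.invariant t).quasiMeasurePreserving.ae_eq_comp (Lp.coeFn_star f)
  filter_upwards [D.coeFn_koopman t (D.conjH f), D.coeFn_koopman t f,
    Lp.coeFn_star (D.koopman t f), h1] with x h2 h3 h4 h5
  rw [h2, conjH_apply, conjH_apply, h4, Pi.star_apply, h3]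
  exact h5

theorem conjH_one : D.conjH D.one = D.one := by
  apply Lp.ext
  filter_upwards [Lp.coeFn_star D.one, D.coeFn_one] with x h1 h2
  rw [conjH_apply, h1, Pi.star_apply, h2, star_one]

theorem mem_Htilde {f : D.H} : f ∈ D.Htilde ↔ ⟪D.one, f⟫_ℂ = 0 :=
  Submodule.mem_orthogonal_singleton_iff_inner_right

/-! ### The resolvent of the generator: symmetries and norm bound -/

section Resolvent

theorem mem_generator_domain {f : D.H} :
    f ∈ D.generator.domain ↔ DifferentiableAt ℝ (fun t : ℝ => D.koopman t f) 0 := Iff.rfl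

theorem hasDerivAt_koopman (f : D.generator.domain) :
    HasDerivAt (fun t : ℝ => D.koopman t (f : D.H)) (D.generator f) 0 :=
  (D.mem_generator_domain.1 f.2).hasDerivAt

/-- Only real linearity of `T` is asked, so that orthogonal projections and complex conjugation are
treated together. -/
theorem generator_commute {T : D.H →L[ℝ] D.H} (hT : ∀ t f, T (D.koopman t f) = D.koopman t (T f))
    (f : D.generator.domain) :
    ∃ h : T f ∈ D.generator.domain, D.generator ⟨T f, h⟩ = T (D.generator f) := by
  have h1 : HasDerivAt (fun t : ℝ => D.koopman t (T (f : D.H))) (T (D.generator f)) 0 := by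
    have := T.hasFDerivAt.comp_hasDerivAt (0 : ℝ) (D.hasDerivAt_koopman f)
    refine this.congr_of_eventuallyEq (Eventually.of_forall fun t => ?_)
    exact (hT t f).symm
  exact ⟨h1.differentiableAt, h1.deriv⟩

/-- `T R f` solves the resolvent equation with right side `T f`, and solutions are unique. If no
bounded inverse existed, the default value 0 would satisfy the identity too, so existence is never
needed. -/
theorem resolventOp_commute {T : D.H →L[ℝ] D.H}
    (hT : ∀ t f, T (D.koopman t f) = D.koopman t (T f)) (z : ℝ) (f : D.H) :
    T (resolventOp D.generator (z : ℂ) f) = resolventOp D.generator (z : ℂ) (T f) := by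
  unfold resolventOp
  split_ifs with h
  · obtain ⟨h1, h2⟩ := h.choose_spec
    set R := h.choose with hR
    obtain ⟨hf, hf'⟩ := h2 f
    obtain ⟨hT1, hT2⟩ := D.generator_commute hT ⟨R f, hf⟩
    have h3 := h1 ⟨T (R f), hT1⟩
    have h4 : (z : ℂ) • T (R f) - D.generator ⟨T (R f), hT1⟩ = T f := by
      conv_rhs => rw [← hf']
      rw [hT2, map_sub, Complex.coe_smul, Complex.coe_smul, map_smul]
      rfl
    change R ((z : ℂ) • T (R f) - D.generator ⟨T (R f), hT1⟩) = T (R f) at h3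
    rw [h4] at h3
    exact h3.symm
  · simp

/-- Differentiate the constant function `⟪U^t f, U^t f⟫` at 0. -/
theorem re_inner_generator (f : D.generator.domain) :
    (⟪(f : D.H), D.generator f⟫_ℂ).re = 0 := by
  have h1 := (D.hasDerivAt_koopman f).inner ℂ (D.hasDerivAt_koopman f)
  have h2 : (fun t : ℝ => ⟪D.koopman t (f : D.H), D.koopman t (f : D.H)⟫_ℂ) =
      fun _ => ⟪(f : D.H), (f : D.H)⟫_ℂ := by
    ext t; exact D.isUnitaryGroup_koopman.inner t _ _
  rw [h2] at h1
  have h3 := h1.unique (hasDerivAt_const (0 : ℝ) _)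
  have h0 : D.koopman 0 (f : D.H) = f := by rw [D.isUnitaryGroup_koopman.zero]; rfl
  rw [h0] at h3
  have h4 := congrArg Complex.re h3
  rw [Complex.add_re, ← inner_conj_symm (D.generator f) (f : D.H), Complex.conj_re,
    Complex.zero_re] at h4
  linarith

/-- Skewness of the generator gives `Re ⟪R f, f⟫ = z ‖R f‖²`, and Cauchy–Schwarz concludes. The
default value 0 obeys the bound as well. -/
theorem norm_resolventOp_le {z : ℝ} (hz : 0 < z) :
    ‖resolventOp D.generator (z : ℂ)‖ ≤ 1 / z := by
  unfold resolventOp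
  split_ifs with h
  · obtain ⟨-, h2⟩ := h.choose_spec
    set R := h.choose with hR
    refine ContinuousLinearMap.opNorm_le_bound _ (by positivity) fun f => ?_
    obtain ⟨hf, hf'⟩ := h2 f
    have h3 : (⟪R f, f⟫_ℂ).re = z * ‖R f‖ ^ 2 := by
      conv_lhs => rw [← hf']
      have h4 := D.re_inner_generator ⟨R f, hf⟩
      change (⟪R f, D.generator ⟨R f, hf⟩⟫_ℂ).re = 0 at h4
      rw [inner_sub_right, Complex.sub_re, inner_smul_right, hf', Complex.re_ofReal_mul, h4, sub_zero]
      congr 1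
      exact inner_self_eq_norm_sq (𝕜 := ℂ) (R f)
    have h5 : z * ‖R f‖ ^ 2 ≤ ‖R f‖ * ‖f‖ := by
      rw [← h3]
      exact (Complex.re_le_norm _).trans (norm_inner_le_norm _ _)
    rw [div_mul_eq_mul_div, one_mul, le_div_iff₀ hz]
    rcases (norm_nonneg (R f)).eq_or_lt with h0 | h0
    · rw [← h0, zero_mul]; exact norm_nonneg f
    · nlinarith
  · rw [norm_zero]; positivity

end Resolvent

/-! ### Positive and negative frequency parts of the resolvent -/

section SpectralProjections

/-- The negative-frequency subspace. -/
def Hminus : Submodule ℂ D.H := spectralSubspace D.koopman (Set.Iio 0)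

instance : CompleteSpace D.Hplus := (Submodule.isClosed_topologicalClosure _).completeSpace_coe
instance : CompleteSpace D.Hminus := (Submodule.isClosed_topologicalClosure _).completeSpace_coe

theorem projPlus_eq : D.projPlus = D.Hplus.starProjection := rfl

theorem conjH_mem_Hminus {f : D.H} (hf : f ∈ D.Hplus) : D.conjH f ∈ D.Hminus := by
  have := conjugation_mem_spectralSubspace D.conjH D.koopman_conjH hf
  rwa [show Neg.neg ⁻¹' Set.Ioi (0 : ℝ) = Set.Iio 0 by ext; simp] at this

theorem conjH_mem_Hplus {f : D.H} (hf : f ∈ D.Hminus) : D.conjH f ∈ D.Hplus := by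
  have := conjugation_mem_spectralSubspace D.conjH D.koopman_conjH hf
  rwa [show Neg.neg ⁻¹' Set.Iio (0 : ℝ) = Set.Ioi 0 by ext; simp] at this

theorem conjOp_projPlus : conjOp D.conjH D.projPlus = D.projMinus :=
  conjOp_starProjection D.conjH (fun _ => D.conjH_mem_Hminus) fun _ => D.conjH_mem_Hplus

/-- Constants are fixed by the Koopman group, so they have frequency 0 only. -/
theorem Hplus_le_Htilde : D.Hplus ≤ D.Htilde := fun _ hx => D.mem_Htilde.2
  (inner_fixed_spectralSubspace_eq_zero D.isUnitaryGroup_koopman D.koopman_one hx)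

theorem Hminus_le_Htilde : D.Hminus ≤ D.Htilde := fun x hx => by
  have h := D.mem_Htilde.1 (D.Hplus_le_Htilde (D.conjH_mem_Hplus hx))
  rw [inner_conjugation_right, D.conjH_symm, D.conjH_one] at h
  rw [D.mem_Htilde]
  exact inner_eq_zero_symm.1 h

theorem koopman_mem_Htilde (t : ℝ) {x : D.H} (hx : x ∈ D.Htilde) : D.koopman t x ∈ D.Htilde := by
  rw [D.mem_Htilde] at hx ⊢
  rw [← D.koopman_one t, D.isUnitaryGroup_koopman.inner, hx]

theorem resolventOp_starProjection {W : Submodule ℂ D.H} [W.HasOrthogonalProjection]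
    (hW : ∀ s, ∀ x ∈ W, D.koopman s x ∈ W) (z : ℝ) :
    Commute (resolventOp D.generator (z : ℂ)) W.starProjection := by
  ext1 f
  exact (D.resolventOp_commute (T := W.starProjection.restrictScalars ℝ)
    (fun t f => starProjection_commute_group D.isUnitaryGroup_koopman hW t f) z f).symm

theorem commute_comp_resolventOp {W : Submodule ℂ D.H} [W.HasOrthogonalProjection]
    (hW : W ≤ D.Htilde) (z : ℝ) :
    Commute (W.starProjection ∘L resolventOp D.generator (z : ℂ)) D.Htilde.starProjection := by
  have h1 := D.resolventOp_starProjection (fun s x hx => D.koopman_mem_Htilde s hx) z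
  have h2 : W.starProjection * D.Htilde.starProjection = W.starProjection := by
    exact Submodule.starProjection_comp_starProjection_of_le hW
  have h3 : D.Htilde.starProjection * W.starProjection = W.starProjection := by
    have := congrArg star h2
    rwa [star_mul, (isSelfAdjoint_starProjection W).star_eq,
      (isSelfAdjoint_starProjection D.Htilde).star_eq] at this
  have h4 : Commute W.starProjection D.Htilde.starProjection := by
    rw [Commute, SemiconjBy, h2, h3]
  exact h4.mul_left h1

theorem commute_resPlus (z : ℝ) : Commute (D.resPlus z) D.Htilde.starProjection :=
  D.commute_comp_resolventOp D.Hplus_le_Htilde z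

theorem commute_resMinus (z : ℝ) : Commute (D.resMinus z) D.Htilde.starProjection :=
  D.commute_comp_resolventOp D.Hminus_le_Htilde z

theorem resolventOp_conjH (z : ℝ) (f : D.H) :
    D.conjH (resolventOp D.generator (z : ℂ) f) = resolventOp D.generator (z : ℂ) (D.conjH f) :=
  D.resolventOp_commute (T := (D.conjH : D.H →+ D.H).toRealLinearMap D.conjH.continuous)
    (fun t f => (D.koopman_conjH t f).symm) z f

theorem conjH_resPlus (z : ℝ) (f : D.H) :
    D.conjH (D.resPlus z (D.conjH f)) = D.resMinus z f := by
  have h1 := congrArg (fun T : D.H →L[ℂ] D.H => T (resolventOp D.generator (z : ℂ) f))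
    D.conjOp_projPlus
  change D.conjH (D.projPlus (D.conjH (resolventOp D.generator (z : ℂ) f))) = _ at h1
  rw [D.resolventOp_conjH] at h1
  exact h1

theorem conjOp_restrictTo_resPlus (z : ℝ) :
    conjOp D.conjHtilde (restrictTo D.Htilde (D.resPlus z)) =
      restrictTo D.Htilde (D.resMinus z) := by
  ext1 x
  apply Subtype.ext
  rw [coe_restrictTo_apply_of_mem _
    (mem_of_commute_starProjection _ (D.commute_resMinus z) x.2), ← D.conjH_resPlus]
  change D.conjH (restrictTo D.Htilde (D.resPlus z) (D.conj x) : D.H) = _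
  rw [coe_restrictTo_apply_of_mem _
    (mem_of_commute_starProjection _ (D.commute_resPlus z) (D.conj x).2)]
  rfl

theorem norm_resPlus_le {z : ℝ} (hz : 0 < z) : ‖D.resPlus z‖ ≤ 1 / z := by
  refine (ContinuousLinearMap.opNorm_comp_le _ _).trans ?_
  refine (mul_le_of_le_one_left (norm_nonneg _) ?_).trans (D.norm_resolventOp_le hz)
  exact Submodule.starProjection_norm_le _

/-- The positive-frequency subspace, as a subspace of the zero-mean functions. -/
abbrev HtildePlus : Submodule ℂ D.Htilde := D.Hplus.comap D.Htilde.subtype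

/-- The projection onto `H₊` commutes with the resolvent, so it can be applied first. Consequently
`S⁺_{z,τ}` vanishes off `H₊`, and `ψ` describes it completely. -/
theorem restrictTo_resPlus_apply_eq_zero (z : ℝ) {x : D.Htilde} (hx : x ∈ D.HtildePlusᗮ) :
    restrictTo D.Htilde (D.resPlus z) x = 0 := by
  have h1 : D.projPlus (x : D.H) = 0 := by
    rw [projPlus_eq, Submodule.starProjection_apply_eq_zero_iff, Submodule.mem_orthogonal]
    exact fun u hu => (Submodule.mem_orthogonal _ _).1 hx ⟨u, D.Hplus_le_Htilde hu⟩ hu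
  have h2 : D.resPlus z x = 0 := by
    have := D.resolventOp_starProjection (W := D.Hplus)
      (fun s x hx => apply_mem_spectralSubspace D.isUnitaryGroup_koopman s hx) z
    have h3 := congrArg (fun T : D.H →L[ℂ] D.H => T x) this.eq
    change resolventOp D.generator (z : ℂ) (D.projPlus x) = D.resPlus z x at h3
    rw [← h3, h1, map_zero]
  apply Subtype.ext
  rw [coe_restrictTo_apply, h2, map_zero]
  rfl

theorem inner_conjHtilde_eq_zero {x y : D.Htilde} (hx : x ∈ D.HtildePlus)
    (hy : y ∈ D.HtildePlus) : ⟪x, D.conjHtilde y⟫_ℂ = 0 :=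
  inner_spectralSubspace_eq_zero D.isUnitaryGroup_koopman (x := (x : D.H)) hx
    (D.conjH_mem_Hminus hy)

end SpectralProjections

end ErgodicFlow

/-! ### The Markov operators: positivity, compactness and spectral gap -/

variable {𝓜 : Type*} [MetricSpace 𝓜] [MeasurableSpace 𝓜] [BorelSpace 𝓜]

namespace ErgodicFlow

variable (D : ErgodicFlow 𝓜)

theorem ae_mem_K : ∀ᵐ x ∂D.μ, x ∈ D.K :=
  measure_mono_null (Set.compl_subset_compl.2 D.support_subset) D.measure_compl_support

theorem one_ne_zero : D.one ≠ 0 := by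
  intro h
  have h1 := D.coeFn_one
  rw [h] at h1
  have h2 : ∀ᵐ _ ∂D.μ, False := by
    filter_upwards [h1, Lp.coeFn_zero ℂ 2 D.μ] with x hx hx'
    rw [hx'] at hx
    exact zero_ne_one hx
  obtain ⟨x, hx⟩ := h2.exists
  exact hx

end ErgodicFlow

namespace MarkovKernelFamily

variable {D : ErgodicFlow 𝓜} (P : MarkovKernelFamily D) {τ : ℝ}

theorem isIntegralOperator (hτ : 0 < τ) : D.IsIntegralOperator (P.p τ) (P.G τ) := by
  -- The conventional value 0 of `integralOperator` would contradict strict positivity at the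
  -- constant function 1, so the kernel does define a bounded operator.
  have h := (P.strictly_positive τ hτ D.one D.one_ne_zero).1
  unfold MarkovKernelFamily.G
  unfold ErgodicFlow.integralOperator at *
  split_ifs at h ⊢ with hk
  · exact hk.choose_spec
  · simp at h

theorem G_nonneg (hτ : 0 < τ) : 0 ≤ P.G τ := by
  rw [ContinuousLinearMap.nonneg_iff_isPositive, ContinuousLinearMap.isPositive_iff_complex]
  intro f
  have key : 0 ≤ (⟪f, P.G τ f⟫_ℂ).re ∧ (⟪f, P.G τ f⟫_ℂ).im = 0 := by
    rcases eq_or_ne f 0 with rfl | hf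
    · simp
    · exact ⟨(P.strictly_positive τ hτ f hf).1.le, (P.strictly_positive τ hτ f hf).2⟩
  rw [← inner_conj_symm]
  refine ⟨Complex.ext ?_ ?_, ?_⟩
  · rfl
  · change 0 = (starRingEnd ℂ ⟪f, P.G τ f⟫_ℂ).im
    rw [Complex.conj_im, key.2, neg_zero]
  · change 0 ≤ (starRingEnd ℂ ⟪f, P.G τ f⟫_ℂ).re
    rw [Complex.conj_re]
    exact key.1

theorem isSelfAdjoint_G (hτ : 0 < τ) : IsSelfAdjoint (P.G τ) := (P.G_nonneg hτ).isSelfAdjoint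

theorem G_one (hτ : 0 < τ) : P.G τ D.one = D.one := by
  apply Lp.ext
  filter_upwards [P.isIntegralOperator hτ D.one, D.coeFn_one, D.ae_mem_K] with x h1 h2 h3
  rw [h1, h2]
  have h4 : ∫ y, (P.p τ x y : ℂ) * D.one y ∂D.μ = ∫ y, ((P.p τ x y : ℝ) : ℂ) ∂D.μ := by
    refine integral_congr_ae ?_
    filter_upwards [D.coeFn_one] with y hy
    rw [hy, mul_one]
  rw [h4, integral_complex_ofReal, P.integral_eq_one τ hτ x h3, Complex.ofReal_one]

theorem G_mem_Htilde (hτ : 0 < τ) {f : D.H} (hf : f ∈ D.Htilde) : P.G τ f ∈ D.Htilde := by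
  rw [D.mem_Htilde] at *
  have h := ContinuousLinearMap.isSelfAdjoint_iff_isSymmetric.1 (P.isSelfAdjoint_G hτ) D.one f
  have h' : ⟪P.G τ D.one, f⟫_ℂ = ⟪D.one, P.G τ f⟫_ℂ := h
  rw [← h', P.G_one hτ, hf]

theorem G_conjH (hτ : 0 < τ) (f : D.H) : P.G τ (D.conjH f) = D.conjH (P.G τ f) := by
  apply Lp.ext
  filter_upwards [P.isIntegralOperator hτ (D.conjH f), P.isIntegralOperator hτ f,
    Lp.coeFn_star (P.G τ f)] with x h1 h2 h3
  rw [h1, D.conjH_apply (P.G τ f), h3, Pi.star_apply, h2]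
  change _ = (starRingEnd ℂ) _
  rw [← integral_conj]
  refine integral_congr_ae ?_
  filter_upwards [Lp.coeFn_star f] with y hy
  rw [D.conjH_apply, hy, Pi.star_apply, map_mul, Complex.conj_ofReal]
  rfl

theorem coe_Gtilde_apply (hτ : 0 < τ) (f : D.Htilde) :
    (P.Gtilde τ f : D.H) = P.G τ (f : D.H) :=
  coe_restrictTo_apply_of_mem D.Htilde (P.G_mem_Htilde hτ f.2)

theorem conjOp_Gtilde (hτ : 0 < τ) : conjOp D.conjHtilde (P.Gtilde τ) = P.Gtilde τ := by
  ext1 f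
  apply Subtype.ext
  change star ((P.Gtilde τ (D.conjHtilde.symm f) : D.Htilde) : D.H) = _
  rw [P.coe_Gtilde_apply hτ, P.coe_Gtilde_apply hτ]
  have h := P.G_conjH hτ (f : D.H)
  change star (P.G τ (D.conjH (f : D.H))) = _
  rw [h, D.conjH_apply, star_star]

theorem Gtilde_nonneg (hτ : 0 < τ) : 0 ≤ P.Gtilde τ := restrictTo_nonneg D.Htilde (P.G_nonneg hτ)

theorem exists_bound (hτ : 0 < τ) : ∃ C : ℝ, 0 ≤ C ∧ ∀ x ∈ D.K, ∀ y ∈ D.K, ‖P.p τ x y‖ ≤ C := by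
  obtain ⟨C, hC⟩ := (D.isCompact_K.prod D.isCompact_K).exists_bound_of_continuousOn
    (P.continuousOn τ hτ)
  exact ⟨max C 0, le_max_right _ _, fun x hx y hy => (hC (x, y) ⟨hx, hy⟩).trans (le_max_left _ _)⟩

/-- Kernel sections `κ x = p_τ(x, ·)` are bounded uniformly on `K`. They express the Hilbert–Schmidt
property and the mapping of `L²` into `L^∞` in one formula. -/
theorem exists_section (hτ : 0 < τ) : ∃ C : ℝ, 0 ≤ C ∧ ∃ κ : 𝓜 → D.H,
    (∀ x ∈ D.K, ‖κ x‖ ≤ C) ∧ ∀ f : D.H, ∀ᵐ x ∂D.μ, P.G τ f x = ⟪κ x, f⟫_ℂ := by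
  obtain ⟨C, hC0, hC⟩ := P.exists_bound hτ
  have hb : ∀ x ∈ D.K, ∀ᵐ y ∂D.μ, ‖(P.p τ x y : ℂ)‖ ≤ C := fun x hx => by
    filter_upwards [D.ae_mem_K] with y hy
    rw [Complex.norm_real]
    exact hC x hx y hy
  have hm : ∀ x ∈ D.K, MemLp (fun y => (P.p τ x y : ℂ)) 2 D.μ := fun x hx => by
    refine MemLp.of_bound ?_ C (hb x hx)
    exact (Complex.measurable_ofReal.comp
      ((P.measurable τ hτ).comp measurable_prodMk_left)).aestronglyMeasurable
  classical
  -- The value 0 off `K` is immaterial, as `K` has full measure.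
  refine ⟨C, hC0, fun x => if hx : x ∈ D.K then (hm x hx).toLp _ else 0, fun x hx => ?_,
    fun f => ?_⟩
  · simp only [dif_pos hx]
    have h1 : ∀ᵐ y ∂D.μ, ‖((hm x hx).toLp _ : D.H) y‖ ≤ C := by
      filter_upwards [(hm x hx).coeFn_toLp, hb x hx] with y h1 h2
      rwa [h1]
    refine (Lp.norm_le_of_ae_bound hC0 h1).trans_eq ?_
    simp [measureUnivNNReal]
  · filter_upwards [P.isIntegralOperator hτ f, D.ae_mem_K] with x h1 hx
    rw [h1, dif_pos hx, L2.inner_def]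
    refine integral_congr_ae ?_
    filter_upwards [(hm x hx).coeFn_toLp] with y hy
    rw [hy, RCLike.inner_apply', Complex.conj_ofReal]

theorem norm_sq_eq_integral (f : D.H) : ‖f‖ ^ 2 = ∫ x, ‖f x‖ ^ 2 ∂D.μ := by
  have h : ((‖f‖ ^ 2 : ℝ) : ℂ) = ∫ x, ((‖f x‖ ^ 2 : ℝ) : ℂ) ∂D.μ := by
    rw [Complex.ofReal_pow]
    refine (inner_self_eq_norm_sq_to_K (𝕜 := ℂ) f).symm.trans ?_
    rw [L2.inner_def]
    refine integral_congr_ae (Eventually.of_forall fun x => ?_)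
    exact (inner_self_eq_norm_sq_to_K (𝕜 := ℂ) (f x)).trans (Complex.ofReal_pow _ _).symm
  rw [integral_complex_ofReal] at h
  exact_mod_cast h

theorem integrable_norm_sq (f : D.H) : Integrable (fun x => ‖f x‖ ^ 2) D.μ :=
  (Lp.memLp f).integrable_norm_pow two_ne_zero

/-- A Hilbert–Schmidt bound: Bessel's inequality for `κ x` at almost every `x`, then integration
against the probability measure. -/
theorem exists_sum_norm_sq_le (hτ : 0 < τ) : ∃ C : ℝ, 0 ≤ C ∧ ∀ {ι : Type} (v : ι → D.H),
    Orthonormal ℂ v → ∀ s : Finset ι, ∑ j ∈ s, ‖P.G τ (v j)‖ ^ 2 ≤ C ^ 2 := by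
  obtain ⟨C, hC0, κ, hκ, hG⟩ := P.exists_section hτ
  refine ⟨C, hC0, fun v hv s => ?_⟩
  simp_rw [norm_sq_eq_integral]
  rw [← integral_finsetSum s fun j _ => integrable_norm_sq _]
  have h : ∀ᵐ x ∂D.μ, ∑ j ∈ s, ‖P.G τ (v j) x‖ ^ 2 ≤ C ^ 2 := by
    have h1 : ∀ᵐ x ∂D.μ, ∀ j ∈ s, P.G τ (v j) x = ⟪κ x, v j⟫_ℂ :=
      (ae_ball_iff s.countable_toSet).2 fun j _ => hG (v j)
    filter_upwards [h1, D.ae_mem_K] with x hx hxK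
    calc ∑ j ∈ s, ‖P.G τ (v j) x‖ ^ 2 = ∑ j ∈ s, ‖⟪v j, κ x⟫_ℂ‖ ^ 2 :=
          Finset.sum_congr rfl fun j hj => by rw [hx j hj, norm_inner_symm]
      _ ≤ ‖κ x‖ ^ 2 := hv.sum_inner_products_le (κ x)
      _ ≤ C ^ 2 := by gcongr; exact hκ x hxK
  calc _ ≤ ∫ _, C ^ 2 ∂D.μ := integral_mono_ae
        (integrable_finsetSum s fun j _ => integrable_norm_sq _) (integrable_const _) h
    _ = C ^ 2 := by simp

theorem norm_G_apply_le (hτ : 0 < τ) {f : D.H} {B : ℝ} (hf : ∀ᵐ x ∂D.μ, ‖f x‖ ≤ B) :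
    ∀ᵐ x ∂D.μ, ‖P.G τ f x‖ ≤ B := by
  filter_upwards [P.isIntegralOperator hτ f, D.ae_mem_K] with x h1 hx
  have h2 := P.integral_eq_one τ hτ x hx
  have h3 : Integrable (P.p τ x) D.μ := by
    refine Integrable.of_integral_ne_zero ?_
    rw [h2]
    exact _root_.one_ne_zero
  rw [h1]
  calc _ ≤ ∫ y, P.p τ x y * B ∂D.μ := by
        refine norm_integral_le_of_norm_le (h3.mul_const B) ?_
        filter_upwards [hf] with y hy
        rw [norm_mul, Complex.norm_real, Real.norm_of_nonneg (P.nonneg τ hτ x y)]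
        exact mul_le_mul_of_nonneg_left hy (P.nonneg τ hτ x y)
    _ = B := by rw [integral_mul_const, h2, one_mul]

/-- An eigenfunction with `c > 1` is bounded, because `G_τ` maps `L²` to bounded functions. The
Markov property makes `G_τ` a sup-norm contraction, so each iteration improves the bound by `1/c`,
forcing `f = 0`. -/
theorem eigenvalue_le_one (hτ : 0 < τ) {f : D.H} (hf : f ≠ 0) {c : ℝ}
    (h : P.G τ f = (c : ℂ) • f) : c ≤ 1 := by
  by_contra! hc
  obtain ⟨C, hC0, κ, hκ, hG⟩ := P.exists_section hτ
  have hc0 : 0 < c := one_pos.trans hc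
  have h0 : ∀ᵐ x ∂D.μ, P.G τ f x = (c : ℂ) * f x := by
    rw [h]; exact Lp.coeFn_smul _ _
  have step : ∀ {B : ℝ}, (∀ᵐ x ∂D.μ, ‖P.G τ f x‖ ≤ B) → ∀ᵐ x ∂D.μ, ‖f x‖ ≤ B / c := fun hB => by
    filter_upwards [hB, h0] with x h1 h2
    rw [h2, norm_mul, Complex.norm_real, Real.norm_of_nonneg hc0.le] at h1
    rw [le_div_iff₀ hc0]
    linarith
  have h1 : ∀ n : ℕ, ∀ᵐ x ∂D.μ, ‖f x‖ ≤ C * ‖f‖ / c * (c⁻¹) ^ n := by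
    intro n
    induction n with
    | zero =>
      rw [pow_zero, mul_one]
      refine step ?_
      filter_upwards [hG f, D.ae_mem_K] with x h1 hx
      rw [h1]
      exact (norm_inner_le_norm _ _).trans (mul_le_mul_of_nonneg_right (hκ x hx) (norm_nonneg _))
    | succ n ih =>
      rw [pow_succ, ← mul_assoc, ← div_eq_mul_inv]
      exact step (P.norm_G_apply_le hτ ih)
  apply hf
  apply Lp.ext
  filter_upwards [ae_all_iff.2 h1, Lp.coeFn_zero ℂ 2 D.μ] with x hx hx0
  rw [hx0]
  have h2 : Tendsto (fun n : ℕ => C * ‖f‖ / c * (c⁻¹) ^ n) atTop (𝓝 (C * ‖f‖ / c * 0)) :=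
    (tendsto_pow_atTop_nhds_zero_of_lt_one (by positivity) (inv_lt_one_of_one_lt₀ hc)).const_mul _
  rw [mul_zero] at h2
  exact norm_le_zero_iff.1 (ge_of_tendsto' h2 hx)

/-- Otherwise `G_{τ/2} f - f` would be an eigenvector of `G_{τ/2}` with eigenvalue `-1`, against
positivity. -/
theorem G_half_apply (hτ : 0 < τ) {f : D.H} (h : P.G τ f = f) : P.G (τ / 2) f = f := by
  by_contra hne
  have h2 : P.G (τ / 2) (P.G (τ / 2) f) = f := by
    have := P.semigroup (τ / 2) (τ / 2) (half_pos hτ) (half_pos hτ)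
    rw [add_halves] at this
    exact (DFunLike.congr_fun this f).trans h
  have h3 := (P.strictly_positive (τ / 2) (half_pos hτ) (P.G (τ / 2) f - f) (sub_ne_zero.2 hne)).1
  have h4 : D.integralOperator (P.p (τ / 2)) (P.G (τ / 2) f - f) = -(P.G (τ / 2) f - f) := by
    change P.G (τ / 2) (P.G (τ / 2) f - f) = _
    rw [map_sub, h2, neg_sub]
  rw [h4, inner_neg_right, Complex.neg_re] at h3
  have h5 : 0 ≤ (⟪P.G (τ / 2) f - f, P.G (τ / 2) f - f⟫_ℂ).re := inner_self_nonneg (𝕜 := ℂ)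
  linarith

theorem G_half_pow_apply (hτ : 0 < τ) {f : D.H} (h : P.G τ f = f) (n : ℕ) :
    P.G (τ / 2 ^ n) f = f := by
  induction n with
  | zero => simpa using h
  | succ n ih =>
    rw [pow_succ, ← div_div]
    exact P.G_half_apply (by positivity) ih

theorem G_mul_apply (hτ : 0 < τ) {f : D.H} (h : P.G τ f = f) (n : ℕ) :
    P.G ((n + 1) * τ) f = f := by
  induction n with
  | zero => simpa using h
  | succ n ih =>
    have h1 := DFunLike.congr_fun (P.semigroup ((n + 1) * τ) τ (by positivity) hτ) f
    have h2 : ((n + 1 : ℕ) + 1 : ℝ) * τ = (n + 1) * τ + τ := by push_cast; ring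
    rw [h2]
    refine h1.symm.trans ?_
    change P.G ((n + 1) * τ) (P.G τ f) = f
    rw [h, ih]

/-- Ergodicity speaks of all times at once, so invariance at a single `τ` must be spread: halving
and adding give dyadic multiples of `τ`, and strong continuity at `0⁺` reaches every `t`. -/
theorem G_apply_eq_self (hτ : 0 < τ) {f : D.H} (h : P.G τ f = f) {t : ℝ} (ht : 0 < t) :
    P.G t f = f := by
  set δ : ℕ → ℝ := fun n => τ / 2 ^ n with hδ
  have hδ0 : ∀ n, 0 < δ n := fun n => by positivity
  have hδt : Tendsto δ atTop (𝓝 0) := by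
    have := (tendsto_pow_atTop_nhds_zero_of_lt_one (r := (2 : ℝ)⁻¹) (by norm_num)
      (by norm_num)).const_mul τ
    simpa [hδ, div_eq_mul_inv] using this
  -- The first multiple of `δ n` strictly beyond `t`; strictness is needed because the semigroup is
  -- given for positive times only.
  set s : ℕ → ℝ := fun n => (⌊t / δ n⌋₊ + 1) * δ n with hs
  have h1 : ∀ n, 0 < s n - t := fun n => by
    have := (div_lt_iff₀ (hδ0 n)).1 (Nat.lt_floor_add_one (t / δ n))
    simp only [hs]; linarith
  have h2 : ∀ n, s n - t ≤ δ n := fun n => by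
    have := (le_div_iff₀ (hδ0 n)).1 (Nat.floor_le (div_nonneg ht.le (hδ0 n).le))
    simp only [hs]; linarith
  have h3 : Tendsto (fun n => s n - t) atTop (𝓝[>] 0) :=
    tendsto_nhdsWithin_iff.2 ⟨squeeze_zero (fun n => (h1 n).le) h2 hδt,
      Eventually.of_forall h1⟩
  have h4 : Tendsto (fun n => P.G t (P.G (s n - t) f)) atTop (𝓝 (P.G t f)) :=
    ((P.G t).continuous.tendsto f).comp ((P.tendsto_zero f).comp h3)
  have h5 : ∀ n, P.G t (P.G (s n - t) f) = f := fun n => by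
    have h6 := DFunLike.congr_fun (P.semigroup t (s n - t) ht (h1 n)) f
    rw [add_sub_cancel] at h6
    exact h6.trans (P.G_mul_apply (hδ0 n) (P.G_half_pow_apply hτ h n) _)
  simp_rw [h5] at h4
  exact tendsto_nhds_unique h4 tendsto_const_nhds

theorem eq_zero_of_G_apply_eq_self (hτ : 0 < τ) {f : D.H} (hf : f ∈ D.Htilde) (h : P.G τ f = f) :
    f = 0 := by
  obtain ⟨c, hc⟩ := (P.ergodic f).1 fun t ht => P.G_apply_eq_self hτ h ht
  have h1 : f = c • D.one := by
    apply Lp.ext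
    filter_upwards [hc, Lp.coeFn_smul c D.one, D.coeFn_one] with x h1 h2 h3
    rw [h1, h2, Pi.smul_apply, h3, smul_eq_mul, mul_one]
  rw [D.mem_Htilde, h1, inner_smul_right, mul_eq_zero, inner_self_eq_zero] at hf
  rw [h1, hf.resolve_right D.one_ne_zero, zero_smul]

variable {lam : ℕ+ → ℝ} {φ : ℕ+ → D.Htilde}

theorem isPosEigendecomposition_Gtilde (hτ : 0 < τ)
    (hφ : IsEigendecomposition (P.Gtilde τ) ⊤ lam φ) :
    IsPosEigendecomposition (P.Gtilde τ) ⊤ lam φ where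
  toIsEigendecomposition := hφ
  nonneg := P.Gtilde_nonneg hτ
  apply_eq_zero x hx := by
    rw [Submodule.top_orthogonal_eq_bot, Submodule.mem_bot] at hx
    rw [hx, map_zero]

theorem G_apply_eigenvector (hτ : 0 < τ) (hφ : IsEigendecomposition (P.Gtilde τ) ⊤ lam φ) (j : ℕ+) :
    P.G τ (φ j : D.H) = (lam j : ℂ) • (φ j : D.H) := by
  rw [← P.coe_Gtilde_apply hτ, hφ.apply_eq]
  rfl

theorem coe_eigenvector_ne_zero (hφ : IsEigendecomposition (P.Gtilde τ) ⊤ lam φ) (j : ℕ+) :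
    (φ j : D.H) ≠ 0 := fun h => hφ.orthonormal.ne_zero j (Subtype.ext h)

theorem eigenvalue_lt_one (hτ : 0 < τ) (hφ : IsEigendecomposition (P.Gtilde τ) ⊤ lam φ) (j : ℕ+) :
    lam j < 1 := by
  have hne := P.coe_eigenvector_ne_zero hφ j
  have h := P.G_apply_eigenvector hτ hφ j
  refine lt_of_le_of_ne (P.eigenvalue_le_one hτ hne h) fun h1 => hne ?_
  rw [h1, Complex.ofReal_one, one_smul] at h
  exact P.eq_zero_of_G_apply_eq_self hτ (φ j).2 h

theorem norm_Gtilde_le (hτ : 0 < τ) (hφ : IsEigendecomposition (P.Gtilde τ) ⊤ lam φ) :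
    ‖P.Gtilde τ‖ ≤ lam 1 := by
  have h := P.isPosEigendecomposition_Gtilde hτ hφ
  exact ContinuousLinearMap.opNorm_le_bound _ (h.eigenvalue_nonneg 1) fun x =>
    h.norm_apply_le 1 fun j hj => absurd hj (not_lt_one)

/-- The Hilbert–Schmidt bound makes the squared eigenvalues summable. -/
theorem tendsto_eigenvalue (hτ : 0 < τ) (hφ : IsEigendecomposition (P.Gtilde τ) ⊤ lam φ) :
    Tendsto (fun n : ℕ => lam (Nat.succPNat n)) atTop (𝓝 0) := by
  obtain ⟨C, hC0, hC⟩ := P.exists_sum_norm_sq_le hτ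
  have hv : Orthonormal ℂ fun i : ℕ => (φ (Nat.succPNat i) : D.H) :=
    (D.Htilde.subtypeₗᵢ.orthonormal_comp_iff (v := φ)).2 hφ.orthonormal |>.comp _
      Nat.succPNat_injective
  have h0 := (P.isPosEigendecomposition_Gtilde hτ hφ).eigenvalue_nonneg
  have hnorm : ∀ i : ℕ, ‖P.G τ (φ (Nat.succPNat i) : D.H)‖ = lam (Nat.succPNat i) := fun i => by
    rw [P.G_apply_eigenvector hτ hφ, norm_smul, hv.1 i, mul_one, Complex.norm_of_nonneg (h0 _)]
  have h1 : Summable fun i : ℕ => ‖P.G τ (φ (Nat.succPNat i) : D.H)‖ ^ 2 :=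
    summable_of_sum_le (fun i => by positivity) (hC _ hv)
  have h2 := h1.tendsto_atTop_zero.sqrt
  simp_rw [Real.sqrt_sq (norm_nonneg _), hnorm, Real.sqrt_zero] at h2
  exact h2

/-- A norm limit of finite-rank truncations; the error after `M` eigenvectors is at most the next
eigenvalue. -/
theorem isCompactOperator_Gtilde (hτ : 0 < τ) (hφ : IsEigendecomposition (P.Gtilde τ) ⊤ lam φ) :
    IsCompactOperator (P.Gtilde τ) := by
  have h := P.isPosEigendecomposition_Gtilde hτ hφ
  have h1 : Tendsto (fun M : ℕ => P.Gtilde τ ∘L headProj φ M) atTop (𝓝 (P.Gtilde τ)) := by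
    rw [tendsto_iff_norm_sub_tendsto_zero]
    refine squeeze_zero (fun _ => norm_nonneg _) (fun M => ?_) (P.tendsto_eigenvalue hτ hφ)
    refine ContinuousLinearMap.opNorm_le_bound _ (h.eigenvalue_nonneg _) fun x => ?_
    have h2 : (P.Gtilde τ ∘L headProj φ M - P.Gtilde τ) x =
        -P.Gtilde τ (x - headProj φ M x) := by
      rw [map_sub, neg_sub]; rfl
    rw [h2, norm_neg]
    refine (h.norm_apply_le (Nat.succPNat M) fun j hj => ?_).trans ?_
    · exact (headSpan φ M).sub_starProjection_mem_orthogonal x (φ j)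
        (mem_headSpan φ (Nat.lt_succ_iff.1 hj))
    · gcongr
      · exact h.eigenvalue_nonneg _
      · rw [headProj_eq, ← Submodule.starProjection_orthogonal_val]
        exact (headSpan φ M)ᗮ.norm_starProjection_apply_le x
  refine isCompactOperator_of_tendsto h1 (Eventually.of_forall fun M => ?_)
  have h2 : IsCompactOperator (id : headSpan φ M → headSpan φ M) :=
    (isCompactOperator_id_iff_finiteDimensional (𝕜 := ℂ)).2 inferInstance
  exact ((h2.comp_clm (headSpan φ M).orthogonalProjectionOnto).clm_comp
    (headSpan φ M).subtypeL).clm_comp (P.Gtilde τ)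

end MarkovKernelFamily

/-! ### The operators of the statement in abstract form, and convergence in `L` -/

variable {𝓜 : Type*} [MetricSpace 𝓜] [MeasurableSpace 𝓜] [BorelSpace 𝓜]

namespace MarkovKernelFamily

variable {D : ErgodicFlow 𝓜} (P : MarkovKernelFamily D) {z τ : ℝ} {lam e : ℕ+ → ℝ}
  {φ ψ : ℕ+ → D.Htilde}

theorem SPlus_eq (z : ℝ) (hτ : 0 < τ) :
    P.SPlus z τ = sandwich (opAbs (restrictTo D.Htilde (D.resPlus z))) (P.Gtilde τ) :=
  restrictTo_sandwich_opAbs D.Htilde (D.commute_resPlus z) fun _ hx => P.G_mem_Htilde hτ hx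

theorem SMinus_eq (z : ℝ) (hτ : 0 < τ) : P.SMinus z τ = conjOp D.conjHtilde (P.SPlus z τ) := by
  rw [P.SPlus_eq z hτ, conjOp_sandwich_opAbs, D.conjOp_restrictTo_resPlus, P.conjOp_Gtilde hτ]
  exact restrictTo_sandwich_opAbs D.Htilde (D.commute_resMinus z) fun _ hx => P.G_mem_Htilde hτ hx

theorem SPlusL_eq (z τ : ℝ) (φ : ℕ+ → D.Htilde) (L : ℕ) :
    P.SPlusL z τ φ L = sandwich (opAbs (headProj φ L ∘L restrictTo D.Htilde (D.resPlus z) ∘L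
      headProj φ L)) (P.Gtilde τ) := rfl

/-- Since the `φ_j` are real, `Π_L` commutes with conjugation, so the symmetry between the two signs
survives truncation. -/
theorem SMinusL_eq (z : ℝ) (hτ : 0 < τ) (hφ : ∀ j, D.conj (φ j) = φ j) (L : ℕ) :
    P.SMinusL z τ φ L = conjOp D.conjHtilde (P.SPlusL z τ φ L) := by
  have h1 : conjOp D.conjHtilde (headProj φ L) = headProj φ L := by
    rw [conjOp_headProj]
    exact congrArg (fun v => headProj v L) (funext hφ)
  have h2 : conjOp D.conjHtilde (headProj φ L ∘L restrictTo D.Htilde (D.resPlus z) ∘L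
      headProj φ L) = headProj φ L ∘L restrictTo D.Htilde (D.resMinus z) ∘L headProj φ L := by
    rw [← D.conjOp_restrictTo_resPlus z]
    conv_rhs => rw [← h1]
    exact (conjOp_mul _ _ _).trans (congrArg (_ * ·) (conjOp_mul _ _ _))
  rw [P.SPlusL_eq, conjOp_sandwich_opAbs, h2, P.conjOp_Gtilde hτ]
  rfl

theorem SM_eq (z : ℝ) (hτ : 0 < τ) (ψ : ℕ+ → D.Htilde) (M : ℕ) :
    P.SM z τ ψ M = diffCompr D.conjHtilde ψ M (P.SPlus z τ) := by
  unfold SM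
  rw [P.SMinus_eq z hτ]
  rfl

theorem SML_eq (z : ℝ) (hτ : 0 < τ) (hφ : ∀ j, D.conj (φ j) = φ j) (ξ : ℕ+ → D.Htilde) (M L : ℕ) :
    P.SML z τ φ ξ M L = diffCompr D.conjHtilde ξ M (P.SPlusL z τ φ L) := by
  unfold SML
  rw [P.SMinusL_eq z hτ hφ]
  rfl

theorem isPosEigendecomposition_SPlus (hτ : 0 < τ)
    (hψ : IsEigendecomposition (P.SPlus z τ) D.HtildePlus e ψ) :
    IsPosEigendecomposition (P.SPlus z τ) D.HtildePlus e ψ where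
  toIsEigendecomposition := hψ
  nonneg := by
    rw [P.SPlus_eq z hτ]
    exact sandwich_nonneg _ (P.Gtilde_nonneg hτ)
  apply_eq_zero x hx := by
    rw [P.SPlus_eq z hτ]
    exact sandwich_opAbs_apply_eq_zero _ (D.restrictTo_resPlus_apply_eq_zero z hx)

theorem isPosEigendecomposition_SPlusL (hτ : 0 < τ) {L : ℕ} {ξ : ℕ+ → D.Htilde}
    (hξ : IsEigendecomposition (P.SPlusL z τ φ L) ⊤ e ξ) :
    IsPosEigendecomposition (P.SPlusL z τ φ L) ⊤ e ξ where
  toIsEigendecomposition := hξ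
  nonneg := sandwich_nonneg _ (P.Gtilde_nonneg hτ)
  apply_eq_zero x hx := by
    rw [Submodule.top_orthogonal_eq_bot, Submodule.mem_bot] at hx
    rw [hx, map_zero]

theorem norm_restrictTo_resPlus_le (hz : 0 < z) : ‖restrictTo D.Htilde (D.resPlus z)‖ ≤ 1 / z :=
  (norm_restrictTo_le D.Htilde _).trans (D.norm_resPlus_le hz)

theorem norm_sandwich_opAbs_Gtilde_le (hz : 0 < z) (hτ : 0 < τ)
    (hφ : IsEigendecomposition (P.Gtilde τ) ⊤ lam φ) {R : D.Htilde →L[ℂ] D.Htilde}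
    (hR : ‖R‖ ≤ 1 / z) : ‖sandwich (opAbs R) (P.Gtilde τ)‖ ≤ lam 1 / z := by
  refine (norm_sandwich_le (opAbs_nonneg R) _).trans ?_
  rw [norm_opAbs, div_eq_mul_one_div, mul_comm (lam 1)]
  exact mul_le_mul hR (P.norm_Gtilde_le hτ hφ) (norm_nonneg _) (by positivity)

theorem isCompactOperator_sandwich_Gtilde (hτ : 0 < τ)
    (hφ : IsEigendecomposition (P.Gtilde τ) ⊤ lam φ) (R : D.Htilde →L[ℂ] D.Htilde) :
    IsCompactOperator (sandwich R (P.Gtilde τ)) :=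
  ((P.isCompactOperator_Gtilde hτ hφ).comp_clm (opSqrt R)).clm_comp (opSqrt R)

theorem tendsto_compression {E : Type*} [NormedAddCommGroup E] [InnerProductSpace ℂ E]
    [CompleteSpace E] {v : ℕ+ → E}
    (hv : (Submodule.span ℂ (Set.range v)).topologicalClosure = ⊤) (R : E →L[ℂ] E) (x : E) :
    Tendsto (fun L => (headProj v L ∘L R ∘L headProj v L) x) atTop (𝓝 (R x)) := by
  haveI : CompleteSpace (⊤ : Submodule ℂ E) := isClosed_univ.completeSpace_coe
  have h : ∀ y : E, Tendsto (fun L => headProj v L y) atTop (𝓝 ((1 : E →L[ℂ] E) y)) := fun y => by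
    have := tendsto_headProj_apply v ⊤ hv y
    rwa [Submodule.starProjection_top] at this
  exact tendsto_apply_of_norm_le (B := 1) (norm_headProj_le v) (h (R x))
    ((R.continuous.tendsto x).comp (h x))

theorem star_compression {E : Type*} [NormedAddCommGroup E] [InnerProductSpace ℂ E]
    [CompleteSpace E] (v : ℕ+ → E) (L : ℕ) (R : E →L[ℂ] E) :
    star (headProj v L ∘L R ∘L headProj v L) = headProj v L ∘L star R ∘L headProj v L := by
  change star (headProj v L * (R * headProj v L)) = headProj v L * (star R * headProj v L)
  rw [star_mul, star_mul, (isSelfAdjoint_headProj v L).star_eq, mul_assoc]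

/-- `Π_L → 1` strongly, hence the compressions of the resolvent and of its adjoint converge
strongly, and compactness of `G_τ` upgrades this to norm convergence. -/
theorem tendsto_SPlusL (hz : 0 < z) (hτ : 0 < τ)
    (hφ : IsEigendecomposition (P.Gtilde τ) ⊤ lam φ) :
    Tendsto (fun L => P.SPlusL z τ φ L) atTop (𝓝 (P.SPlus z τ)) := by
  rw [P.SPlus_eq z hτ]
  refine tendsto_sandwich_opAbs (C := 1 / z)
    (fun L => (norm_headProj_mul_mul_le φ L _).trans (norm_restrictTo_resPlus_le hz))
    (norm_restrictTo_resPlus_le hz) (tendsto_compression hφ.closure_span _) (fun x => ?_)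
    (P.isCompactOperator_Gtilde hτ hφ) (P.Gtilde_nonneg hτ).isSelfAdjoint
  refine (tendsto_compression hφ.closure_span
    (star (restrictTo D.Htilde (D.resPlus z))) x).congr fun L => ?_
  exact DFunLike.congr_fun (star_compression φ L _).symm x

end MarkovKernelFamily

end ResolventCompactification
end

theorem mainTheorem2 {𝓜 : Type*} [MetricSpace 𝓜] [MeasurableSpace 𝓜] [BorelSpace 𝓜]
    (D : ResolventCompactification.ErgodicFlow 𝓜)
    (P : ResolventCompactification.MarkovKernelFamily D)
    (z τ : ℝ) (hz : 0 < z) (hτ : 0 < τ)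
    -- the real kernel eigenbasis of the zero-mean functions
    (lam : ℕ+ → ℝ) (φ : ℕ+ → D.Htilde)
    (hφ : ResolventCompactification.IsEigendecomposition (P.Gtilde τ) ⊤ lam φ)
    (hφ_real : ∀ j, D.conj (φ j) = φ j)
    -- the eigendecomposition of `S⁺_{z,τ}` on `H₊`
    (e : ℕ+ → ℝ) (ψ : ℕ+ → D.Htilde)
    (hψ : ResolventCompactification.IsEigendecomposition (P.SPlus z τ)
      (D.Hplus.comap D.Htilde.subtype) e ψ)
    -- the eigendecompositions of `S⁺_{z,τ,L}` on `H̃`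
    (eL : ℕ → ℕ+ → ℝ) (ξ : ℕ → ℕ+ → D.Htilde)
    (hξ : ∀ L, ResolventCompactification.IsEigendecomposition (P.SPlusL z τ φ L) ⊤ (eL L) (ξ L)) :
    (∃ a b : ℝ, -(1 / z) < a ∧ a ≤ b ∧ b < 1 / z ∧
      spectrum ℂ (-P.SMinus z τ) ∪ spectrum ℂ (P.SPlus z τ) ⊆ Complex.ofReal '' Set.Icc a b ∧
      ∀ M : ℕ+, e (M + 1) ≠ e M →
        (∃ Lstar : ℕ, ∀ L : ℕ, Lstar < L →
          Module.finrank ℂ (LinearMap.range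
            (P.SML z τ φ (ξ L) M L : D.Htilde →ₗ[ℂ] D.Htilde)) = 2 * (M : ℕ) ∧
          spectrum ℂ (P.SML z τ φ (ξ L) M L) ⊆ Complex.ofReal '' Set.Icc a b) ∧
        Filter.Tendsto (fun L : ℕ => P.SML z τ φ (ξ L) M L) Filter.atTop
          (nhds (P.SM z τ ψ M)) ∧
        ResolventCompactification.SpectrallyConverges Filter.atTop
          (fun L : ℕ => P.SML z τ φ (ξ L) M L) (P.SM z τ ψ M)) ∧
    Filter.Tendsto (fun M : ℕ => P.SM z τ ψ M) Filter.atTop (nhds (P.S z τ)) ∧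
    ResolventCompactification.SpectrallyConverges Filter.atTop
      (fun M : ℕ => P.SM z τ ψ M) (P.S z τ) := by
  -- The orthonormal basis `φ` is indexed by the infinite set `ℕ+`.
  have hE : ¬ FiniteDimensional ℂ D.Htilde := fun _ =>
    not_finite_iff_infinite.2 (inferInstance : Infinite ℕ+)
      hφ.orthonormal.linearIndependent.finite
  have hA := P.isPosEigendecomposition_SPlus hτ hψ
  have hnorm := ResolventCompactification.MarkovKernelFamily.norm_restrictTo_resPlus_le (D := D) hz
  have hL : ∀ L, ‖P.SPlusL z τ φ L‖ ≤ lam 1 / z := fun L =>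
    P.norm_sandwich_opAbs_Gtilde_le hz hτ hφ
      ((ResolventCompactification.norm_headProj_mul_mul_le φ L _).trans hnorm)
  have hS : ‖P.SPlus z τ‖ ≤ lam 1 / z := by
    rw [P.SPlus_eq z hτ]
    exact P.norm_sandwich_opAbs_Gtilde_le hz hτ hφ hnorm
  have hSc : IsCompactOperator (P.SPlus z τ) := by
    rw [P.SPlus_eq z hτ]
    exact P.isCompactOperator_sandwich_Gtilde hτ hφ _
  have key := ResolventCompactification.diffCompr_convergence (J := D.conjHtilde) hE hA
    (fun L => P.isPosEigendecomposition_SPlusL hτ (hξ L))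
    (fun x hx y hy => D.inner_conjHtilde_eq_zero hx hy) hSc
    (fun L => P.isCompactOperator_sandwich_Gtilde hτ hφ _) (P.tendsto_SPlusL hz hτ hφ) hL
  have hlam : lam 1 / z < 1 / z := by
    gcongr
    exact P.eigenvalue_lt_one hτ hφ 1
  have hlam0 : 0 ≤ lam 1 / z := (norm_nonneg (P.SPlus z τ)).trans hS
  simp_rw [P.SML_eq z hτ hφ_real, P.SM_eq z hτ]
  rw [ResolventCompactification.MarkovKernelFamily.S, P.SMinus_eq z hτ]
  -- The interval depends only on `λ₁` and `z`, hence serves all `M` and `L` at once.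
  refine ⟨⟨-(lam 1 / z), lam 1 / z, neg_lt_neg hlam, by linarith, hlam, ?_, fun M hM => ?_⟩, key.2⟩
  swap
  · obtain ⟨⟨N, hN⟩, h⟩ := key.1 M hM
    refine ⟨⟨N, fun L hL => ⟨?_, (hN L hL).2⟩⟩, h⟩
    rw [P.SML_eq z hτ hφ_real]
    exact (hN L hL).1
  refine Set.union_subset
    (ResolventCompactification.spectrum_subset_of_norm_le
      (ResolventCompactification.conjOp_nonneg _ hA.nonneg).isSelfAdjoint.neg ?_)
    (ResolventCompactification.spectrum_subset_of_norm_le hA.nonneg.isSelfAdjoint hS)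
  rw [norm_neg]
  exact (ResolventCompactification.norm_conjOp_le _ _).trans hS
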